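/- Identify each ordinal with its set of predecessors. Let $\mathsf{Ord}$ be the category of ordinals and strictly increasing functions, and $\mathsf{Nat}$ its full subcategory of natural numbers. A \emph{pre-dilator} is a functor $D:\mathsf{Nat}\to\mathsf{Ord}$ with a natural transformation $\operatorname{supp}:D\Rightarrow[\cdot]^{<\omega}$ to the finite subset functor such that, for every morphism $f:m\to n$ of $\mathsf{Nat}$ and all $\sigma\in D(n)$, $\operatorname{supp}_n(\sigma)\subseteq\operatorname{rng}(f)$ implies $\sigma\in\operatorname{rng}(D(f))$. Its trace $\operatorname{Tr}(D)$ is the set of pairs $(\sigma,n)$ with $\sigma\in D(n)$ and $\operatorname{supp}_n(\sigma)=n$. For an ordinal $\alpha$ let $\overline D(\alpha)$ be the set of expressions $(\sigma;\gamma_0,\dots,\gamma_{n-1};\alpha)_D$ with $(\sigma,n)\in\operatorname{Tr}(D)$ and $\gamma_0<\dots<\gamma_{n-1}<\alpha$, linearly ordered by $$(\sigma;\gamma_0,\dots,\gamma_{m-1};\alpha)_D<(\tau;\delta_0,\dots,\delta_{n-1};\alpha)_D\iff D(|\iota_c^{c\cup d}|)(\sigma)<D(|\iota_d^{c\cup d}|)(\tau),$$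 where $c=\{\gamma_0,\dots,\gamma_{m-1}\}$, $d=\{\delta_0,\dots,\delta_{n-1}\}$, and $|\iota_c^{c\cup d}|:|c|\to|c\cup d|$ is the strictly increasing map induced by the inclusion $c\subseteq c\cup d$ via the increasing enumerations (similarly for $d$). A pre-dilator is a \emph{dilator} if $\overline D(\alpha)$ is well-founded for every ordinal $\alpha$; then let $D(\alpha)$ be the unique ordinal with an (again unique) order isomorphism $\eta_\alpha:D(\alpha)\to\overline D(\alpha)$. A \emph{normal dilator} is a dilator with a natural transformation $\mu$ from the inclusion $\mathsf{Nat}\to\mathsf{Ord}$ to $D$ such that $\sigma<\mu_n(k)\Leftrightarrow\operatorname{supp}_n(\sigma)\subseteq\{0,\dots,k-1\}$ for all $k<n$ and $\sigma\in D(n)$. Let $D$ be a normal dilator. For $(\sigma,n)\in\operatorname{Tr}(D)$ write $\gamma\simeq(\sigma;\gamma_0,\dots,\gamma_{n-1})_D$ if $\eta_\alpha(\gamma)=(\sigma;\gamma_0,\dots,\gamma_{n-1};\alpha)_D$ for some (equivalently, every) ordinal $\alpha$ with $\gamma<D(\alpha)$. Define $\alpha\leq_1^D\beta$ by recursion on $\beta$: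 it holds if $\alpha\leq\beta$ and, for all finite sets $X\subseteq\alpha$ and $Y\subseteq\beta\setminus\alpha$, there are a finite $\widetilde Y\subseteq\alpha$ and a bijection $f:X\cup Y\to X\cup\widetilde Y$ that fixes $X$ pointwise and preserves and reflects the relations $\leq$, $\leq_1^D$ and, for each $(\sigma,n)\in\operatorname{Tr}(D)$, the $(n+1)$-ary relation $\gamma\simeq(\sigma;\gamma_0,\dots,\gamma_{n-1})_D$. \textbf{Statement.} Let $D$ be a normal dilator, and let $\mathbb A$ be an admissible set (a transitive set that, with the membership relation, is a model of Kripke--Platek set theory) that contains, as an element, the set-sized functor $D:\mathsf{Nat}\to\mathsf{Ord}$. If $\Omega=\mathsf{Ord}\cap\mathbb A$ is the ordinal height of $\mathbb A$, then $\Omega\leq_1^D D(\Omega+1)$. -/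

import Mathlib

universe u

/-! ### Pre-dilators

An ordinal `α` is identified with its set of predecessors `Set.Iio α`, and the finite ordinal `n`
with `Fin n`. Strictly increasing functions between linear orders are order embeddings `↪o`. -/

/-- A pre-dilator: a functor from the category of natural numbers (with strictly increasing
functions) to the category of ordinals, together with a natural transformation `supp` to the finite
subset functor that satisfies the support condition. -/
structure PreDilator : Type (u + 1) where
  /-- the action on objects -/
  obj : ℕ → Ordinal.{u}
  /-- the action on morphisms -/
  map : ∀ {m n : ℕ}, (Fin m ↪o Fin n) → (Set.Iio (obj m) ↪o Set.Iio (obj n))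
  map_id : ∀ (n : ℕ) (σ : Set.Iio (obj n)), map (RelEmbedding.refl _ : Fin n ↪o Fin n) σ = σ
  map_comp : ∀ {k m n : ℕ} (f : Fin k ↪o Fin m) (g : Fin m ↪o Fin n) (σ : Set.Iio (obj k)),
    map (f.trans g) σ = map g (map f σ)
  /-- the supports -/
  supp : ∀ n : ℕ, Set.Iio (obj n) → Finset (Fin n)
  supp_map : ∀ {m n : ℕ} (f : Fin m ↪o Fin n) (σ : Set.Iio (obj m)),
    supp n (map f σ) = (supp m σ).image f
  support_condition : ∀ {m n : ℕ} (f : Fin m ↪o Fin n) (σ : Set.Iio (obj n)),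
    (supp n σ : Set (Fin n)) ⊆ Set.range f → σ ∈ Set.range (map f)

namespace PreDilator

/-- `(σ, n)` belongs to the trace of `D`, i.e. `σ ∈ D(n)` has full support. -/
def InTrace (D : PreDilator.{u}) (n : ℕ) (σ : Set.Iio (D.obj n)) : Prop :=
  D.supp n σ = Finset.univ

/-- The expressions `(σ; γ₀, …, γₙ₋₁; α)` with `(σ, n)` in the trace of `D` and
`γ₀ < ⋯ < γₙ₋₁ < α`. -/
@[ext]
structure Expr (D : PreDilator.{u}) (α : Ordinal.{u}) : Type (u + 1) where
  /-- the number of arguments -/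
  arity : ℕ
  /-- the constructor symbol -/
  symb : Set.Iio (D.obj arity)
  inTrace : D.InTrace arity symb
  /-- the increasing list of arguments -/
  args : Fin arity ↪o Set.Iio α

variable {D : PreDilator.{u}} {α : Ordinal.{u}}

/-- The set of arguments of an expression. -/
noncomputable def Expr.argSet (s : D.Expr α) : Finset (Set.Iio α) := Finset.univ.image s.args

theorem Expr.args_mem (s : D.Expr α) (i : Fin s.arity) : s.args i ∈ s.argSet :=
  Finset.mem_image_of_mem _ (Finset.mem_univ i)

/-- For an increasing list `a` of length `n` with range `c ⊆ e`, this is the map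
`|ι| : n = |c| → |e|` induced by the inclusion `ι : c → e`: it sends `i` to the position of `a i`
in the increasing enumeration of `e`. -/
noncomputable def position {n : ℕ} (a : Fin n ↪o Set.Iio α) (e : Finset (Set.Iio α)) (h : ∀ i, a i ∈ e) :
    Fin n ↪o Fin e.card :=
  OrderEmbedding.ofStrictMono (fun i => (e.orderIsoOfFin rfl).symm ⟨a i, h i⟩)
    (fun _ _ hij => (e.orderIsoOfFin rfl).symm.strictMono
      (Subtype.mk_lt_mk.2 (a.strictMono hij)))

theorem position_def {n : ℕ} (a : Fin n ↪o Set.Iio α) (e : Finset (Set.Iio α)) (h : ∀ i, a i ∈ e)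
    (i : Fin n) : position a e h i = (e.orderIsoOfFin rfl).symm ⟨a i, h i⟩ := rfl

/-- The order on expressions: `s < t` if and only if `D(|ι|)(σ) < D(|κ|)(τ)`, where `σ`, `τ` are the
constructor symbols and `c`, `d` the argument sets of `s`, `t`, and where `ι : c → c ∪ d` and
`κ : d → c ∪ d` are the inclusions. -/
def Expr.lt (s t : D.Expr α) : Prop :=
  D.map (position s.args (s.argSet ∪ t.argSet)
      (fun i => Finset.mem_union_left _ (s.args_mem i))) s.symb <
    D.map (position t.args (s.argSet ∪ t.argSet)
      (fun i => Finset.mem_union_right _ (t.args_mem i))) t.symb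

theorem map_position_eq {n : ℕ} (a : Fin n ↪o Set.Iio α) (σ : Set.Iio (D.obj n))
    (e e' : Finset (Set.Iio α)) (h : ∀ i, a i ∈ e) (hee : ∀ x : e, (x : Set.Iio α) ∈ e') :
    D.map (position a e' (fun i => hee ⟨_, h i⟩)) σ =
      D.map (position (e.orderEmbOfFin rfl) e'
        (fun i => hee ⟨_, e.orderEmbOfFin_mem rfl i⟩)) (D.map (position a e h) σ) := by
  rw [← D.map_comp]
  congr 2
  ext i
  simp [position_def, ← Finset.coe_orderIsoOfFin_apply]

theorem Expr.lt_iff (s t : D.Expr α) (e : Finset (Set.Iio α)) (hs : ∀ i, s.args i ∈ e)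
    (ht : ∀ i, t.args i ∈ e) :
    s.lt t ↔ D.map (position s.args e hs) s.symb < D.map (position t.args e ht) t.symb := by
  have hee : ∀ x : (s.argSet ∪ t.argSet : Finset _), (x : Set.Iio α) ∈ e := by
    rintro ⟨x, hx⟩
    rcases Finset.mem_union.1 hx with hx | hx
    · obtain ⟨i, -, rfl⟩ := Finset.mem_image.1 hx
      exact hs i
    · obtain ⟨i, -, rfl⟩ := Finset.mem_image.1 hx
      exact ht i
  rw [map_position_eq s.args s.symb _ e
      (fun i => Finset.mem_union_left t.argSet (s.args_mem i)) hee,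
    map_position_eq t.args t.symb _ e
      (fun i => Finset.mem_union_right s.argSet (t.args_mem i)) hee,
    OrderEmbedding.lt_iff_lt]
  rfl

theorem position_apply {n : ℕ} (a : Fin n ↪o Set.Iio α) (e : Finset (Set.Iio α))
    (h : ∀ i, a i ∈ e) (i : Fin n) : e.orderEmbOfFin rfl (position a e h i) = a i := by
  simp [position_def, ← Finset.coe_orderIsoOfFin_apply]

theorem Expr.eq_of_map_eq (s t : D.Expr α) (e : Finset (Set.Iio α)) (hs : ∀ i, s.args i ∈ e)
    (ht : ∀ i, t.args i ∈ e)
    (h : D.map (position s.args e hs) s.symb = D.map (position t.args e ht) t.symb) : s = t := by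
  obtain ⟨m, σ, hσ, a⟩ := s
  obtain ⟨n, τ, hτ, b⟩ := t
  dsimp only at hs ht h
  have hsupp := congrArg (D.supp _) h
  rw [D.supp_map, D.supp_map, hσ, hτ] at hsupp
  have hr : Set.range a = Set.range b := by
    have h2 := congrArg (fun s : Finset (Fin e.card) => (e.orderEmbOfFin rfl) '' (s : Set _)) hsupp
    simp only [Finset.coe_image, Finset.coe_univ, Set.image_univ, ← Set.range_comp] at h2
    have h3 : ∀ {k : ℕ} (c : Fin k ↪o Set.Iio α) (hc : ∀ i, c i ∈ e),
        (e.orderEmbOfFin rfl) ∘ (position c e hc) = c := fun c hc => by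
      ext1 i
      exact position_apply c e hc i
    rwa [h3, h3] at h2
  have hmn : m = n := by
    have := congrArg Set.ncard hr
    rwa [← Set.image_univ, ← Set.image_univ, Set.ncard_image_of_injective _ a.injective,
      Set.ncard_image_of_injective _ b.injective, Set.ncard_univ, Set.ncard_univ,
      Nat.card_fin, Nat.card_fin] at this
  subst hmn
  have hab : a = b := by
    apply DFunLike.coe_injective
    exact (StrictMono.range_inj a.strictMono b.strictMono).1 hr
  subst hab
  have := (D.map _).injective h
  subst this
  rfl

/-- The order on expressions is a strict linear order. -/
instance Expr.isStrictTotalOrder (D : PreDilator.{u}) (α : Ordinal.{u}) :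
    IsStrictTotalOrder (D.Expr α) Expr.lt where
  irrefl s := lt_irrefl _
  trans r s t h₁ h₂ := by
    have hr : ∀ i, r.args i ∈ r.argSet ∪ s.argSet ∪ t.argSet := fun i => by simp [r.args_mem i]
    have hs : ∀ i, s.args i ∈ r.argSet ∪ s.argSet ∪ t.argSet := fun i => by simp [s.args_mem i]
    have ht : ∀ i, t.args i ∈ r.argSet ∪ s.argSet ∪ t.argSet := fun i => by simp [t.args_mem i]
    rw [Expr.lt_iff _ _ _ hr hs] at h₁
    rw [Expr.lt_iff _ _ _ hs ht] at h₂
    rw [Expr.lt_iff _ _ _ hr ht]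
    exact h₁.trans h₂
  trichotomous s t h₁ h₂ := by
    have hs : ∀ i, s.args i ∈ s.argSet ∪ t.argSet := fun i => by simp [s.args_mem i]
    have ht : ∀ i, t.args i ∈ s.argSet ∪ t.argSet := fun i => by simp [t.args_mem i]
    rw [Expr.lt_iff _ _ _ hs ht] at h₁
    rw [Expr.lt_iff _ _ _ ht hs] at h₂
    exact Expr.eq_of_map_eq s t _ hs ht (le_antisymm (not_lt.1 h₂) (not_lt.1 h₁))

instance Expr.small (D : PreDilator.{u}) (α : Ordinal.{u}) : Small.{u} (D.Expr α) :=
  small_of_injective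
    (β := Σ n : ℕ, Set.Iio (D.obj n) × (Fin n → Set.Iio α))
    (f := fun s => ⟨s.arity, s.symb, s.args⟩) (by
      rintro ⟨m, σ, hσ, a⟩ ⟨n, τ, hτ, b⟩ h
      simp only [Sigma.mk.injEq] at h
      obtain ⟨rfl, h⟩ := h
      simp only [heq_eq_eq, Prod.mk.injEq, DFunLike.coe_fn_eq] at h
      obtain ⟨rfl, rfl⟩ := h
      rfl)

end PreDilator

/-! ### Dilators and normal dilators -/

/-- A dilator: a pre-dilator such that, for every ordinal `α`, the linear order of expressions
`(σ; γ₀, …, γₙ₋₁; α)` is well-founded. -/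
structure Dilator : Type (u + 1) extends PreDilator.{u} where
  wf : ∀ α : Ordinal.{u}, WellFounded (PreDilator.Expr.lt (D := toPreDilator) (α := α))

namespace Dilator

theorem exists_value (D : Dilator.{u}) (α : Ordinal.{u}) :
    ∃ δ : Ordinal.{u}, Nonempty ((fun x y : Set.Iio δ => x < y) ≃r
      (PreDilator.Expr.lt (D := D.toPreDilator) (α := α))) := by
  let e := equivShrink.{u} (D.toPreDilator.Expr α)
  let r : Shrink.{u} (D.toPreDilator.Expr α) → Shrink.{u} (D.toPreDilator.Expr α) → Prop :=
    e.symm ⁻¹'o PreDilator.Expr.lt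
  let E : r ≃r (PreDilator.Expr.lt (D := D.toPreDilator) (α := α)) := RelIso.preimage e.symm _
  have : IsWellFounded _ (PreDilator.Expr.lt (D := D.toPreDilator) (α := α)) := ⟨D.wf α⟩
  have : IsWellOrder _ (PreDilator.Expr.lt (D := D.toPreDilator) (α := α)) := {}
  have : IsWellOrder _ r := E.toRelEmbedding.isWellOrder
  exact ⟨Ordinal.type r, ⟨(Ordinal.enum r).trans E⟩⟩

/-- The value `D(α)`: the ordinal isomorphic to the well-order of expressions
`(σ; γ₀, …, γₙ₋₁; α)`. -/
noncomputable def value (D : Dilator.{u}) (α : Ordinal.{u}) : Ordinal.{u} :=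
  Classical.choose (D.exists_value α)

/-- The (unique) order isomorphism from `D(α)` to the order of expressions
`(σ; γ₀, …, γₙ₋₁; α)`. -/
noncomputable def eta (D : Dilator.{u}) (α : Ordinal.{u}) :
    (fun x y : Set.Iio (D.value α) => x < y) ≃r
      (PreDilator.Expr.lt (D := D.toPreDilator) (α := α)) :=
  Classical.choice (Classical.choose_spec (D.exists_value α))

/-- The relation `γ ≃ (σ; γ₀, …, γₙ₋₁)_D`: for some ordinal `α` with `γ < D(α)`, the isomorphism
`η_α` sends `γ` to the expression `(σ; γ₀, …, γₙ₋₁; α)`. -/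
def Represents (D : Dilator.{u}) {n : ℕ} (σ : Set.Iio (D.obj n)) (g : Fin n → Ordinal.{u})
    (γ : Ordinal.{u}) : Prop :=
  ∃ (α : Ordinal.{u}) (hγ : γ < D.value α) (hσ : D.InTrace n σ) (a : Fin n ↪o Set.Iio α),
    (∀ i, (a i : Ordinal.{u}) = g i) ∧ D.eta α ⟨γ, hγ⟩ = ⟨n, σ, hσ, a⟩

end Dilator

/-- A normal dilator: a dilator with a natural transformation `μ` from the inclusion functor
(of natural numbers into ordinals) to `D` that satisfies the normality condition. -/
structure NormalDilator : Type (u + 1) extends Dilator.{u} where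
  /-- the natural transformation -/
  mu : ∀ n : ℕ, Fin n ↪o Set.Iio (obj n)
  mu_map : ∀ {m n : ℕ} (f : Fin m ↪o Fin n) (k : Fin m), map f (mu m k) = mu n (f k)
  normality : ∀ (n : ℕ) (k : Fin n) (σ : Set.Iio (obj n)),
    σ < mu n k ↔ ∀ i ∈ supp n σ, i < k

/-! ### Patterns of resemblance relative to a normal dilator -/

namespace NormalDilator

/-- `f : X → Z` is an isomorphism of structures for the language that consists of `≤`, of a binary
relation symbol interpreted by `R`, and of the relation symbols `γ ≃ (σ; γ₀, …, γₙ₋₁)_D` for all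
`(σ, n)` in the trace of `D`. -/
structure IsIsomorphism (D : NormalDilator.{u}) (R : Ordinal.{u} → Ordinal.{u} → Prop)
    (X Z : Set Ordinal.{u}) (f : Ordinal.{u} → Ordinal.{u}) : Prop where
  bijOn : Set.BijOn f X Z
  le_iff : ∀ γ ∈ X, ∀ δ ∈ X, γ ≤ δ ↔ f γ ≤ f δ
  rel_iff : ∀ γ ∈ X, ∀ δ ∈ X, R γ δ ↔ R (f γ) (f δ)
  represents_iff : ∀ (n : ℕ) (σ : Set.Iio (D.obj n)), D.InTrace n σ →
    ∀ γ ∈ X, ∀ g : Fin n → Ordinal.{u}, (∀ i, g i ∈ X) →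
      (D.Represents σ g γ ↔ D.Represents σ (fun i => f (g i)) (f γ))

/-- The relation `α ≤₁ β` relative to `D`, by recursion on `β`; see `leOne_iff` for the
characterization without the bound that makes the recursion explicit. -/
def LeOne (D : NormalDilator.{u}) (α β : Ordinal.{u}) : Prop :=
  α ≤ β ∧ ∀ X Y : Set Ordinal.{u}, X.Finite → Y.Finite → X ⊆ Set.Iio α → Y ⊆ Set.Iio β \ Set.Iio α →
    ∃ Y' : Set Ordinal.{u}, Y'.Finite ∧ Y' ⊆ Set.Iio α ∧ ∃ f : Ordinal.{u} → Ordinal.{u},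
      D.IsIsomorphism (fun γ δ => ∃ _h : δ < β, D.LeOne γ δ) (X ∪ Y) (X ∪ Y') f ∧
        ∀ γ ∈ X, f γ = γ
termination_by β

/-- `α ≤₁ β` holds if and only if `α ≤ β` and, for all finite `X ⊆ α` and `Y ⊆ β \ α`, there are a
finite `Y' ⊆ α` and an isomorphism `f : X ∪ Y → X ∪ Y'` that fixes `X`, with respect to the language
that includes `≤₁` itself. -/
theorem leOne_iff (D : NormalDilator.{u}) (α β : Ordinal.{u}) :
    D.LeOne α β ↔ α ≤ β ∧ ∀ X Y : Set Ordinal.{u}, X.Finite → Y.Finite → X ⊆ Set.Iio α →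
      Y ⊆ Set.Iio β \ Set.Iio α →
      ∃ Y' : Set Ordinal.{u}, Y'.Finite ∧ Y' ⊆ Set.Iio α ∧ ∃ f : Ordinal.{u} → Ordinal.{u},
        D.IsIsomorphism D.LeOne (X ∪ Y) (X ∪ Y') f ∧ ∀ γ ∈ X, f γ = γ := by
  rw [LeOne]
  refine and_congr_right fun hαβ => ?_
  refine forall₂_congr fun X Y => forall₄_congr fun _ _ hX hY => exists_congr fun Y' =>
    and_congr_right fun _ => and_congr_right fun hY' => exists_congr fun f =>
    and_congr_left fun _ => ?_
  have h1 : ∀ γ ∈ X ∪ Y, γ < β := by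
    rintro γ (h | h)
    · exact lt_of_lt_of_le (hX h) hαβ
    · exact (hY h).1
  have h2 : ∀ γ ∈ X ∪ Y', γ < β := by
    rintro γ (h | h)
    · exact lt_of_lt_of_le (hX h) hαβ
    · exact lt_of_lt_of_le (hY' h) hαβ
  constructor
  · rintro ⟨b, l, r, p⟩
    refine ⟨b, l, fun γ hγ δ hδ => ?_, p⟩
    simpa [h1 δ hδ, h2 _ (b.mapsTo hδ)] using r γ hγ δ hδ
  · rintro ⟨b, l, r, p⟩
    refine ⟨b, l, fun γ hγ δ hδ => ?_, p⟩
    simpa [h1 δ hδ, h2 _ (b.mapsTo hδ)] using r γ hγ δ hδ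

end NormalDilator

/-! ### Pre-dilators as sets -/

/-- The von Neumann numeral `n`. -/
noncomputable def natSet (n : ℕ) : ZFSet.{u} := (n : Ordinal.{u}).toZFSet

/-- A morphism `f : m → n` between finite ordinals as a set: the triple of its domain, its codomain
and its graph. -/
noncomputable def natMorphismSet {m n : ℕ} (f : Fin m ↪o Fin n) : ZFSet.{u} :=
  ZFSet.pair (natSet m) (ZFSet.pair (natSet n)
    (ZFSet.range (fun i : Fin m => ZFSet.pair (natSet i) (natSet (f i)))))

/-- A morphism `f : α → β` between ordinals as a set: the triple of its domain, its codomain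
and its graph. -/
noncomputable def ordMorphismSet {α β : Ordinal.{u}} (f : Set.Iio α ↪o Set.Iio β) : ZFSet.{u} :=
  ZFSet.pair α.toZFSet (ZFSet.pair β.toZFSet
    (ZFSet.range (fun x : Set.Iio α => ZFSet.pair x.1.toZFSet (f x).1.toZFSet)))

/-- The functor `D` from natural numbers to ordinals as a set: the pair that consists of the graph
of its action on objects and the graph of its action on morphisms. -/
noncomputable def PreDilator.toSet (D : PreDilator.{u}) : ZFSet.{u} :=
  ZFSet.pair (ZFSet.range (fun n : ℕ => ZFSet.pair (natSet n) (D.obj n).toZFSet))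
    (ZFSet.range (fun f : Σ m n : ℕ, Fin m ↪o Fin n =>
      ZFSet.pair (natMorphismSet f.2.2) (ordMorphismSet (D.map f.2.2))))

/-! ### Admissible sets -/

namespace KripkePlatek

open FirstOrder FirstOrder.Language

/-- The only non-logical symbol of set theory: the membership relation. -/
inductive SetRel : ℕ → Type
  | mem : SetRel 2

/-- The first-order language of set theory (equality is a logical symbol). -/
def setLang : FirstOrder.Language.{0, 0} := ⟨fun _ => Empty, SetRel⟩

/-- A set as a structure for the language of set theory, with the true membership relation. -/
instance setStructure (A : ZFSet.{u}) : setLang.Structure {x : ZFSet.{u} // x ∈ A} where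
  funMap := fun f _ => Empty.elim f
  RelMap := fun r => match r with
    | SetRel.mem => fun v => (v 0).1 ∈ (v 1).1

/-- Formulas with variables `0, …, n - 1`. -/
abbrev Fml (n : ℕ) : Type := setLang.BoundedFormula Empty n

/-- The formula `xᵢ = xⱼ`. -/
def eqFml {n : ℕ} (i j : Fin n) : Fml n :=
  BoundedFormula.equal (Term.var (Sum.inr i)) (Term.var (Sum.inr j))

/-- The formula `xᵢ ∈ xⱼ`. -/
def memFml {n : ℕ} (i j : Fin n) : Fml n :=
  BoundedFormula.rel (L := setLang) SetRel.mem ![Term.var (Sum.inr i), Term.var (Sum.inr j)]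

/-- The `Δ₀`-formulas: the formulas built from atomic ones by propositional connectives (all of
which come from `⊥` and `→`) and bounded quantification `∀ xₙ ∈ xᵢ, φ(x₀, …, xₙ)` (by negation, this
also covers bounded existential quantification). -/
inductive IsDeltaZero : ∀ {n : ℕ}, Fml n → Prop
  | falsum {n : ℕ} : IsDeltaZero (BoundedFormula.falsum : Fml n)
  | equal {n : ℕ} (i j : Fin n) : IsDeltaZero (eqFml i j)
  | mem {n : ℕ} (i j : Fin n) : IsDeltaZero (memFml i j)
  | imp {n : ℕ} {φ ψ : Fml n} : IsDeltaZero φ → IsDeltaZero ψ → IsDeltaZero (φ.imp ψ)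
  | ball {n : ℕ} (i : Fin n) {φ : Fml (n + 1)} : IsDeltaZero φ →
      IsDeltaZero (BoundedFormula.all ((memFml (Fin.last n) i.castSucc).imp φ))

/-- Satisfaction `A ⊨ φ(v₀, …, vₙ₋₁)`. -/
def Sat {A : ZFSet.{u}} {n : ℕ} (φ : Fml n) (v : Fin n → {x : ZFSet.{u} // x ∈ A}) : Prop :=
  φ.Realize Empty.elim v

theorem sat_eqFml {A : ZFSet.{u}} {n : ℕ} (i j : Fin n) (v : Fin n → {x : ZFSet.{u} // x ∈ A}) :
    Sat (eqFml i j) v ↔ v i = v j := by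
  simp [Sat, eqFml, BoundedFormula.Realize]

theorem sat_memFml {A : ZFSet.{u}} {n : ℕ} (i j : Fin n) (v : Fin n → {x : ZFSet.{u} // x ∈ A}) :
    Sat (memFml i j) v ↔ (v i).1 ∈ (v j).1 := by
  simp [Sat, memFml, BoundedFormula.Realize, Structure.RelMap]

/-- The axioms of Kripke–Platek set theory hold in `A` (with the true membership relation). The
schemata range over formulas with arbitrary parameters `p` from `A`. -/
structure ModelsKP (A : ZFSet.{u}) : Prop where
  nonempty : Nonempty {x : ZFSet.{u} // x ∈ A}
  extensionality : ∀ a b : {x : ZFSet.{u} // x ∈ A},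
    (∀ x : {x : ZFSet.{u} // x ∈ A}, x.1 ∈ a.1 ↔ x.1 ∈ b.1) → a = b
  foundation : ∀ {n : ℕ} (φ : Fml (n + 1)) (p : Fin n → {x : ZFSet.{u} // x ∈ A}),
    (∃ x, Sat φ (Fin.snoc p x)) →
      ∃ x, Sat φ (Fin.snoc p x) ∧
        ∀ y : {x : ZFSet.{u} // x ∈ A}, y.1 ∈ x.1 → ¬ Sat φ (Fin.snoc p y)
  pairing : ∀ a b : {x : ZFSet.{u} // x ∈ A}, ∃ c : {x : ZFSet.{u} // x ∈ A},
    a.1 ∈ c.1 ∧ b.1 ∈ c.1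
  union : ∀ a : {x : ZFSet.{u} // x ∈ A}, ∃ c : {x : ZFSet.{u} // x ∈ A},
    ∀ x y : {x : ZFSet.{u} // x ∈ A}, y.1 ∈ a.1 → x.1 ∈ y.1 → x.1 ∈ c.1
  separation : ∀ {n : ℕ} (φ : Fml (n + 1)), IsDeltaZero φ →
    ∀ (p : Fin n → {x : ZFSet.{u} // x ∈ A}) (a : {x : ZFSet.{u} // x ∈ A}),
      ∃ b : {x : ZFSet.{u} // x ∈ A}, ∀ x : {x : ZFSet.{u} // x ∈ A},
        x.1 ∈ b.1 ↔ x.1 ∈ a.1 ∧ Sat φ (Fin.snoc p x)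
  collection : ∀ {n : ℕ} (φ : Fml (n + 2)), IsDeltaZero φ →
    ∀ (p : Fin n → {x : ZFSet.{u} // x ∈ A}) (a : {x : ZFSet.{u} // x ∈ A}),
      (∀ x : {x : ZFSet.{u} // x ∈ A}, x.1 ∈ a.1 →
        ∃ y, Sat φ (Fin.snoc (Fin.snoc p x : Fin (n + 1) → _) y)) →
      ∃ b : {x : ZFSet.{u} // x ∈ A}, ∀ x : {x : ZFSet.{u} // x ∈ A}, x.1 ∈ a.1 →
        ∃ y : {x : ZFSet.{u} // x ∈ A}, y.1 ∈ b.1 ∧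
          Sat φ (Fin.snoc (Fin.snoc p x : Fin (n + 1) → _) y)

end KripkePlatek

/-- An admissible set: a transitive model of Kripke–Platek set theory. -/
structure IsAdmissibleSet (A : ZFSet.{u}) : Prop where
  transitive : A.IsTransitive
  modelsKP : KripkePlatek.ModelsKP A

/-- The ordinals in a transitive set form an ordinal. -/
theorem exists_ordinal_height (A : ZFSet.{u}) (hA : A.IsTransitive) :
    ∃ Ω : Ordinal.{u}, Ω.toZFSet = A.sep ZFSet.IsOrdinal := by
  have h : (A.sep ZFSet.IsOrdinal).IsOrdinal := by
    rw [ZFSet.isOrdinal_iff_forall_mem_isOrdinal]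
    refine ⟨fun y hy x hx => ?_, fun y hy => (ZFSet.mem_sep.1 hy).2⟩
    rw [ZFSet.mem_sep] at hy ⊢
    exact ⟨hA _ hy.1 hx, hy.2.mem hx⟩
  exact ⟨_, h.toZFSet_rank_eq⟩

/-!
An ordinal `γ` is represented by a pair `(σ, c)` of a constructor symbol and a finite set of
arguments (`NormalDilator.term`). Write `γ[a ↦ b]` for the ordinal that results when the argument
`a` is replaced by `b` (`NormalDilator.subst`). By normality, `γ < D(α)` means that the arguments
of `γ` lie below `α`. As the admissible set `A` is closed under `α ↦ D(α)`, its height `Ω` is a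
fixed point of `D`, and the ordinals `t` with `Ω ≤ t < D(Ω + 1)` are those with largest argument
`Ω`.

The combinatorial core is `NormalDilator.leOne_of_reflection`: a fixed point `κ` of `D` satisfies
`κ ≤₁ θ`, for `θ ≤ D(κ + 1)`, if for all `s` with `κ ≤ s < θ` there are arbitrarily large fixed
points `δ < κ` with `δ ≤₁ s[κ ↦ δ]`. Given finite sets `X` and `Y`, the map `γ ↦ γ[κ ↦ δ]`, with
`δ` chosen for `s = max Y`, is the desired isomorphism. It respects `≤₁` since ordinals strictly
between `κ` and `D(κ + 1)` are not fixed points of `D` and hence are only related to themselves,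
while relations that start in `X` transfer between `δ` and `κ` if `δ` is large.

For `κ = Ω` and `θ = D(Ω + 1)`, the reflection property is `Admissible.exists_reflection`. It is
proved by induction on `t = s`. If it holds for all ordinals below `t`, then for all large `κ < Ω`
and each `ξ` with `D(κ) ≤ ξ < t[Ω ↦ κ]` there is a fixed point `δ > κ` with `δ ≤₁ ξ[κ ↦ δ]`. As
`t[Ω ↦ κ]` is an element of `A`, collection bounds these `δ`. Iteration along `ω`, which belongs to
`A` because `D` does, leads to a limit `δ < Ω` that is closed under the bounds, and
`leOne_of_reflection` yields `δ ≤₁ t[Ω ↦ δ]`.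

Collection and the iteration require that all notions involved are `Δ₁` in `A`. Objects of a type
`T` are coded by elements of `A` (`Admissible.Coded`), and `SigmaFun A f` says that a function
between such types has a `Σ₁` graph; decidable properties are functions into `Prop`. Closure
properties and the recursion theorem `Admissible.sigma_recursion` show that the action of `D`, the
collapse of terms to ordinals (`val_recursion`) and the relation `≤₁` itself (`leOne_recursion`)
are recursive in this sense.
-/

set_option linter.unusedSectionVars false

/-! ### `Δ₀` and `Σ₁` relations on an admissible set -/

namespace Admissible

open KripkePlatek

/-- The elements of the set `A`, as a type. -/
abbrev El (A : ZFSet.{u}) : Type (u + 1) := {x : ZFSet.{u} // x ∈ A}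

/-- Extension of an environment `v` by a value for the new variable `none`. -/
def ext {Γ : Type} {X : Type*} (v : Γ → X) (x : X) : Option Γ → X := fun o => o.elim x v

@[simp] theorem ext_none {Γ : Type} {X : Type*} (v : Γ → X) (x : X) : ext v x none = x := rfl
@[simp] theorem ext_some {Γ : Type} {X : Type*} (v : Γ → X) (x : X) (i : Γ) :
    ext v x (some i) = v i := rfl

variable {A : ZFSet.{u}} {Γ Δ : Type}

/-- `R` is a `Δ₀` relation with parameters in `A`, on environments that assign an element of `A` to
each variable in `Γ`. The finite set `P` consists of the parameters. Whatever variable `s i`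
represents `i : Γ` and whatever variable `q a` represents the parameter `a`, there is a
corresponding `Δ₀`-formula. -/
def IsDeltaRel (R : (Γ → El A) → Prop) : Prop :=
  ∃ P : Set (El A), P.Finite ∧ ∀ (n : ℕ) (s : Γ → Fin n) (q : El A → Fin n),
    ∃ φ : Fml n, IsDeltaZero φ ∧
      ∀ w : Fin n → El A, (∀ a ∈ P, w (q a) = a) → (Sat φ w ↔ R (w ∘ s))

theorem sat_imp {n : ℕ} {φ ψ : Fml n} {v : Fin n → El A} : Sat (φ.imp ψ) v ↔ (Sat φ v → Sat ψ v) :=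
  FirstOrder.Language.BoundedFormula.realize_imp

theorem sat_all {n : ℕ} {φ : Fml (n + 1)} {v : Fin n → El A} :
    Sat φ.all v ↔ ∀ x, Sat φ (Fin.snoc v x) :=
  FirstOrder.Language.BoundedFormula.realize_all

namespace IsDeltaRel

theorem rename {R : (Γ → El A) → Prop} (h : IsDeltaRel R) (f : Γ → Δ) :
    IsDeltaRel (fun v : Δ → El A => R (fun i => v (f i))) := by
  obtain ⟨P, hP, h⟩ := h
  exact ⟨P, hP, fun n s q => h n (s ∘ f) q⟩

/-- Substitution of a parameter for a variable. -/
theorem const {R : (Option Γ → El A) → Prop} (h : IsDeltaRel R) (c : El A) :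
    IsDeltaRel (fun v : Γ → El A => R (ext v c)) := by
  obtain ⟨P, hP, h⟩ := h
  refine ⟨insert c P, hP.insert c, fun n s q => ?_⟩
  obtain ⟨φ, hφ, hw⟩ := h n (ext s (q c)) q
  refine ⟨φ, hφ, fun w hc => ?_⟩
  rw [hw w fun a ha => hc a (Set.mem_insert_of_mem _ ha)]
  have : w ∘ ext s (q c) = ext (w ∘ s) c := by
    funext o
    cases o
    · exact hc c (Set.mem_insert _ _)
    · rfl
  rw [this]

theorem of_iff {R S : (Γ → El A) → Prop} (h : IsDeltaRel R) (e : ∀ v, S v ↔ R v) :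
    IsDeltaRel S := by
  rwa [show S = R from funext fun v => propext (e v)]

theorem false : IsDeltaRel (fun _ : Γ → El A => False) :=
  ⟨∅, Set.finite_empty, fun _ _ _ => ⟨_, .falsum, fun _ _ => Iff.rfl⟩⟩

theorem eq (i j : Γ) : IsDeltaRel (fun v : Γ → El A => v i = v j) :=
  ⟨∅, Set.finite_empty, fun _ s _ => ⟨_, .equal (s i) (s j), fun _ _ => sat_eqFml _ _ _⟩⟩

theorem mem (i j : Γ) : IsDeltaRel (fun v : Γ → El A => (v i).1 ∈ (v j).1) :=
  ⟨∅, Set.finite_empty, fun _ s _ => ⟨_, .mem (s i) (s j), fun _ _ => sat_memFml _ _ _⟩⟩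

theorem imp {R S : (Γ → El A) → Prop} (hR : IsDeltaRel R) (hS : IsDeltaRel S) :
    IsDeltaRel (fun v => R v → S v) := by
  obtain ⟨P, hP, hR⟩ := hR
  obtain ⟨Q, hQ, hS⟩ := hS
  refine ⟨P ∪ Q, hP.union hQ, fun n s q => ?_⟩
  obtain ⟨φ, hφ, h1⟩ := hR n s q
  obtain ⟨ψ, hψ, h2⟩ := hS n s q
  refine ⟨_, hφ.imp hψ, fun w hw => ?_⟩
  rw [sat_imp, h1 w fun a ha => hw a (.inl ha), h2 w fun a ha => hw a (.inr ha)]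

theorem ball (i : Γ) {R : (Γ → El A) → El A → Prop}
    (h : IsDeltaRel (fun w : Option Γ → El A => R (fun i => w (some i)) (w none))) :
    IsDeltaRel (fun v : Γ → El A => ∀ x : El A, x.1 ∈ (v i).1 → R v x) := by
  obtain ⟨P, hP, h⟩ := h
  refine ⟨P, hP, fun n s q => ?_⟩
  obtain ⟨φ, hφ, hw⟩ := h (n + 1) (ext (fun i => (s i).castSucc) (Fin.last n))
    (fun a => (q a).castSucc)
  refine ⟨_, .ball (s i) hφ, fun w hP => ?_⟩
  rw [sat_all]
  refine forall_congr' fun x => ?_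
  rw [sat_imp, sat_memFml, hw _ (fun a ha => by rw [Fin.snoc_castSucc]; exact hP a ha)]
  simp only [Fin.snoc_last, Fin.snoc_castSucc, Function.comp_apply, ext_none, ext_some]
  rfl

theorem not {R : (Γ → El A) → Prop} (h : IsDeltaRel R) : IsDeltaRel (fun v => ¬ R v) := h.imp false

theorem or {R S : (Γ → El A) → Prop} (hR : IsDeltaRel R) (hS : IsDeltaRel S) :
    IsDeltaRel (fun v => R v ∨ S v) := (hR.not.imp hS).of_iff fun _ => by tauto

theorem and {R S : (Γ → El A) → Prop} (hR : IsDeltaRel R) (hS : IsDeltaRel S) :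
    IsDeltaRel (fun v => R v ∧ S v) := (hR.not.or hS.not).not.of_iff fun _ => by tauto

theorem bex (i : Γ) {R : (Γ → El A) → El A → Prop}
    (h : IsDeltaRel (fun w : Option Γ → El A => R (fun i => w (some i)) (w none))) :
    IsDeltaRel (fun v : Γ → El A => ∃ x : El A, x.1 ∈ (v i).1 ∧ R v x) :=
  (ball i (R := fun v x => ¬ R v x) h.not).not.of_iff fun _ => by push Not; rfl

/-- A `Δ₀` relation is defined by a single `Δ₀`-formula in the format of the separation scheme:
the values of `v` and the parameters are listed first, the distinguished variable comes last. -/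
theorem exists_fml_one [Finite Γ] {R : (Option Γ → El A) → Prop} (h : IsDeltaRel R) (v : Γ → El A) :
    ∃ (n : ℕ) (φ : Fml (n + 1)) (p : Fin n → El A), IsDeltaZero φ ∧
      ∀ x, Sat φ (Fin.snoc p x) ↔ R (ext v x) := by
  classical
  obtain ⟨P, hP, h⟩ := h
  have hQ : (P ∪ Set.range v).Finite := hP.union (Set.finite_range v)
  have := hQ.to_subtype
  obtain ⟨n, ⟨e⟩⟩ := Finite.exists_equiv_fin (P ∪ Set.range v : Set (El A))
  obtain ⟨φ, hφ, hw⟩ := h (n + 1)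
    (ext (fun i => (e ⟨v i, .inr ⟨i, rfl⟩⟩).castSucc) (Fin.last n))
    (fun a => if ha : a ∈ P ∪ Set.range v then (e ⟨a, ha⟩).castSucc else Fin.last n)
  refine ⟨n, φ, fun i => (e.symm i).1, hφ, fun x => ?_⟩
  rw [hw]
  · refine iff_of_eq (congrArg R ?_)
    funext o
    cases o <;> simp
  · intro a ha
    have ha' : a ∈ P ∪ Set.range v := Or.inl ha
    rw [dif_pos ha']
    simp

/-- The analogue of `exists_fml_one` for the format of the collection scheme. -/
theorem exists_fml_two [Finite Γ] {R : (Option (Option Γ) → El A) → Prop} (h : IsDeltaRel R)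
    (v : Γ → El A) :
    ∃ (n : ℕ) (φ : Fml (n + 2)) (p : Fin n → El A), IsDeltaZero φ ∧
      ∀ x y, Sat φ (Fin.snoc (Fin.snoc p x : Fin (n + 1) → _) y) ↔ R (ext (ext v x) y) := by
  classical
  obtain ⟨P, hP, h⟩ := h
  have hQ : (P ∪ Set.range v).Finite := hP.union (Set.finite_range v)
  have := hQ.to_subtype
  obtain ⟨n, ⟨e⟩⟩ := Finite.exists_equiv_fin (P ∪ Set.range v : Set (El A))
  obtain ⟨φ, hφ, hw⟩ := h (n + 2)
    (ext (ext (fun i => (e ⟨v i, .inr ⟨i, rfl⟩⟩).castSucc.castSucc) (Fin.last n).castSucc)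
      (Fin.last (n + 1)))
    (fun a => if ha : a ∈ P ∪ Set.range v then (e ⟨a, ha⟩).castSucc.castSucc else Fin.last (n + 1))
  refine ⟨n, φ, fun i => (e.symm i).1, hφ, fun x y => ?_⟩
  rw [hw]
  · refine iff_of_eq (congrArg R ?_)
    funext o
    rcases o with _ | _ | o
    · simp
    · simp only [Function.comp_apply, ext_some, ext_none]
      rw [Fin.snoc_castSucc, Fin.snoc_last]
    · simp
  · intro a ha
    have ha' : a ∈ P ∪ Set.range v := Or.inl ha
    rw [dif_pos ha']
    simp

end IsDeltaRel

/-- `R` is a `Σ₁` relation with parameters in `A`: it results from a `Δ₀` relation by quantification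
over a single witness. -/
def IsSigmaRel (R : (Γ → El A) → Prop) : Prop :=
  ∃ R' : (Γ → El A) → El A → Prop,
    IsDeltaRel (fun w : Option Γ → El A => R' (fun i => w (some i)) (w none)) ∧
      ∀ v, R v ↔ ∃ y, R' v y

/-- The property of being an admissible set, as a type class. -/
class Adm (A : ZFSet.{u}) : Prop where
  isAdmissibleSet : IsAdmissibleSet A

section

variable [hA : Adm A]

theorem mem_of_mem {x y : ZFSet.{u}} (hx : x ∈ A) (hy : y ∈ x) : y ∈ A :=
  hA.isAdmissibleSet.transitive.mem_trans hy hx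

theorem exists_pair (a b : El A) : ∃ c : El A, a.1 ∈ c.1 ∧ b.1 ∈ c.1 :=
  hA.isAdmissibleSet.modelsKP.pairing a b

/-- `Δ₀` separation. -/
theorem exists_sep [Finite Γ] {R : (Γ → El A) → El A → Prop}
    (h : IsDeltaRel (fun w : Option Γ → El A => R (fun i => w (some i)) (w none)))
    (v : Γ → El A) (a : El A) :
    ∃ b : El A, ∀ x : El A, x.1 ∈ b.1 ↔ x.1 ∈ a.1 ∧ R v x := by
  obtain ⟨n, φ, p, hφ, hx⟩ := h.exists_fml_one v
  have := hA.isAdmissibleSet.modelsKP.separation φ hφ p a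
  simp only [hx] at this
  exact this

/-- `Δ₀` collection. -/
theorem exists_collection [Finite Γ] {R : (Γ → El A) → El A → El A → Prop}
    (h : IsDeltaRel (fun w : Option (Option Γ) → El A =>
      R (fun i => w (some (some i))) (w (some none)) (w none)))
    (v : Γ → El A) (a : El A) (ha : ∀ x : El A, x.1 ∈ a.1 → ∃ y, R v x y) :
    ∃ b : El A, ∀ x : El A, x.1 ∈ a.1 → ∃ y : El A, y.1 ∈ b.1 ∧ R v x y := by
  obtain ⟨n, φ, p, hφ, hx⟩ := h.exists_fml_two v
  have := hA.isAdmissibleSet.modelsKP.collection φ hφ p a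
  simp only [hx] at this
  exact this ha

end

namespace IsDeltaRel

theorem isSigmaRel [hA : Adm A] {R : (Γ → El A) → Prop} (h : IsDeltaRel R) : IsSigmaRel R := by
  refine ⟨fun v _ => R v, h.rename some, fun v => ?_⟩
  have := hA.isAdmissibleSet.modelsKP.nonempty
  simp

end IsDeltaRel

namespace IsSigmaRel

theorem of_iff {R S : (Γ → El A) → Prop} (h : IsSigmaRel R) (e : ∀ v, S v ↔ R v) :
    IsSigmaRel S := by
  rwa [show S = R from funext fun v => propext (e v)]

theorem rename {R : (Γ → El A) → Prop} (h : IsSigmaRel R) (f : Γ → Δ) :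
    IsSigmaRel (fun v : Δ → El A => R (fun i => v (f i))) := by
  obtain ⟨R', h, e⟩ := h
  exact ⟨fun v y => R' (fun i => v (f i)) y, h.rename (Option.map f), fun v => e _⟩

theorem or {R S : (Γ → El A) → Prop} (hR : IsSigmaRel R) (hS : IsSigmaRel S) :
    IsSigmaRel (fun v => R v ∨ S v) := by
  obtain ⟨R', h1, e1⟩ := hR
  obtain ⟨S', h2, e2⟩ := hS
  refine ⟨fun v y => R' v y ∨ S' v y, h1.or h2, fun v => ?_⟩
  simp only [e1, e2, exists_or]

variable [hA : Adm A]

/-- `Σ₁` relations are closed under existential quantification: the two witnesses are bounded by a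
single set. -/
theorem ex {R : (Γ → El A) → El A → Prop}
    (h : IsSigmaRel (fun w : Option Γ → El A => R (fun i => w (some i)) (w none))) :
    IsSigmaRel (fun v : Γ → El A => ∃ x, R v x) := by
  obtain ⟨R', h, e⟩ := h
  refine ⟨fun v c => ∃ x : El A, x.1 ∈ c.1 ∧ ∃ y : El A, y.1 ∈ c.1 ∧ R' (ext v x) y, ?_,
    fun v => ?_⟩
  · refine .bex none (.bex (some none) ?_)
    refine (h.rename (fun o : Option (Option Γ) =>
      (o.elim none fun o => o.elim (some none) fun i => some (some (some i)) :
        Option (Option (Option Γ))))).of_iff fun v => iff_of_eq ?_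
    congr 1
    funext o
    cases o <;> rfl
  · constructor
    · rintro ⟨x, hx⟩
      obtain ⟨y, hy⟩ := (e (ext v x)).1 hx
      obtain ⟨c, h1, h2⟩ := exists_pair x y
      exact ⟨c, x, h1, y, h2, hy⟩
    · rintro ⟨c, x, -, y, -, hy⟩
      exact ⟨x, (e (ext v x)).2 ⟨y, hy⟩⟩

theorem and {R S : (Γ → El A) → Prop} (hR : IsSigmaRel R) (hS : IsSigmaRel S) :
    IsSigmaRel (fun v => R v ∧ S v) := by
  obtain ⟨R', h1, e1⟩ := hR
  obtain ⟨S', h2, e2⟩ := hS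
  have h : IsSigmaRel (fun v : Γ → El A => ∃ x y, R' v x ∧ S' v y) := by
    refine .ex (.ex (IsDeltaRel.isSigmaRel (.and ?_ ?_)))
    · exact h1.rename some
    · exact h2.rename (fun o : Option Γ => o.elim none fun i => some (some i))
  refine h.of_iff fun v => ?_
  rw [e1, e2]
  simp

/-- `Σ₁` relations are closed under bounded universal quantification. This is where the collection
scheme is used. -/
theorem ball [Finite Γ] (i : Γ) {R : (Γ → El A) → El A → Prop}
    (h : IsSigmaRel (fun w : Option Γ → El A => R (fun i => w (some i)) (w none))) :
    IsSigmaRel (fun v : Γ → El A => ∀ x : El A, x.1 ∈ (v i).1 → R v x) := by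
  obtain ⟨R', h, e⟩ := h
  have h' : IsDeltaRel (fun w : Option (Option Γ) → El A =>
      R' (ext (fun i => w (some (some i))) (w (some none))) (w none)) := by
    refine h.of_iff fun v => iff_of_eq ?_
    congr 1
    funext o
    cases o <;> rfl
  refine ⟨fun v b => ∀ x : El A, x.1 ∈ (v i).1 → ∃ y : El A, y.1 ∈ b.1 ∧ R' (ext v x) y, ?_,
    fun v => ⟨fun hv => ?_, ?_⟩⟩
  · refine .ball (some i) (.bex (some none) ?_)
    exact h'.rename (fun o : Option (Option Γ) =>
      (o.elim none fun o => o.elim (some none) fun i => some (some (some i)) :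
        Option (Option (Option Γ))))
  · exact exists_collection (R := fun v x y => R' (ext v x) y) h' v (v i)
      fun x hx => (e (ext v x)).1 (hv x hx)
  · rintro ⟨b, hb⟩ x hx
    obtain ⟨y, -, hy⟩ := hb x hx
    exact (e (ext v x)).2 ⟨y, hy⟩

end IsSigmaRel

/-- Strong `Σ₁` collection: the collecting set contains no superfluous elements. -/
theorem exists_strong_collection [Adm A] [Finite Γ] {R : (Γ → El A) → El A → El A → Prop}
    (h : IsSigmaRel (fun w : Option (Option Γ) → El A =>
      R (fun i => w (some (some i))) (w (some none)) (w none)))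
    (v : Γ → El A) (a : El A) (ha : ∀ x : El A, x.1 ∈ a.1 → ∃ y, R v x y) :
    ∃ b : El A, (∀ x : El A, x.1 ∈ a.1 → ∃ y : El A, y.1 ∈ b.1 ∧ R v x y) ∧
      ∀ y : El A, y.1 ∈ b.1 → ∃ x : El A, x.1 ∈ a.1 ∧ R v x y := by
  obtain ⟨R', h, e⟩ := h
  have e' : ∀ x y, R v x y ↔ ∃ z, R' (ext (ext v x) y) z := fun x y => e (ext (ext v x) y)
  have h' : IsDeltaRel (fun w : Option (Option (Option Γ)) → El A =>
      R' (ext (ext (fun i => w (some (some (some i)))) (w (some (some none)))) (w (some none)))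
        (w none)) := by
    refine h.of_iff fun v => iff_of_eq ?_
    congr 1
    funext o
    rcases o with _ | _ | o <;> rfl
  obtain ⟨b, hb⟩ := exists_collection
    (R := fun v x c => ∃ y : El A, y.1 ∈ c.1 ∧ ∃ z : El A, z.1 ∈ c.1 ∧ R' (ext (ext v x) y) z)
    (by
      refine .bex none (.bex (some none) ?_)
      exact h'.rename (fun o : Option (Option (Option Γ)) =>
        (o.elim none fun o => o.elim (some none) fun o => o.elim (some (some (some none)))
          fun i => some (some (some (some i))) : Option (Option (Option (Option Γ)))))) v a
    (fun x hx => by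
      obtain ⟨y, hy⟩ := ha x hx
      obtain ⟨z, hz⟩ := (e' x y).1 hy
      obtain ⟨c, h1, h2⟩ := exists_pair y z
      exact ⟨c, y, h1, z, h2, hz⟩)
  -- The elements of `b` are sets that contain a value `y` together with a witness `z`.
  obtain ⟨d, hd⟩ := ‹Adm A›.isAdmissibleSet.modelsKP.union b
  obtain ⟨f, hf⟩ := exists_sep (Γ := Option (Option Γ))
    (R := fun w y => ∃ x : El A, x.1 ∈ (w (some none)).1 ∧ ∃ z : El A, z.1 ∈ (w none).1 ∧
      R' (ext (ext (fun i => w (some (some i))) x) y) z)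
    (by
      refine .bex (some (some none)) (.bex (some (some none)) ?_)
      exact h'.rename (fun o : Option (Option (Option Γ)) =>
        (o.elim none fun o => o.elim (some (some none)) fun o => o.elim (some none)
          fun i => some (some (some (some (some i)))) :
            Option (Option (Option (Option (Option Γ))))))) (ext (ext v a) d) d
  refine ⟨f, fun x hx => ?_, fun y hy => ?_⟩
  · obtain ⟨c, hc, y, hy, z, hz, hyz⟩ := hb x hx
    exact ⟨y, (hf y).2 ⟨hd y c hc hy, x, hx, z, hd z c hc hz, hyz⟩, (e' x y).2 ⟨z, hyz⟩⟩
  · obtain ⟨-, x, hx, z, -, hz⟩ := (hf y).1 hy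
    exact ⟨x, hx, (e' x y).2 ⟨z, hz⟩⟩

/-! ### Pairs in an admissible set -/

theorem IsDeltaRel.eq_insert [Adm A] (p a b : Γ) :
    IsDeltaRel (fun v : Γ → El A => (v p).1 = {(v a).1, (v b).1}) := by
  have : IsDeltaRel (fun v : Γ → El A => ((v a).1 ∈ (v p).1 ∧ (v b).1 ∈ (v p).1) ∧
      ∀ x : El A, x.1 ∈ (v p).1 → x = v a ∨ x = v b) :=
    .and (.and (.mem _ _) (.mem _ _)) (.ball _ (.or (.eq none (some a)) (.eq none (some b))))
  refine this.of_iff fun v => ⟨fun h => ?_, fun h => ?_⟩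
  · rw [h]
    refine ⟨⟨ZFSet.mem_pair.2 (.inl rfl), ZFSet.mem_pair.2 (.inr rfl)⟩, fun x hx => ?_⟩
    rwa [Subtype.ext_iff, Subtype.ext_iff, ← ZFSet.mem_pair]
  · ext x
    rw [ZFSet.mem_pair]
    refine ⟨fun hx => ?_, ?_⟩
    · have := h.2 ⟨x, mem_of_mem (v p).2 hx⟩ hx
      simpa only [Subtype.ext_iff] using this
    · rintro (rfl | rfl)
      exacts [h.1.1, h.1.2]

theorem pair_mem [Adm A] (a b : El A) : ({a.1, b.1} : ZFSet) ∈ A := by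
  obtain ⟨c, h1, h2⟩ := exists_pair a b
  obtain ⟨d, hd⟩ := exists_sep (Γ := Bool) (R := fun v x => x = v true ∨ x = v false)
    (.or (.eq none (some true)) (.eq none (some false))) (fun i => if i then a else b) c
  have : ({a.1, b.1} : ZFSet) = d.1 := by
    ext x
    rw [ZFSet.mem_pair]
    constructor
    · rintro (rfl | rfl)
      · exact (hd a).2 ⟨h1, .inl rfl⟩
      · exact (hd b).2 ⟨h2, .inr rfl⟩
    · intro hx
      exact ((hd ⟨x, mem_of_mem d.2 hx⟩).1 hx).2.imp (congrArg Subtype.val) (congrArg Subtype.val)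
  rw [this]
  exact d.2

/-- The ordered pair of two elements of an admissible set. -/
noncomputable def opair [Adm A] (a b : El A) : El A :=
  ⟨ZFSet.pair a.1 b.1, by
    have h1 := pair_mem a a
    have h2 := pair_mem a b
    have := pair_mem ⟨_, h1⟩ ⟨_, h2⟩
    simpa [ZFSet.pair] using this⟩

theorem opair_inj [Adm A] {a b c d : El A} : opair a b = opair c d ↔ a = c ∧ b = d := by
  rw [Subtype.ext_iff, Subtype.ext_iff, Subtype.ext_iff]
  exact ZFSet.pair_inj

theorem IsDeltaRel.eq_opair [Adm A] (p a b : Γ) :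
    IsDeltaRel (fun v : Γ → El A => v p = opair (v a) (v b)) := by
  have : IsDeltaRel (fun v : Γ → El A =>
      ((∃ x : El A, x.1 ∈ (v p).1 ∧ x.1 = {(v a).1, (v a).1}) ∧
        (∃ x : El A, x.1 ∈ (v p).1 ∧ x.1 = {(v a).1, (v b).1})) ∧
      ∀ x : El A, x.1 ∈ (v p).1 → x.1 = {(v a).1, (v a).1} ∨ x.1 = {(v a).1, (v b).1}) := by
    refine .and (.and ?_ ?_) (.ball _ (.or ?_ ?_))
    · exact .bex p (.eq_insert none (some a) (some a))
    · exact .bex p (.eq_insert none (some a) (some b))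
    · exact .eq_insert none (some a) (some a)
    · exact .eq_insert none (some a) (some b)
  refine this.of_iff fun v => ?_
  have h1 := pair_mem (v a) (v a)
  have h2 := pair_mem (v a) (v b)
  simp only [ZFSet.pair_eq_singleton] at h1 ⊢
  constructor
  · intro h
    rw [h]
    simp only [opair, ZFSet.pair, ZFSet.mem_pair]
    exact ⟨⟨⟨⟨_, h1⟩, .inl rfl, rfl⟩, ⟨_, h2⟩, .inr rfl, rfl⟩, fun x hx => hx⟩
  · rintro ⟨⟨⟨x, hx, h3⟩, y, hy, h4⟩, h5⟩
    rw [Subtype.ext_iff]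
    simp only [opair, ZFSet.pair]
    ext z
    rw [ZFSet.mem_pair]
    constructor
    · intro hz
      exact h5 ⟨z, mem_of_mem (v p).2 hz⟩ hz
    · rintro (rfl | rfl)
      · rwa [← h3]
      · rwa [← h4]

end Admissible

/-! ### Types coded in an admissible set -/

namespace Admissible

open KripkePlatek

variable (A : ZFSet.{u}) [Adm A]

/-- A type whose elements are coded by elements of `A`, so that the set of codes is `Σ₁`. -/
class Coded (T : Type*) where
  /-- the code of an object -/
  enc : T → El A
  enc_injective : Function.Injective enc
  range_sigma : IsSigmaRel (fun v : Unit → El A => ∃ t, enc t = v ())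

/-- The code of an object of a coded type. -/
abbrev enc {T : Type*} [Coded A T] (t : T) : El A := Coded.enc t

variable {T U W V : Type*} [Coded A T] [Coded A U] [Coded A W] [Coded A V] {Γ : Type}

theorem enc_inj {t t' : T} : enc A t = enc A t' ↔ t = t' := Coded.enc_injective.eq_iff

/-- A predicate on a coded type is `Σ₁` if the set of codes of its instances is `Σ₁`. -/
def SigmaPred (R : T → Prop) : Prop :=
  IsSigmaRel (fun v : Unit → El A => ∃ t, enc A t = v () ∧ R t)

variable {A}

theorem SigmaPred.at {R : T → Prop} (h : SigmaPred A R) (i : Γ) :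
    IsSigmaRel (fun v : Γ → El A => ∃ t, enc A t = v i ∧ R t) := h.rename (fun _ => i)

theorem range_at (T : Type*) [Coded A T] (i : Γ) :
    IsSigmaRel (fun v : Γ → El A => ∃ t : T, enc A t = v i) :=
  (Coded.range_sigma (T := T)).rename (fun _ => i)

/-- It suffices to describe a predicate on codes; the set of all codes is `Σ₁` anyway. -/
theorem SigmaPred.of_rel {R : T → Prop} {S : El A → Prop}
    (hS : IsSigmaRel (fun v : Unit → El A => S (v ()))) (e : ∀ t, R t ↔ S (enc A t)) :
    SigmaPred A R := by
  refine ((range_at T ()).and hS).of_iff fun v => ?_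
  constructor
  · rintro ⟨t, ht, h⟩
    exact ⟨⟨t, ht⟩, ht ▸ (e t).1 h⟩
  · rintro ⟨⟨t, ht⟩, h⟩
    exact ⟨t, ht, (e t).2 (ht ▸ h)⟩

/-- Elements of `A` are their own codes. -/
instance : Coded A (El A) where
  enc := id
  enc_injective _ _ h := h
  range_sigma := ((IsDeltaRel.eq () ()).isSigmaRel).of_iff fun v => by simp

/-- Pairs are coded by ordered pairs of codes. -/
noncomputable instance : Coded A (T × U) where
  enc p := opair (enc A p.1) (enc A p.2)
  enc_injective := by
    rintro ⟨a, b⟩ ⟨c, d⟩ h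
    obtain ⟨h1, h2⟩ := opair_inj.1 h
    exact Prod.ext (Coded.enc_injective h1) (Coded.enc_injective h2)
  range_sigma := by
    have : IsSigmaRel (fun v : Unit → El A => ∃ a b, v () = opair a b ∧
        (∃ t : T, enc A t = a) ∧ ∃ u : U, enc A u = b) :=
      .ex (.ex (.and (IsDeltaRel.eq_opair (some (some ())) (some none) none).isSigmaRel
        (.and (range_at T (some none)) (range_at U none))))
    refine this.of_iff fun v => ?_
    constructor
    · rintro ⟨⟨t, u⟩, h⟩
      exact ⟨_, _, h.symm, ⟨t, rfl⟩, ⟨u, rfl⟩⟩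
    · rintro ⟨_, _, h, ⟨t, rfl⟩, ⟨u, rfl⟩⟩
      exact ⟨(t, u), h.symm⟩

theorem enc_prod (p : T × U) : enc A p = opair (enc A p.1) (enc A p.2) := rfl

theorem SigmaPred.pair_at {R : T × U → Prop} (h : SigmaPred A R) (i j : Γ) :
    IsSigmaRel (fun v : Γ → El A => ∃ t u, enc A t = v i ∧ enc A u = v j ∧ R (t, u)) := by
  have : IsSigmaRel (fun v : Γ → El A => ∃ z, z = opair (v i) (v j) ∧ ∃ p, enc A p = z ∧ R p) :=
    .ex (.and (IsDeltaRel.eq_opair none (some i) (some j)).isSigmaRel (h.at none))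
  refine this.of_iff fun v => ?_
  constructor
  · rintro ⟨t, u, h1, h2, h3⟩
    exact ⟨_, rfl, (t, u), by rw [enc_prod, h1, h2], h3⟩
  · rintro ⟨_, rfl, ⟨t, u⟩, h2, h3⟩
    obtain ⟨h4, h5⟩ := opair_inj.1 h2
    exact ⟨t, u, h4, h5, h3⟩

/-- A predicate on pairs is `Σ₁` if it is given by a `Σ₁` relation between the codes of the
components. -/
theorem SigmaPred.of_rel₂ {R : T × U → Prop} {S : El A → El A → Prop}
    (hS : IsSigmaRel (fun v : Bool → El A => S (v true) (v false)))
    (e : ∀ t u, R (t, u) ↔ S (enc A t) (enc A u)) : SigmaPred A R := by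
  refine SigmaPred.of_rel (S := fun z => ∃ a b, z = opair a b ∧ S a b) ?_ ?_
  · exact .ex (.ex (.and (IsDeltaRel.eq_opair (some (some ())) (some none) none).isSigmaRel
      (hS.rename (fun b => if b then some none else none))))
  · rintro ⟨t, u⟩
    rw [e, enc_prod]
    constructor
    · exact fun h => ⟨_, _, rfl, h⟩
    · rintro ⟨a, b, h, h'⟩
      obtain ⟨rfl, rfl⟩ := opair_inj.1 h
      exact h'

theorem SigmaPred.of_iff {R S : T → Prop} (h : SigmaPred A R) (e : ∀ t, S t ↔ R t) :
    SigmaPred A S := by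
  rwa [show S = R from funext fun v => propext (e v)]

theorem SigmaPred.and {R S : T → Prop} (hR : SigmaPred A R) (hS : SigmaPred A S) :
    SigmaPred A (fun t => R t ∧ S t) := by
  refine (IsSigmaRel.and hR hS).of_iff fun v => ?_
  constructor
  · rintro ⟨t, h, h1, h2⟩
    exact ⟨⟨t, h, h1⟩, ⟨t, h, h2⟩⟩
  · rintro ⟨⟨t, h, h1⟩, ⟨t', h', h2⟩⟩
    obtain rfl := Coded.enc_injective (h.trans h'.symm)
    exact ⟨t, h, h1, h2⟩

theorem SigmaPred.or {R S : T → Prop} (hR : SigmaPred A R) (hS : SigmaPred A S) :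
    SigmaPred A (fun t => R t ∨ S t) := by
  refine (IsSigmaRel.or hR hS).of_iff fun v => ?_
  simp only [and_or_left, exists_or]

theorem SigmaPred.ex {R : T → U → Prop} (h : SigmaPred A (fun p : T × U => R p.1 p.2)) :
    SigmaPred A (fun t => ∃ u, R t u) := by
  have : IsSigmaRel (fun v : Unit → El A => ∃ b, ∃ t u, enc A t = v () ∧ enc A u = b ∧ R t u) :=
    .ex (h.pair_at (some ()) none)
  refine this.of_iff fun v => ?_
  constructor
  · rintro ⟨t, ht, u, h⟩
    exact ⟨_, t, u, ht, rfl, h⟩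
  · rintro ⟨_, t, u, ht, rfl, h⟩
    exact ⟨t, ht, u, h⟩

variable (A) in
/-- A function between coded types is `Σ₁` if its graph is `Σ₁`. As such functions are total, this
is a notion of recursive function relative to `A`. A predicate that is `Σ₁` as a function into
`Prop` is a recursive one: it and its negation are `Σ₁`. -/
@[fun_prop]
def SigmaFun (f : T → U) : Prop := SigmaPred A (fun p : T × U => p.2 = f p.1)

namespace SigmaFun

theorem _root_.Admissible.SigmaPred.comp {R : U → Prop} (h : SigmaPred A R) {f : T → U}
    (hf : SigmaFun A f) : SigmaPred A (fun t => R (f t)) := by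
  have : IsSigmaRel (fun v : Unit → El A => ∃ b, (∃ t u, enc A t = v () ∧ enc A u = b ∧ u = f t) ∧
      ∃ u, enc A u = b ∧ R u) := .ex (.and (hf.pair_at (some ()) none) (h.at none))
  refine this.of_iff fun v => ?_
  constructor
  · rintro ⟨t, ht, h⟩
    exact ⟨_, ⟨t, f t, ht, rfl, rfl⟩, _, rfl, h⟩
  · rintro ⟨_, ⟨t, _, ht, rfl, rfl⟩, u, hu, h⟩
    obtain rfl := Coded.enc_injective hu
    exact ⟨t, ht, h⟩

@[fun_prop]
theorem id : SigmaFun A (fun t : T => t) :=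
  SigmaPred.of_rel₂ (S := fun a b => b = a) (IsDeltaRel.eq false true).isSigmaRel
    fun _ _ => (enc_inj A).symm

@[fun_prop]
theorem const (u : U) : SigmaFun A (fun _ : T => u) := by
  refine SigmaPred.of_rel₂ (S := fun a b => b = enc A u) ?_ fun _ _ => (enc_inj A).symm
  exact ((IsDeltaRel.eq (A := A) (some false) (none : Option Bool)).const (enc A u)).isSigmaRel

@[fun_prop]
theorem comp {g : U → W} (hg : SigmaFun A g) {f : T → U} (hf : SigmaFun A f) :
    SigmaFun A (fun t => g (f t)) := by
  refine SigmaPred.of_rel₂ (S := fun a c => ∃ b, (∃ t u, enc A t = a ∧ enc A u = b ∧ u = f t) ∧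
    ∃ u w, enc A u = b ∧ enc A w = c ∧ w = g u) ?_ ?_
  · exact .ex (.and (hf.pair_at (some true) none) (hg.pair_at none (some false)))
  · intro t w
    dsimp only
    constructor
    · rintro rfl
      exact ⟨_, ⟨t, _, rfl, rfl, rfl⟩, _, _, rfl, rfl, rfl⟩
    · rintro ⟨_, ⟨t', u, ht, rfl, rfl⟩, u', w', hu, hw, rfl⟩
      obtain rfl := Coded.enc_injective ht
      obtain rfl := Coded.enc_injective hu
      exact (Coded.enc_injective hw).symm

@[fun_prop]
theorem prodMk {f : T → U} {g : T → W} (hf : SigmaFun A f) (hg : SigmaFun A g) :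
    SigmaFun A (fun t => (f t, g t)) := by
  refine SigmaPred.of_rel₂ (S := fun a d => ∃ b c, d = opair b c ∧
    (∃ t u, enc A t = a ∧ enc A u = b ∧ u = f t) ∧
      ∃ t w, enc A t = a ∧ enc A w = c ∧ w = g t) ?_ ?_
  · exact .ex (.ex (.and (IsDeltaRel.eq_opair (some (some false)) (some none) none).isSigmaRel
      (.and (hf.pair_at (some (some true)) (some none)) (hg.pair_at (some (some true)) none))))
  · rintro t ⟨u, w⟩
    dsimp only
    constructor
    · intro h
      obtain ⟨rfl, rfl⟩ := Prod.mk.inj h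
      exact ⟨_, _, rfl, ⟨t, _, rfl, rfl, rfl⟩, t, _, rfl, rfl, rfl⟩
    · rintro ⟨_, _, h, ⟨t', u', ht, rfl, rfl⟩, t'', w', ht', rfl, rfl⟩
      obtain rfl := Coded.enc_injective ht
      obtain rfl := Coded.enc_injective ht'
      obtain ⟨h1, h2⟩ := opair_inj.1 h
      exact Prod.ext (Coded.enc_injective h1) (Coded.enc_injective h2)

theorem fst' : SigmaFun A (fun p : T × U => p.1) := by
  refine SigmaPred.of_rel₂ (S := fun d a => ∃ b, d = opair a b) ?_ ?_
  · exact .ex (IsDeltaRel.eq_opair (some true) (some false) none).isSigmaRel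
  · rintro ⟨t, u⟩ t'
    dsimp only
    constructor
    · rintro rfl
      exact ⟨_, rfl⟩
    · rintro ⟨_, h⟩
      exact (Coded.enc_injective (opair_inj.1 h).1).symm

theorem snd' : SigmaFun A (fun p : T × U => p.2) := by
  refine SigmaPred.of_rel₂ (S := fun d a => ∃ b, d = opair b a) ?_ ?_
  · exact .ex (IsDeltaRel.eq_opair (some true) none (some false)).isSigmaRel
  · rintro ⟨t, u⟩ t'
    dsimp only
    constructor
    · rintro rfl
      exact ⟨_, rfl⟩
    · rintro ⟨_, h⟩
      exact (Coded.enc_injective (opair_inj.1 h).2).symm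

@[fun_prop]
theorem fst {f : T → U × W} (hf : SigmaFun A f) : SigmaFun A (fun t => (f t).1) := fst'.comp hf

@[fun_prop]
theorem snd {f : T → U × W} (hf : SigmaFun A f) : SigmaFun A (fun t => (f t).2) := snd'.comp hf

theorem congr {f g : T → U} (hf : SigmaFun A f) (h : ∀ t, g t = f t) : SigmaFun A g := by
  rwa [show g = f from funext h]

end SigmaFun

theorem SigmaPred.graph {f g : T → U} (hf : SigmaFun A f) (hg : SigmaFun A g) :
    SigmaPred A (fun t => f t = g t) :=
  SigmaPred.comp (R := fun p : U × U => p.2 = p.1) SigmaFun.id (f := fun t => (g t, f t))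
    (by fun_prop)

/-! ### Decidable properties as functions into the type of propositions -/

theorem empty_mem (A : ZFSet.{u}) [hA : Adm A] : (∅ : ZFSet) ∈ A := by
  obtain ⟨a⟩ := hA.isAdmissibleSet.modelsKP.nonempty
  obtain ⟨b, hb⟩ := exists_sep (Γ := Empty) (A := A) (R := fun v x => False) .false Empty.elim a
  have : b.1 = ∅ := by
    rw [ZFSet.eq_empty]
    intro y hy
    exact ((hb ⟨y, mem_of_mem b.2 hy⟩).1 hy).2
  exact this ▸ b.2

open Classical in
/-- A truth value is coded by `∅` or `{∅}`. -/
noncomputable instance : Coded A Prop where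
  enc P := if P then ⟨{∅, ∅}, pair_mem ⟨∅, empty_mem A⟩ ⟨∅, empty_mem A⟩⟩ else ⟨∅, empty_mem A⟩
  enc_injective P Q h := by
    have hne : ({∅, ∅} : ZFSet) ≠ ∅ := fun h => by
      have h' : (∅ : ZFSet) ∈ ({∅, ∅} : ZFSet) := ZFSet.mem_insert _ _
      rw [h] at h'
      exact ZFSet.notMem_empty _ h'
    by_cases hP : P <;> by_cases hQ : Q <;> simp only [hP, hQ, if_true, if_false] at h ⊢
    · exact absurd (congrArg Subtype.val h) hne
    · exact absurd (congrArg Subtype.val h).symm hne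
  range_sigma := by
    have h (c : El A) : IsSigmaRel (fun v : Unit → El A => c = v ()) :=
      ((IsDeltaRel.eq (A := A) (none : Option Unit) (some ())).const c).isSigmaRel
    refine ((h ⟨{∅, ∅}, pair_mem ⟨∅, empty_mem A⟩ ⟨∅, empty_mem A⟩⟩).or
      (h ⟨∅, empty_mem A⟩)).of_iff fun v => ?_
    constructor
    · rintro ⟨P, h⟩
      by_cases hP : P
      · rw [if_pos hP] at h
        exact .inl h
      · rw [if_neg hP] at h
        exact .inr h
    · rintro (h | h)
      · exact ⟨True, by rwa [if_pos trivial]⟩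
      · exact ⟨False, by rwa [if_neg _root_.id]⟩

theorem SigmaFun.sigmaPred {R : T → Prop} (h : SigmaFun A R) : SigmaPred A R :=
  (SigmaPred.graph h (SigmaFun.const True)).of_iff fun t => by simp

theorem SigmaFun.of_sigmaPred {R : T → Prop} (h : SigmaPred A R) (h' : SigmaPred A fun t => ¬ R t) :
    SigmaFun A R := by
  have h1 : SigmaPred A (fun p : T × Prop => p.2 = True ∧ R p.1 ∨ p.2 = False ∧ ¬ R p.1) :=
    ((SigmaPred.graph (by fun_prop) (by fun_prop)).and (h.comp (by fun_prop))).or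
      ((SigmaPred.graph (by fun_prop) (by fun_prop)).and (h'.comp (f := Prod.fst) (by fun_prop)))
  refine h1.of_iff fun p => ?_
  obtain ⟨t, P⟩ := p
  by_cases hR : R t <;> simp [hR]

namespace SigmaFun

@[fun_prop]
theorem not {P : T → Prop} (hP : SigmaFun A P) : SigmaFun A (fun t => ¬ P t) := by
  have h : SigmaPred A (fun t => ¬ P t) :=
    (SigmaPred.graph hP (const False)).of_iff fun t => by simp
  refine of_sigmaPred h (hP.sigmaPred.of_iff fun t => not_not)

@[fun_prop]
theorem and {P Q : T → Prop} (hP : SigmaFun A P) (hQ : SigmaFun A Q) :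
    SigmaFun A (fun t => P t ∧ Q t) :=
  of_sigmaPred (hP.sigmaPred.and hQ.sigmaPred)
    ((hP.not.sigmaPred.or hQ.not.sigmaPred).of_iff fun t => by tauto)

@[fun_prop]
theorem or {P Q : T → Prop} (hP : SigmaFun A P) (hQ : SigmaFun A Q) :
    SigmaFun A (fun t => P t ∨ Q t) := (hP.not.and hQ.not).not.congr fun t => by
  rw [eq_iff_iff]; tauto

theorem imp {P Q : T → Prop} (hP : SigmaFun A P) (hQ : SigmaFun A Q) :
    SigmaFun A (fun t => P t → Q t) := (hP.not.or hQ).congr fun t => by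
  rw [eq_iff_iff]; tauto

@[fun_prop]
theorem iff {P Q : T → Prop} (hP : SigmaFun A P) (hQ : SigmaFun A Q) :
    SigmaFun A (fun t => P t ↔ Q t) := ((hP.imp hQ).and (hQ.imp hP)).congr fun t => by
  rw [eq_iff_iff]; tauto

@[fun_prop]
theorem eq {f g : T → U} (hf : SigmaFun A f) (hg : SigmaFun A g) :
    SigmaFun A (fun t => f t = g t) := by
  refine of_sigmaPred (SigmaPred.graph hf hg) ?_
  have : SigmaPred A (fun p : U × U => ¬ p.1 = p.2) :=
    SigmaPred.of_rel₂ (S := fun a b => ¬ a = b) (IsDeltaRel.eq true false).not.isSigmaRel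
      fun t u => by simp only [enc_inj A]
  exact this.comp (f := fun t => (f t, g t)) (by fun_prop)

@[fun_prop]
theorem ite {P : T → Prop} [DecidablePred P] {f g : T → U} (hP : SigmaFun A P) (hf : SigmaFun A f)
    (hg : SigmaFun A g) : SigmaFun A (fun t => if P t then f t else g t) := by
  have h1 : SigmaPred A (fun p : T × U => P p.1 ∧ p.2 = f p.1 ∨ ¬ P p.1 ∧ p.2 = g p.1) :=
    ((hP.sigmaPred.comp (by fun_prop)).and hf).or ((hP.not.sigmaPred.comp (by fun_prop)).and hg)
  refine h1.of_iff fun p => ?_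
  by_cases hR : P p.1 <;> simp [hR]

end SigmaFun

end Admissible

/-! ### Sets of coded objects, and `Σ₁` collection -/

namespace Admissible

open KripkePlatek

variable {A : ZFSet.{u}} [Adm A]
variable {T U W V : Type*} [Coded A T] [Coded A U] [Coded A W] [Coded A V] {Γ : Type}

variable (A U) in
/-- The elements of `A` all of whose elements are codes of objects of type `U`. -/
def ASet : Type (u + 1) := {a : El A // ∀ x : El A, x.1 ∈ a.1 → ∃ t : U, enc A t = x}

/-- Membership of an object means membership of its code. -/
instance : Membership U (ASet A U) := ⟨fun S t => (enc A t).1 ∈ S.1.1⟩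

theorem ASet.mem_def {S : ASet A U} {t : U} : t ∈ S ↔ (enc A t).1 ∈ S.1.1 := Iff.rfl

theorem ASet.ext {S S' : ASet A U} (h : ∀ t, t ∈ S ↔ t ∈ S') : S = S' := by
  apply Subtype.ext
  apply Subtype.ext
  ext x
  constructor
  · intro hx
    obtain ⟨t, ht⟩ := S.2 ⟨x, mem_of_mem S.1.2 hx⟩ hx
    have := (h t).1 (by rw [ASet.mem_def, ht]; exact hx)
    rwa [ASet.mem_def, ht] at this
  · intro hx
    obtain ⟨t, ht⟩ := S'.2 ⟨x, mem_of_mem S'.1.2 hx⟩ hx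
    have := (h t).2 (by rw [ASet.mem_def, ht]; exact hx)
    rwa [ASet.mem_def, ht] at this

/-- Sets of codes are their own codes. -/
instance : Coded A (ASet A U) where
  enc := Subtype.val
  enc_injective := Subtype.val_injective
  range_sigma := by
    have : IsSigmaRel (fun v : Unit → El A => ∀ x : El A, x.1 ∈ (v ()).1 → ∃ t : U, enc A t = x) :=
      .ball () (range_at U none)
    refine this.of_iff fun v => ?_
    constructor
    · rintro ⟨t, h⟩
      rw [← h]
      exact t.2
    · intro h
      exact ⟨⟨v (), h⟩, rfl⟩

theorem SigmaFun.mem_aset {f : T → U} {F : T → ASet A U} (hf : SigmaFun A f) (hF : SigmaFun A F) :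
    SigmaFun A (fun t => f t ∈ F t) := by
  have h1 : SigmaPred A (fun p : U × ASet A U => p.1 ∈ p.2) :=
    SigmaPred.of_rel₂ (S := fun a b => a.1 ∈ b.1) (IsDeltaRel.mem true false).isSigmaRel
      fun t u => Iff.rfl
  have h2 : SigmaPred A (fun p : U × ASet A U => ¬ p.1 ∈ p.2) :=
    SigmaPred.of_rel₂ (S := fun a b => ¬ a.1 ∈ b.1) (IsDeltaRel.mem true false).not.isSigmaRel
      fun t u => Iff.rfl
  exact comp (of_sigmaPred h1 h2) (hf.prodMk hF)

theorem SigmaPred.ball_aset {R : T → U → Prop} (hR : SigmaPred A (fun p : T × U => R p.1 p.2))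
    {F : T → ASet A U} (hF : SigmaFun A F) : SigmaPred A (fun t => ∀ u, u ∈ F t → R t u) := by
  have : IsSigmaRel (fun v : Unit → El A => ∃ b,
      (∃ t S, enc A t = v () ∧ enc A S = b ∧ S = F t) ∧
        ∀ x : El A, x.1 ∈ b.1 → ∃ t u, enc A t = v () ∧ enc A u = x ∧ R t u) :=
    .ex (.and (hF.pair_at (some ()) none) (.ball none (hR.pair_at (some (some ())) none)))
  refine this.of_iff fun v => ?_
  constructor
  · rintro ⟨t, ht, h⟩
    refine ⟨_, ⟨t, F t, ht, rfl, rfl⟩, fun x hx => ?_⟩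
    obtain ⟨u, rfl⟩ := (F t).2 x hx
    exact ⟨t, u, ht, rfl, h u hx⟩
  · rintro ⟨_, ⟨t, S, ht, rfl, rfl⟩, h⟩
    refine ⟨t, ht, fun u hu => ?_⟩
    obtain ⟨t', u', ht', hu', h'⟩ := h (enc A u) hu
    obtain rfl := Coded.enc_injective hu'
    obtain rfl := Coded.enc_injective (ht'.trans ht.symm)
    exact h'

/-- Strong `Σ₁` collection for coded types. -/
theorem ASet.exists_collect {R : U → W → Prop} (hR : SigmaPred A (fun p : U × W => R p.1 p.2))
    (S : ASet A U) (h : ∀ u, u ∈ S → ∃ w, R u w) :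
    ∃ B : ASet A W, (∀ u, u ∈ S → ∃ w, w ∈ B ∧ R u w) ∧ ∀ w, w ∈ B → ∃ u, u ∈ S ∧ R u w := by
  obtain ⟨b, h1, h2⟩ := exists_strong_collection (Γ := Empty)
    (R := fun _ x y => ∃ u w, enc A u = x ∧ enc A w = y ∧ R u w)
    (hR.pair_at (some none) none) Empty.elim S.1 (fun x hx => by
      obtain ⟨u, rfl⟩ := S.2 x hx
      obtain ⟨w, hw⟩ := h u hx
      exact ⟨_, u, w, rfl, rfl, hw⟩)
  refine ⟨⟨b, fun y hy => ?_⟩, fun u hu => ?_, fun w hw => ?_⟩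
  · obtain ⟨x, hx, u, w, -, hw, -⟩ := h2 y hy
    exact ⟨w, hw⟩
  · obtain ⟨y, hy, u', w, hu', hw, h⟩ := h1 (enc A u) hu
    obtain rfl := Coded.enc_injective hu'
    refine ⟨w, ?_, h⟩
    change (enc A w).1 ∈ b.1
    rwa [hw]
  · obtain ⟨x, hx, u, w', hu, hw', h⟩ := h2 _ hw
    obtain rfl := Coded.enc_injective hw'
    refine ⟨u, ?_, h⟩
    rwa [ASet.mem_def, hu]

theorem ASet.exists_sUnion (S : ASet A (ASet A U)) :
    ∃ B : ASet A U, ∀ u, u ∈ B ↔ ∃ s, s ∈ S ∧ u ∈ s := by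
  obtain ⟨c, hc⟩ := ‹Adm A›.isAdmissibleSet.modelsKP.union S.1
  obtain ⟨b, hb⟩ := exists_sep (Γ := Unit) (R := fun v x => ∃ y : El A, y.1 ∈ (v ()).1 ∧ x.1 ∈ y.1)
    (.bex (some ()) (.mem (some none) none)) (fun _ => S.1) c
  refine ⟨⟨b, fun x hx => ?_⟩, fun u => ?_⟩
  · obtain ⟨-, y, hy, hxy⟩ := (hb x).1 hx
    obtain ⟨s, rfl⟩ := S.2 y hy
    exact s.2 x hxy
  · refine (hb _).trans ⟨?_, ?_⟩
    · rintro ⟨-, y, hy, hxy⟩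
      obtain ⟨s, rfl⟩ := S.2 y hy
      exact ⟨s, hy, hxy⟩
    · rintro ⟨s, hs, hu⟩
      exact ⟨hc _ s.1 hs hu, s.1, hs, hu⟩

theorem ASet.exists_pair (s t : U) : ∃ B : ASet A U, ∀ u, u ∈ B ↔ u = s ∨ u = t := by
  refine ⟨⟨⟨_, pair_mem (enc A s) (enc A t)⟩, fun x hx => ?_⟩, fun u => ?_⟩
  · rcases ZFSet.mem_pair.1 hx with h | h
    · exact ⟨s, Subtype.ext h.symm⟩
    · exact ⟨t, Subtype.ext h.symm⟩
  · refine ZFSet.mem_pair.trans ?_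
    rw [← Subtype.ext_iff, ← Subtype.ext_iff, enc_inj, enc_inj]

theorem ASet.exists_empty : ∃ B : ASet A U, ∀ u : U, ¬ u ∈ B :=
  ⟨⟨⟨∅, empty_mem A⟩, fun _ hx => (ZFSet.notMem_empty _ hx).elim⟩,
    fun _ hu => ZFSet.notMem_empty _ hu⟩

theorem ASet.exists_union (S S' : ASet A U) : ∃ B : ASet A U, ∀ u, u ∈ B ↔ u ∈ S ∨ u ∈ S' := by
  obtain ⟨C, hC⟩ := ASet.exists_pair (A := A) S S'
  obtain ⟨B, hB⟩ := ASet.exists_sUnion C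
  refine ⟨B, fun u => ?_⟩
  rw [hB]
  simp [hC]

/-- `Δ₁` separation. -/
theorem ASet.exists_sep {P : U → Prop} (hP : SigmaFun A P) (S : ASet A U) :
    ∃ B : ASet A U, ∀ u, u ∈ B ↔ u ∈ S ∧ P u := by
  have hR : SigmaPred A (fun p : U × ASet A U =>
      (P p.1 ∧ p.1 ∈ p.2 ∧ ∀ w, w ∈ p.2 → w = p.1) ∨ (¬ P p.1 ∧ ∀ w, w ∈ p.2 → False)) := by
    refine .or (.and ?_ (.and ?_ ?_)) (.and ?_ ?_)
    · exact SigmaFun.sigmaPred (by fun_prop)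
    · exact (SigmaFun.mem_aset (by fun_prop) (by fun_prop)).sigmaPred
    · refine SigmaPred.ball_aset (SigmaFun.sigmaPred ?_) ?_ <;> fun_prop
    · exact SigmaFun.sigmaPred (by fun_prop)
    · refine SigmaPred.ball_aset (SigmaFun.sigmaPred ?_) ?_ <;> fun_prop
  obtain ⟨C, h1, h2⟩ := ASet.exists_collect (R := fun (u : U) (B : ASet A U) =>
      (P u ∧ u ∈ B ∧ ∀ w, w ∈ B → w = u) ∨ (¬ P u ∧ ∀ w, w ∈ B → False)) hR S (fun u hu => by
    by_cases h : P u
    · obtain ⟨B, hB⟩ := ASet.exists_pair (A := A) u u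
      exact ⟨B, .inl ⟨h, (hB u).2 (.inl rfl), fun w hw => by simpa using (hB w).1 hw⟩⟩
    · obtain ⟨B, hB⟩ := ASet.exists_empty (A := A) (U := U)
      exact ⟨B, .inr ⟨h, hB⟩⟩)
  obtain ⟨B, hB⟩ := ASet.exists_sUnion C
  refine ⟨B, fun u => ?_⟩
  rw [hB]
  constructor
  · rintro ⟨s, hs, hu⟩
    obtain ⟨v, hv, ⟨h3, h4, h5⟩ | ⟨h3, h4⟩⟩ := h2 s hs
    · rw [h5 u hu]
      exact ⟨hv, h3⟩
    · exact (h4 u hu).elim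
  · rintro ⟨hu, hP⟩
    obtain ⟨s, hs, ⟨h3, h4, h5⟩ | ⟨h3, h4⟩⟩ := h1 u hu
    · exact ⟨s, hs, h4⟩
    · exact (h3 hP).elim

/-! ### Recursive set-valued functions -/

variable (A) in
/-- A set-valued function on a coded type whose values are elements of `A`, and which is recursive
as a function into `A`. -/
def SigmaSet (X : T → Set U) : Prop :=
  ∃ F : T → ASet A U, SigmaFun A F ∧ ∀ t u, u ∈ F t ↔ u ∈ X t

theorem SigmaFun.sigmaSet {F : T → ASet A U} (h : SigmaFun A F) :
    SigmaSet A (fun t => {u | u ∈ F t}) := ⟨F, h, fun _ _ => Iff.rfl⟩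

theorem SigmaPred.ball {X : T → Set U} (hX : SigmaSet A X) {R : T → U → Prop}
    (hR : SigmaPred A (fun p : T × U => R p.1 p.2)) :
    SigmaPred A (fun t => ∀ u, u ∈ X t → R t u) := by
  obtain ⟨F, hF, h⟩ := hX
  exact (ball_aset hR hF).of_iff fun t => by simp only [h]

theorem SigmaFun.ball {X : T → Set U} (hX : SigmaSet A X) {R : T → U → Prop}
    (hR : SigmaFun A (fun p : T × U => R p.1 p.2)) :
    SigmaFun A (fun t => ∀ u, u ∈ X t → R t u) := by
  refine of_sigmaPred (SigmaPred.ball hX hR.sigmaPred) ?_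
  obtain ⟨F, hF, h⟩ := hX
  have : SigmaPred A (fun t => ∃ u, u ∈ F t ∧ ¬ R t u) :=
    .ex (.and (mem_aset (by fun_prop) (by fun_prop)).sigmaPred hR.not.sigmaPred)
  exact this.of_iff fun t => by
    simp only [h]
    push Not
    rfl

theorem SigmaFun.bex {X : T → Set U} (hX : SigmaSet A X) {R : T → U → Prop}
    (hR : SigmaFun A (fun p : T × U => R p.1 p.2)) :
    SigmaFun A (fun t => ∃ u, u ∈ X t ∧ R t u) :=
  (ball (R := fun t u => ¬ R t u) hX hR.not).not.congr fun t => by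
    push Not
    rfl

theorem SigmaFun.mem {X : T → Set U} (hX : SigmaSet A X) {f : T → U} (hf : SigmaFun A f) :
    SigmaFun A (fun t => f t ∈ X t) := by
  obtain ⟨F, hF, h⟩ := hX
  exact (mem_aset hf hF).congr fun t => by simp only [h]

namespace SigmaSet

theorem of_eq {X Y : T → Set U} (h : SigmaSet A X) (e : ∀ t u, u ∈ Y t ↔ u ∈ X t) :
    SigmaSet A Y := by
  obtain ⟨F, hF, h⟩ := h
  exact ⟨F, hF, fun t u => by rw [h, e]⟩

theorem comp {X : U → Set W} (hX : SigmaSet A X) {f : T → U} (hf : SigmaFun A f) :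
    SigmaSet A (fun t => X (f t)) := by
  obtain ⟨F, hF, h⟩ := hX
  exact ⟨fun t => F (f t), hF.comp hf, fun t u => h _ _⟩

theorem const (S : ASet A U) : SigmaSet A (fun _ : T => {u | u ∈ S}) :=
  ⟨fun _ => S, SigmaFun.const S, fun _ _ => Iff.rfl⟩

theorem mk {X : T → Set U} (h : ∀ t, ∃ S : ASet A U, ∀ u, u ∈ S ↔ u ∈ X t)
    (h' : SigmaPred A (fun p : T × ASet A U => ∀ u, u ∈ p.2 ↔ u ∈ X p.1)) : SigmaSet A X := by
  choose F hF using h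
  refine ⟨F, h'.of_iff fun p => ?_, hF⟩
  constructor
  · intro h u
    rw [h, hF]
  · intro h
    refine ASet.ext fun u => ?_
    rw [h, hF]

theorem sep {X : T → Set U} (hX : SigmaSet A X) {P : T → U → Prop}
    (hP : SigmaFun A (fun p : T × U => P p.1 p.2)) :
    SigmaSet A (fun t => {u | u ∈ X t ∧ P t u}) := by
  refine mk (fun t => ?_) ?_
  · obtain ⟨F, hF, h⟩ := hX
    have := ASet.exists_sep (A := A) (P := fun u => P t u)
      (SigmaFun.comp hP (by fun_prop : SigmaFun A (fun u => (t, u)))) (F t)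
    simpa [h] using this
  · have : SigmaPred A (fun p : T × ASet A U => (∀ u, u ∈ {u | u ∈ p.2} → u ∈ X p.1 ∧ P p.1 u) ∧
        ∀ u, u ∈ X p.1 → P p.1 u → u ∈ p.2) := by
      refine .and (.ball (SigmaFun.sigmaSet (by fun_prop)) (SigmaFun.sigmaPred ?_))
        (.ball (hX.comp (by fun_prop)) (SigmaFun.sigmaPred ?_))
      · exact .and (.mem (hX.comp (by fun_prop)) (by fun_prop))
          (hP.comp (f := fun p : (T × ASet A U) × U => (p.1.1, p.2)) (by fun_prop))
      · exact .imp (hP.comp (f := fun p : (T × ASet A U) × U => (p.1.1, p.2)) (by fun_prop))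
          (.mem_aset (by fun_prop) (by fun_prop))
    refine this.of_iff fun p => ?_
    simp only [Set.mem_ofPred_eq]
    exact ⟨fun h => ⟨fun u hu => (h u).1 hu, fun u h1 h2 => (h u).2 ⟨h1, h2⟩⟩,
      fun h u => ⟨h.1 u, fun h' => h.2 u h'.1 h'.2⟩⟩

theorem biUnion {X : T → Set U} (hX : SigmaSet A X) {Y : T → U → Set W}
    (hY : SigmaSet A (fun p : T × U => Y p.1 p.2)) :
    SigmaSet A (fun t => {w | ∃ u, u ∈ X t ∧ w ∈ Y t u}) := by
  refine mk (fun t => ?_) ?_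
  · obtain ⟨F, hF, h⟩ := hX
    obtain ⟨G, hG, h'⟩ := hY
    obtain ⟨C, h1, h2⟩ := ASet.exists_collect (R := fun u S => S = G (t, u))
      (SigmaFun.sigmaPred (by fun_prop)) (F t) fun u _ => ⟨_, rfl⟩
    obtain ⟨B, hB⟩ := ASet.exists_sUnion C
    refine ⟨B, fun w => ?_⟩
    rw [hB]
    constructor
    · rintro ⟨s, hs, hw⟩
      obtain ⟨u, hu, rfl⟩ := h2 s hs
      exact ⟨u, (h t u).1 hu, (h' (t, u) w).1 hw⟩
    · rintro ⟨u, hu, hw⟩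
      obtain ⟨s, hs, rfl⟩ := h1 u ((h t u).2 hu)
      exact ⟨_, hs, (h' (t, u) w).2 hw⟩
  · have : SigmaPred A (fun p : T × ASet A W =>
        (∀ w, w ∈ {w | w ∈ p.2} → ∃ u, u ∈ X p.1 ∧ w ∈ Y p.1 u) ∧
        ∀ u, u ∈ X p.1 → ∀ w, w ∈ Y p.1 u → w ∈ p.2) := by
      refine .and (.ball (SigmaFun.sigmaSet (by fun_prop)) (SigmaFun.sigmaPred ?_))
        (.ball (hX.comp (by fun_prop)) (SigmaFun.sigmaPred ?_))
      · exact .bex (hX.comp (by fun_prop)) (.mem (hY.comp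
          (f := fun p : ((T × ASet A W) × W) × U => (p.1.1.1, p.2)) (by fun_prop)) (by fun_prop))
      · exact .ball (hY.comp (f := fun p : (T × ASet A W) × U => (p.1.1, p.2)) (by fun_prop))
          (.mem_aset (by fun_prop) (by fun_prop))
    refine this.of_iff fun p => ?_
    simp only [Set.mem_ofPred_eq]
    exact ⟨fun h => ⟨fun u hu => (h u).1 hu, fun u h1 w h2 => (h w).2 ⟨u, h1, h2⟩⟩,
      fun h u => ⟨h.1 u, fun ⟨v, h1, h2⟩ => h.2 v h1 u h2⟩⟩

theorem singleton {f : T → U} (hf : SigmaFun A f) : SigmaSet A (fun t => {f t}) := by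
  refine mk (fun t => ?_) ?_
  · simpa using ASet.exists_pair (A := A) (f t) (f t)
  · have : SigmaPred A (fun p : T × ASet A U => f p.1 ∈ p.2 ∧ ∀ u, u ∈ {u | u ∈ p.2} → u = f p.1) :=
      .and (SigmaFun.mem_aset (by fun_prop) (by fun_prop)).sigmaPred
        (.ball (SigmaFun.sigmaSet (by fun_prop)) (SigmaFun.sigmaPred (by fun_prop)))
    refine this.of_iff fun p => ?_
    simp only [Set.mem_ofPred_eq, Set.mem_singleton_iff]
    exact ⟨fun h => ⟨(h _).2 rfl, fun u => (h u).1⟩, fun h u => ⟨h.2 u, fun e => e ▸ h.1⟩⟩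

theorem image {X : T → Set U} (hX : SigmaSet A X) {f : T → U → W}
    (hf : SigmaFun A (fun p : T × U => f p.1 p.2)) :
    SigmaSet A (fun t => f t '' X t) :=
  (hX.biUnion (Y := fun t u => {f t u}) (singleton hf)).of_eq fun t u => by
    simp [eq_comm]

theorem union {X Y : T → Set U} (hX : SigmaSet A X) (hY : SigmaSet A Y) :
    SigmaSet A (fun t => X t ∪ Y t) := by
  refine mk (fun t => ?_) ?_
  · obtain ⟨F, hF, h⟩ := hX
    obtain ⟨G, hG, h'⟩ := hY
    simpa [h, h'] using ASet.exists_union (F t) (G t)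
  · have : SigmaPred A (fun p : T × ASet A U =>
        (∀ u, u ∈ {u | u ∈ p.2} → u ∈ X p.1 ∨ u ∈ Y p.1) ∧
          (∀ u, u ∈ X p.1 → u ∈ p.2) ∧ ∀ u, u ∈ Y p.1 → u ∈ p.2) := by
      refine .and (.ball (SigmaFun.sigmaSet (by fun_prop)) (SigmaFun.sigmaPred (.or ?_ ?_)))
        (.and (.ball ?_ (SigmaFun.sigmaPred ?_)) (.ball ?_ (SigmaFun.sigmaPred ?_)))
      · exact .mem (hX.comp (by fun_prop)) (by fun_prop)
      · exact .mem (hY.comp (by fun_prop)) (by fun_prop)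
      · exact hX.comp (by fun_prop)
      · exact .mem_aset (by fun_prop) (by fun_prop)
      · exact hY.comp (by fun_prop)
      · exact .mem_aset (by fun_prop) (by fun_prop)
    refine this.of_iff fun p => ?_
    simp only [Set.mem_ofPred_eq, Set.mem_union]
    exact ⟨fun h => ⟨fun u hu => (h u).1 hu, fun u h1 => (h u).2 (.inl h1),
      fun u h1 => (h u).2 (.inr h1)⟩, fun h u => ⟨h.1 u, fun h' => h'.elim (h.2.1 u) (h.2.2 u)⟩⟩

theorem prod {X : T → Set U} (hX : SigmaSet A X) {Y : T → Set W} (hY : SigmaSet A Y) :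
    SigmaSet A (fun t => X t ×ˢ Y t) :=
  (hX.biUnion (Y := fun t u => (fun w => (u, w)) '' Y t)
    ((hY.comp (by fun_prop)).image (f := fun (p : T × U) w => (p.2, w)) (by fun_prop))).of_eq
      fun t u => by
    obtain ⟨a, b⟩ := u
    simp only [Set.mem_prod, Set.mem_ofPred_eq, Set.mem_image, Prod.mk.injEq]
    constructor
    · rintro ⟨h1, h2⟩
      exact ⟨a, h1, b, h2, rfl, rfl⟩
    · rintro ⟨_, h1, _, h2, rfl, rfl⟩
      exact ⟨h1, h2⟩

end SigmaSet

/-- A recursive function into sets from a recursive set-valued function. -/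
theorem SigmaFun.of_mem_iff {X : T → Set U} (hX : SigmaSet A X) {F : T → ASet A U}
    (h : ∀ t u, u ∈ F t ↔ u ∈ X t) : SigmaFun A F := by
  obtain ⟨G, hG, h'⟩ := hX
  exact hG.congr fun t => ASet.ext fun u => by rw [h, h']

/-! ### Recursion in an admissible set -/

/-- The `Σ₁` recursion theorem. The relation `G` is the graph of a function on `T`, and `Ψ`
computes the value of this function at `t` from its restriction to the set `b t` of
predecessors of `t`. Neither the totality of `G` nor a definition of `G` in `A` is presupposed. -/
theorem sigma_recursion {r : T → T → Prop} (hr : WellFounded r) {b : T → Set T}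
    (hb : SigmaSet A b) (hbr : ∀ t s, s ∈ b t → r s t) {G : T → U → Prop}
    (hG : ∀ t u u', G t u → G t u' → u = u') {Ψ : T → U → ASet A (T × U) → Prop}
    (hΨ : SigmaPred A (fun p : (T × U) × ASet A (T × U) => Ψ p.1.1 p.1.2 p.2))
    (h : ∀ t (g : ASet A (T × U)), (∀ p, p ∈ g ↔ p.1 ∈ b t ∧ G p.1 p.2) →
      (∀ s ∈ b t, ∃ u, G s u) → (∃ u, Ψ t u g) ∧ ∀ u, Ψ t u g → G t u) :
    (∀ t, ∃ u, G t u) ∧ SigmaPred A (fun p : T × U => G p.1 p.2) := by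
  -- `Good d` means that `d` is a set of correct computations that is closed under predecessors.
  let Good : ASet A (T × U) → Prop := fun d => ∀ p, p ∈ {p | p ∈ d} → ∃ g : ASet A (T × U),
    Ψ p.1 p.2 g ∧ (∀ q, q ∈ {q | q ∈ g} → q ∈ d ∧ q.1 ∈ b p.1) ∧
      ∀ s, s ∈ b p.1 → ∃ q, q ∈ g ∧ q.1 = s
  let H : T → U → Prop := fun t u => ∃ d, (t, u) ∈ d ∧ Good d
  have hGood : SigmaPred A Good := by
    refine .ball (SigmaFun.sigmaSet (by fun_prop)) (.ex (.and ?_ (.and ?_ ?_)))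
    · exact hΨ.comp (f := fun p : (ASet A (T × U) × (T × U)) × ASet A (T × U) => (p.1.2, p.2))
        (by fun_prop)
    · refine .ball (SigmaFun.sigmaSet (by fun_prop)) (SigmaFun.sigmaPred (.and ?_ ?_))
      · exact .mem_aset (by fun_prop) (by fun_prop)
      · exact .mem (hb.comp (by fun_prop)) (by fun_prop)
    · refine .ball (hb.comp (by fun_prop)) (.ex (.and ?_ ?_))
      · exact (SigmaFun.mem_aset (by fun_prop) (by fun_prop)).sigmaPred
      · exact SigmaFun.sigmaPred (by fun_prop)
  have hH : SigmaPred A (fun p : T × U => H p.1 p.2) :=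
    .ex (.and (SigmaFun.mem_aset (by fun_prop) (by fun_prop)).sigmaPred (hGood.comp (by fun_prop)))
  have sound : ∀ d, Good d → ∀ t u, (t, u) ∈ d → G t u := by
    intro d hd t
    induction t using hr.induction with
    | _ t ih =>
      intro u hu
      obtain ⟨g, h1, h2, h3⟩ := hd (t, u) hu
      have h4 : ∀ p, p ∈ g → p.1 ∈ b t ∧ G p.1 p.2 := fun p hp => by
        have := (h2 p hp)
        exact ⟨this.2, ih p.1 (hbr _ _ this.2) p.2 this.1⟩
      refine (h t g (fun p => ⟨h4 p, ?_⟩) ?_).2 u h1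
      · rintro ⟨h5, h6⟩
        obtain ⟨q, hq, hq'⟩ := h3 p.1 h5
        have : q = p := Prod.ext hq' (hG p.1 _ _ (hq' ▸ (h4 q hq).2) h6)
        exact this ▸ hq
      · intro s hs
        obtain ⟨q, hq, rfl⟩ := h3 s hs
        exact ⟨q.2, (h4 q hq).2⟩
  have soundH : ∀ t u, H t u → G t u := fun t u ⟨d, h1, h2⟩ => sound d h2 t u h1
  have total : ∀ t, ∃ u, H t u := by
    intro t
    induction t using hr.induction with
    | _ t ih =>
      obtain ⟨F, hF, hFb⟩ := hb
      obtain ⟨C, hC1, hC2⟩ := ASet.exists_collect (A := A) (U := T) (W := ASet A (T × U))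
        (R := fun s d => Good d ∧ ∃ u, (s, u) ∈ d)
        (.and (hGood.comp (by fun_prop))
          (.ex (SigmaFun.mem_aset (by fun_prop) (by fun_prop)).sigmaPred)) (F t)
        (fun s hs => by
          obtain ⟨u, d, h1, h2⟩ := ih s (hbr _ _ ((hFb t s).1 hs))
          exact ⟨d, h2, u, h1⟩)
      obtain ⟨D, hD⟩ := ASet.exists_sUnion C
      have goodD : Good D := by
        intro p hp
        obtain ⟨d, hd, hpd⟩ := (hD p).1 hp
        obtain ⟨s, hs, hgd, -⟩ := hC2 d hd
        obtain ⟨g, h1, h2, h3⟩ := hgd p hpd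
        exact ⟨g, h1, fun q hq => ⟨(hD q).2 ⟨d, hd, (h2 q hq).1⟩, (h2 q hq).2⟩, h3⟩
      obtain ⟨g, hg⟩ := ASet.exists_sep (A := A) (P := fun p : T × U => p.1 ∈ F t)
        (.mem_aset (by fun_prop) (by fun_prop)) D
      have cover : ∀ s, s ∈ b t → ∃ q, q ∈ g ∧ q.1 = s := by
        intro s hs
        rw [← hFb] at hs
        obtain ⟨d, hd, -, u, hu⟩ := hC1 s hs
        exact ⟨(s, u), (hg _).2 ⟨(hD _).2 ⟨d, hd, hu⟩, hs⟩, rfl⟩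
      have h4 : ∀ p, p ∈ g → p.1 ∈ b t ∧ G p.1 p.2 := fun p hp =>
        ⟨(hFb _ _).1 ((hg p).1 hp).2, sound D goodD _ _ ((hg p).1 hp).1⟩
      obtain ⟨u, hu⟩ := (h t g (fun p => ⟨h4 p, by
        rintro ⟨h5, h6⟩
        obtain ⟨q, hq, hq'⟩ := cover p.1 h5
        have : q = p := Prod.ext hq' (hG p.1 _ _ (hq' ▸ (h4 q hq).2) h6)
        exact this ▸ hq⟩) (fun s hs => by
          obtain ⟨q, hq, rfl⟩ := cover s hs
          exact ⟨q.2, (h4 q hq).2⟩)).1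
      obtain ⟨E, hE⟩ := ASet.exists_pair (A := A) (t, u) (t, u)
      obtain ⟨D', hD'⟩ := ASet.exists_union D E
      refine ⟨u, D', (hD' _).2 (.inr ((hE _).2 (.inl rfl))), ?_⟩
      intro p hp
      rcases (hD' p).1 hp with hp | hp
      · obtain ⟨g, h1, h2, h3⟩ := goodD p hp
        exact ⟨g, h1, fun q hq => ⟨(hD' q).2 (.inl (h2 q hq).1), (h2 q hq).2⟩, h3⟩
      · obtain rfl : p = (t, u) := by simpa using (hE p).1 hp
        exact ⟨g, hu, fun q hq => ⟨(hD' q).2 (.inl ((hg q).1 hq).1), (h4 q hq).1⟩, cover⟩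
  refine ⟨fun t => (total t).imp fun u hu => soundH t u hu, hH.of_iff fun p => ⟨fun hp => ?_,
    soundH _ _⟩⟩
  obtain ⟨u, hu⟩ := total p.1
  rwa [hG p.1 _ _ hp (soundH _ _ hu)]

end Admissible

/-! ### Ordinals of an admissible set -/

namespace Admissible

open KripkePlatek

variable {A : ZFSet.{u}} [Adm A]
variable {T U W V : Type*} [Coded A T] [Coded A U] [Coded A W] [Coded A V] {Γ : Type}

variable (A) in
/-- The ordinals of `A`. -/
abbrev On : Type (u + 1) := {α : Ordinal.{u} // α.toZFSet ∈ A}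

theorem IsDeltaRel.isOrdinal (i : Γ) :
    IsDeltaRel (fun v : Γ → El A => (v i).1.IsOrdinal) := by
  have : IsDeltaRel (fun v : Γ → El A =>
      (∀ x : El A, x.1 ∈ (v i).1 → ∀ y : El A, y.1 ∈ x.1 → y.1 ∈ (v i).1) ∧
        ∀ x : El A, x.1 ∈ (v i).1 → ∀ y : El A, y.1 ∈ x.1 → ∀ z : El A, z.1 ∈ y.1 → z.1 ∈ x.1) := by
    refine .and (.ball i (.ball none (.mem none (some (some i)))))
      (.ball i (.ball none (.ball none (.mem none (some (some none))))))
  refine this.of_iff fun v => ?_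
  rw [ZFSet.isOrdinal_iff_forall_mem_isTransitive]
  constructor
  · rintro ⟨h1, h2⟩
    exact ⟨fun x hx y hy => h1.mem_trans hy hx,
      fun x hx y hy z hz => (h2 _ hx).mem_trans hz hy⟩
  · rintro ⟨h1, h2⟩
    refine ⟨fun x hx y hy => ?_, fun x hx y hy z hz => ?_⟩
    · have hx' := mem_of_mem (v i).2 hx
      exact h1 ⟨x, hx'⟩ hx ⟨y, mem_of_mem hx' hy⟩ hy
    · have hx' := mem_of_mem (v i).2 hx
      have hy' := mem_of_mem hx' hy
      exact h2 ⟨x, hx'⟩ hx ⟨y, hy'⟩ hy ⟨z, mem_of_mem hy' hz⟩ hz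

/-- Ordinals are coded by von Neumann ordinals. -/
noncomputable instance : Coded A (On A) where
  enc α := ⟨_, α.2⟩
  enc_injective α β h := Subtype.ext (Ordinal.toZFSet_injective (congrArg Subtype.val h))
  range_sigma := (IsDeltaRel.isOrdinal ()).isSigmaRel.of_iff fun v => by
    constructor
    · rintro ⟨t, h⟩
      rw [← h]
      exact ZFSet.isOrdinal_toZFSet _
    · intro h
      refine ⟨⟨(v ()).1.rank, ?_⟩, Subtype.ext h.toZFSet_rank_eq⟩
      rw [h.toZFSet_rank_eq]
      exact (v ()).2

theorem On.mem_of_lt {α β : Ordinal.{u}} (h : α < β) (hβ : β.toZFSet ∈ A) : α.toZFSet ∈ A :=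
  mem_of_mem hβ (Ordinal.toZFSet_mem_toZFSet_iff.2 h)

/-- The set of predecessors of an ordinal. -/
noncomputable def On.iio (α : On A) : ASet A (On A) :=
  ⟨enc A α, fun x hx => by
    obtain ⟨β, hβ, h⟩ := Ordinal.mem_toZFSet_iff.1 hx
    exact ⟨⟨β, On.mem_of_lt hβ α.2⟩, Subtype.ext h⟩⟩

theorem On.mem_iio {α β : On A} : β ∈ On.iio α ↔ β < α := Ordinal.toZFSet_mem_toZFSet_iff

theorem SigmaFun.iio {f : T → On A} (hf : SigmaFun A f) : SigmaFun A (fun t => On.iio (f t)) :=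
  comp (g := On.iio) (SigmaPred.of_rel₂ (S := fun a b => b = a)
    (IsDeltaRel.eq false true).isSigmaRel fun _ _ => (enc_inj A).symm) hf

theorem SigmaSet.iio {f : T → On A} (hf : SigmaFun A f) :
    SigmaSet A (fun t => {γ | γ < f t}) := ⟨_, hf.iio, fun _ _ => On.mem_iio⟩

@[fun_prop]
theorem SigmaFun.lt {f g : T → On A} (hf : SigmaFun A f) (hg : SigmaFun A g) :
    SigmaFun A (fun t => f t < g t) := .mem (.iio hg) hf

@[fun_prop]
theorem SigmaFun.le {f g : T → On A} (hf : SigmaFun A f) (hg : SigmaFun A g) :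
    SigmaFun A (fun t => f t ≤ g t) := (hg.lt hf).not.congr fun t => by simp

/-- An element of `A` as a set of elements of `A`. -/
def ASet.ofEl (a : El A) : ASet A (El A) := ⟨a, fun x _ => ⟨x, rfl⟩⟩

theorem On.zero_mem (A : ZFSet.{u}) [Adm A] : (0 : Ordinal.{u}).toZFSet ∈ A := by
  simpa using empty_mem A

theorem On.succ_mem (α : On A) : (α.1 + 1).toZFSet ∈ A := by
  obtain ⟨S, hS⟩ := ASet.exists_pair (A := A) (enc A α) (enc A α)
  obtain ⟨B, hB⟩ := ASet.exists_union (ASet.ofEl (enc A α)) S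
  have : (α.1 + 1).toZFSet = B.1.1 := by
    ext x
    rw [Ordinal.toZFSet_add_one, ZFSet.mem_insert_iff]
    constructor
    · rintro (rfl | hx)
      · exact (hB (enc A α)).2 (.inr ((hS _).2 (.inl rfl)))
      · exact (hB ⟨x, mem_of_mem α.2 hx⟩).2 (.inl hx)
    · intro hx
      rcases (hB ⟨x, mem_of_mem B.1.2 hx⟩).1 hx with h | h
      · exact .inr h
      · exact .inl (congrArg Subtype.val ((hS _).1 h |>.elim _root_.id _root_.id))
  rw [this]
  exact B.1.2

/-- The ordinals in a set are bounded by the successor of its union. -/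
theorem ASet.exists_bound (S : ASet A (On A)) : ∃ β : On A, ∀ α, α ∈ S → α < β := by
  let S' : ASet A (ASet A (El A)) := ⟨S.1, fun x _ => ⟨ASet.ofEl x, rfl⟩⟩
  obtain ⟨B, hB⟩ := ASet.exists_sUnion S'
  have hord : B.1.1.IsOrdinal := by
    have : B.1.1 = ZFSet.sUnion S.1.1 := by
      ext x
      rw [ZFSet.mem_sUnion]
      constructor
      · intro hx
        obtain ⟨s, hs, hxs⟩ := (hB ⟨x, mem_of_mem B.1.2 hx⟩).1 hx
        exact ⟨s.1.1, hs, hxs⟩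
      · rintro ⟨z, hz, hx⟩
        have hz' := mem_of_mem S.1.2 hz
        exact (hB ⟨x, mem_of_mem hz' hx⟩).2 ⟨ASet.ofEl ⟨z, hz'⟩, hz, hx⟩
    have key : ∀ z ∈ S.1.1, z.IsOrdinal := fun z hz => by
      obtain ⟨α, hα⟩ := S.2 ⟨z, mem_of_mem S.1.2 hz⟩ hz
      have : z = α.1.toZFSet := (congrArg Subtype.val hα).symm
      rw [this]
      exact ZFSet.isOrdinal_toZFSet _
    rw [this, ZFSet.isOrdinal_iff_forall_mem_isTransitive]
    refine ⟨ZFSet.IsTransitive.sUnion' fun y hy => (key y hy).isTransitive, fun y hy => ?_⟩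
    obtain ⟨z, hz, hyz⟩ := ZFSet.mem_sUnion.1 hy
    exact ((key z hz).mem hyz).isTransitive
  have hβ : B.1.1.rank.toZFSet ∈ A := by
    rw [hord.toZFSet_rank_eq]
    exact B.1.2
  refine ⟨⟨_, On.succ_mem ⟨_, hβ⟩⟩, fun α hα => ?_⟩
  change α.1 < B.1.1.rank + 1
  rw [Order.lt_add_one_iff, ← Ordinal.toZFSet_subset_toZFSet_iff, hord.toZFSet_rank_eq]
  intro x hx
  exact (hB ⟨x, mem_of_mem α.2 hx⟩).2 ⟨ASet.ofEl (enc A α), hα, hx⟩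

/-- The function that picks the least ordinal with a recursive property is recursive. -/
theorem SigmaFun.least {f : T → On A} {P : T → On A → Prop}
    (hP : SigmaFun A (fun p : T × On A => P p.1 p.2)) (h : ∀ t, IsLeast {β | P t β} (f t)) :
    SigmaFun A f := by
  have : SigmaPred A (fun p : T × On A => P p.1 p.2 ∧ ∀ β, β ∈ {β | β < p.2} → ¬ P p.1 β) := by
    refine hP.sigmaPred.and (.ball (.iio (by fun_prop)) (SigmaFun.sigmaPred ?_))
    exact (hP.comp (f := fun p : (T × On A) × On A => (p.1.1, p.2)) (by fun_prop)).not
  refine this.of_iff fun p => ?_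
  constructor
  · rintro hp
    rw [hp]
    refine ⟨(h p.1).1, fun β hβ hP => ?_⟩
    exact absurd ((h p.1).2 hP) (not_le.2 hβ)
  · rintro ⟨h1, h2⟩
    refine le_antisymm (not_lt.1 fun h3 => h2 _ h3 (h p.1).1) ((h p.1).2 h1)

/-! ### Natural numbers in an admissible set -/

/-- Admissible sets that contain `ω`. -/
class AdmOmega (A : ZFSet.{u}) : Prop extends Adm A where
  omega_mem : (Ordinal.omega0.{u}).toZFSet ∈ A

section Omega

variable {A : ZFSet.{u}} [hA : AdmOmega A]
variable {T U W V : Type*} [Coded A T] [Coded A U] [Coded A W] [Coded A V]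

theorem natSet_mem (n : ℕ) : natSet n ∈ A := On.mem_of_lt (Ordinal.natCast_lt_omega0 n) hA.omega_mem

/-- Natural numbers are coded by von Neumann numerals. -/
noncomputable instance : Coded A ℕ where
  enc n := ⟨natSet n, natSet_mem n⟩
  enc_injective m n h := by
    have := Ordinal.toZFSet_injective (congrArg Subtype.val h)
    exact_mod_cast this
  range_sigma := by
    have : IsSigmaRel (fun v : Unit → El A => (v ()).1 ∈ (Ordinal.omega0.{u}).toZFSet) :=
      ((IsDeltaRel.mem (A := A) (some ()) (none : Option Unit)).const
        ⟨_, hA.omega_mem⟩).isSigmaRel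
    refine this.of_iff fun v => ?_
    rw [Ordinal.mem_toZFSet_iff]
    constructor
    · rintro ⟨n, h⟩
      exact ⟨n, Ordinal.natCast_lt_omega0 n, congrArg Subtype.val h⟩
    · rintro ⟨a, ha, h⟩
      obtain ⟨n, rfl⟩ := Ordinal.lt_omega0.1 ha
      exact ⟨n, Subtype.ext h⟩

theorem SigmaFun.natCast : SigmaFun A (fun n : ℕ => (⟨n, natSet_mem n⟩ : On A)) :=
  SigmaPred.of_rel₂ (S := fun a b => b = a) (IsDeltaRel.eq false true).isSigmaRel
    fun n β => (enc_inj A (t := β) (t' := (⟨n, natSet_mem n⟩ : On A))).symm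

@[fun_prop]
theorem SigmaFun.natLt {f g : T → ℕ} (hf : SigmaFun A f) (hg : SigmaFun A g) :
    SigmaFun A (fun t => f t < g t) :=
  ((natCast.comp hf).lt (natCast.comp hg)).congr fun t => by
    rw [eq_iff_iff, ← Subtype.coe_lt_coe, Nat.cast_lt]

theorem SigmaSet.nat : SigmaSet A (fun _ : T => (Set.univ : Set ℕ)) := by
  have h : ∀ x : El A, x.1 ∈ (Ordinal.omega0.{u}).toZFSet → ∃ t : ℕ, enc A t = x := fun x hx => by
    obtain ⟨a, ha, h⟩ := Ordinal.mem_toZFSet_iff.1 hx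
    obtain ⟨n, rfl⟩ := Ordinal.lt_omega0.1 ha
    exact ⟨n, Subtype.ext h⟩
  refine (const ⟨⟨_, hA.omega_mem⟩, h⟩).of_eq fun t n => ?_
  simp only [Set.mem_univ, true_iff]
  exact Ordinal.toZFSet_mem_toZFSet_iff.2 (Ordinal.natCast_lt_omega0 n)

theorem SigmaSet.natIio {f : T → ℕ} (hf : SigmaFun A f) : SigmaSet A (fun t => {n | n < f t}) :=
  (nat.sep (P := fun t n => n < f t) (by fun_prop)).of_eq fun t n => by simp

@[fun_prop]
theorem SigmaFun.natSucc {f : T → ℕ} (hf : SigmaFun A f) : SigmaFun A (fun t => f t + 1) := by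
  have : SigmaPred A (fun p : ℕ × ℕ => p.1 < p.2 ∧ ∀ k, k ∈ {k | k < p.2} → ¬ p.1 < k) :=
    .and (SigmaFun.sigmaPred (by fun_prop))
      (.ball (.natIio (by fun_prop)) (SigmaFun.sigmaPred (by fun_prop)))
  have h2 : SigmaFun A (fun n : ℕ => n + 1) := this.of_iff fun p => by
    constructor
    · intro h
      rw [h]
      refine ⟨Nat.lt_succ_self _, fun k hk => ?_⟩
      have : k < p.1 + 1 := hk
      omega
    · rintro ⟨h1, h2⟩
      by_contra h3
      change ¬ p.2 = p.1 + 1 at h3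
      exact h2 (p.1 + 1) (show p.1 + 1 < p.2 by omega) (Nat.lt_succ_self _)
  exact h2.comp hf

/-- Primitive recursion, with values in an arbitrary coded type. -/
theorem SigmaFun.natRec {f : T → U} (hf : SigmaFun A f) {h : T → ℕ → U → U}
    (hh : SigmaFun A (fun p : T × ℕ × U => h p.1 p.2.1 p.2.2)) :
    SigmaFun A (fun p : T × ℕ => Nat.rec (motive := fun _ => U) (f p.1) (h p.1) p.2) := by
  have hb : SigmaSet A (fun p : T × ℕ => (fun n => (p.1, n)) '' {n | n < p.2}) :=
    (SigmaSet.natIio (by fun_prop)).image (f := fun (p : T × ℕ) n => (p.1, n)) (by fun_prop)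
  refine (sigma_recursion (r := InvImage (· < ·) (Prod.snd : T × ℕ → ℕ))
    (InvImage.wf _ Nat.lt_wfRel.wf) hb ?_
    (G := fun p u => u = Nat.rec (motive := fun _ => U) (f p.1) (h p.1) p.2) ?_
    (Ψ := fun p u g => (p.2 = 0 ∧ u = f p.1) ∨ ∃ n, p.2 = n + 1 ∧ ∃ w, ((p.1, n), w) ∈ g ∧
      u = h p.1 n w) ?_ ?_).2
  · rintro ⟨t, n⟩ _ ⟨m, hm, rfl⟩
    exact hm
  · rintro p u u' rfl rfl
    rfl
  · refine .or (SigmaFun.sigmaPred (by fun_prop)) (.ex (.and (SigmaFun.sigmaPred (by fun_prop))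
      (.ex (.and (SigmaFun.mem_aset (by fun_prop) (by fun_prop)).sigmaPred
        (SigmaPred.graph (by fun_prop) ?_)))))
    exact hh.comp (f := fun p : (((((T × ℕ) × U) × ASet A ((T × ℕ) × U)) × ℕ) × U) =>
      (p.1.1.1.1.1, p.1.2, p.2)) (by fun_prop)
  · rintro ⟨t, n⟩ g hg -
    cases n with
    | zero =>
      refine ⟨⟨f t, .inl ⟨rfl, rfl⟩⟩, ?_⟩
      rintro u (⟨-, hu⟩ | ⟨n, hn, -⟩)
      · exact hu
      · simp at hn
    | succ n =>
      refine ⟨⟨_, .inr ⟨n, rfl, Nat.rec (motive := fun _ => U) (f t) (h t) n,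
        (hg _).2 ⟨⟨n, Nat.lt_succ_self n, rfl⟩, rfl⟩, rfl⟩⟩, ?_⟩
      rintro u (⟨h0, -⟩ | ⟨m, hm, w, hw, rfl⟩)
      · simp at h0
      · obtain rfl : n = m := by simpa using hm
        exact congrArg (h t n) ((hg _).1 hw).2

end Omega

end Admissible

/-! ### Finite sets of coded objects -/

namespace Admissible

open KripkePlatek

variable {A : ZFSet.{u}} [hA : AdmOmega A]
variable {T U W V : Type*} [Coded A T] [Coded A U] [Coded A W] [Coded A V] {Γ : Type}

theorem SigmaSet.choose {X : T → Set U} (hX : SigmaSet A X) (t : T) :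
    ∃ S : ASet A U, ∀ u, u ∈ S ↔ u ∈ X t := by
  obtain ⟨F, -, h⟩ := hX
  exact ⟨F t, h t⟩

theorem ASet.exists_of_finite {X : Set U} (hX : X.Finite) : ∃ S : ASet A U, ∀ u, u ∈ S ↔ u ∈ X := by
  induction X, hX using Set.Finite.induction_on with
  | empty => simpa using ASet.exists_empty (A := A) (U := U)
  | @insert a s _ _ ih =>
    obtain ⟨S, hS⟩ := ih
    obtain ⟨P, hP⟩ := ASet.exists_pair (A := A) a a
    obtain ⟨B, hB⟩ := ASet.exists_union P S
    exact ⟨B, fun u => by simp [hB, hP, hS]⟩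

/-- The finite subsets of a set form a set, recursively in the given set. -/
theorem SigmaSet.finite_subsets :
    SigmaSet A (fun S : ASet A U =>
      {B : ASet A U | (∀ u, u ∈ B → u ∈ S) ∧ {u | u ∈ B}.Finite}) := by
  obtain ⟨ins, hins, hins'⟩ := SigmaSet.union (A := A) (T := U × ASet A U)
    (SigmaSet.singleton (SigmaFun.fst' (T := U))) (SigmaFun.snd' (T := U) (U := ASet A U)).sigmaSet
  obtain ⟨e, he⟩ := ASet.exists_empty (A := A) (U := U)
  obtain ⟨b, hb, hb'⟩ : SigmaSet A (fun _ : ASet A U => ({e} : Set (ASet A U))) :=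
    .singleton (by fun_prop)
  have h1 : SigmaSet A (fun p : ASet A U × ASet A (ASet A U) =>
      {B | B ∈ p.2} ∪ ins '' ({u | u ∈ p.1} ×ˢ {B | B ∈ p.2})) := by
    refine .union (SigmaFun.sigmaSet (by fun_prop)) (.image (.prod (SigmaFun.sigmaSet (by fun_prop))
      (SigmaFun.sigmaSet (by fun_prop))) (by fun_prop))
  obtain ⟨step, hstep, hstep'⟩ := h1
  -- `G (S, n)` is the set of all subsets of `S` with at most `n` elements.
  let G : ASet A U × ℕ → ASet A (ASet A U) := fun p =>
    Nat.rec (motive := fun _ => ASet A (ASet A U)) (b p.1) (fun _ W => step (p.1, W)) p.2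
  have hG : SigmaFun A G := SigmaFun.natRec (h := fun S _ W => step (S, W)) hb (by fun_prop)
  have h2 : SigmaSet A (fun S : ASet A U =>
      {B | ∃ n, n ∈ (Set.univ : Set ℕ) ∧ B ∈ {B | B ∈ G (S, n)}}) :=
    .biUnion .nat (SigmaFun.sigmaSet (by fun_prop))
  refine h2.of_eq fun S B => ?_
  simp only [Set.mem_ofPred_eq, Set.mem_univ, true_and]
  have hz : ∀ B, B ∈ G (S, 0) ↔ B = e := fun B => hb' S B
  have hs : ∀ n B, B ∈ G (S, n + 1) ↔ B ∈ G (S, n) ∨ ∃ u C, u ∈ S ∧ C ∈ G (S, n) ∧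
      ins (u, C) = B := fun n B => by
    refine (hstep' (S, G (S, n)) B).trans ?_
    simp only [Set.mem_union, Set.mem_image, Set.mem_prod, Prod.exists, and_assoc]
    rfl
  have hi : ∀ u C w, w ∈ ins (u, C) ↔ w = u ∨ w ∈ C := fun u C w => by
    refine (hins' (u, C) w).trans ?_
    simp only [Set.mem_union, Set.mem_singleton_iff]
    rfl
  constructor
  · rintro ⟨h3, h4⟩
    obtain ⟨X, hX⟩ : ∃ X, X = {u | u ∈ B} := ⟨_, rfl⟩
    rw [← hX] at h4
    have key : (∀ u ∈ X, u ∈ S) → ∃ n, ∃ C ∈ G (S, n), ∀ u, u ∈ C ↔ u ∈ X := by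
      clear hX h3
      induction X, h4 using Set.Finite.induction_on with
      | empty => exact fun _ => ⟨0, e, (hz e).2 rfl, by simpa using he⟩
      | @insert a s _ _ ih =>
        intro h
        obtain ⟨n, C, hC, hC'⟩ := ih fun u hu => h u (Set.mem_insert_of_mem _ hu)
        exact ⟨n + 1, _, (hs _ _).2 (.inr ⟨a, C, h a (Set.mem_insert _ _), hC, rfl⟩), fun u => by
          rw [hi, hC', Set.mem_insert_iff]⟩
    obtain ⟨n, C, hC, hC'⟩ := key (by subst hX; exact h3)
    have : B = C := ASet.ext fun u => by
      rw [hC', hX]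
      rfl
    exact ⟨n, this ▸ hC⟩
  · rintro ⟨n, hn⟩
    induction n generalizing B with
    | zero =>
      obtain rfl := (hz B).1 hn
      exact ⟨fun u hu => (he u hu).elim, Set.finite_empty.subset fun u hu => (he u hu).elim⟩
    | succ n ih =>
      rcases (hs n B).1 hn with h | ⟨u, C, hu, hC, rfl⟩
      · exact ih B h
      · obtain ⟨h3, h4⟩ := ih C hC
        refine ⟨fun w hw => ?_, (h4.insert u).subset fun w hw => (hi u C w).1 hw⟩
        rcases (hi u C w).1 hw with rfl | hw
        exacts [hu, h3 w hw]

variable (A) in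
/-- A finite set of coded objects as an element of `A`. -/
noncomputable def ASet.ofFinset (F : Finset U) : ASet A U :=
  Classical.choose (ASet.exists_of_finite (A := A) F.finite_toSet)

theorem ASet.mem_ofFinset {F : Finset U} {u : U} : u ∈ ASet.ofFinset A F ↔ u ∈ F :=
  Classical.choose_spec (ASet.exists_of_finite (A := A) F.finite_toSet) u

/-- Finite sets are coded by the sets of codes of their elements. -/
noncomputable instance : Coded A (Finset U) where
  enc F := enc A (ASet.ofFinset A F)
  enc_injective F F' h := by
    have := (enc_inj A).1 h
    ext u
    rw [← ASet.mem_ofFinset (A := A), this, ASet.mem_ofFinset]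
  range_sigma := by
    have h : SigmaFun A (fun B : ASet A U =>
        B ∈ {B : ASet A U | (∀ u, u ∈ B → u ∈ B) ∧ {u | u ∈ B}.Finite}) :=
      .mem .finite_subsets (by fun_prop : SigmaFun A (fun B : ASet A U => B))
    have h2 : SigmaPred A (fun B : ASet A U => {u | u ∈ B}.Finite) :=
      h.sigmaPred.of_iff fun B => by simp
    refine IsSigmaRel.of_iff h2 fun v => ?_
    constructor
    · rintro ⟨F, hF⟩
      exact ⟨_, hF, F.finite_toSet.subset fun u hu => ASet.mem_ofFinset.1 hu⟩
    · rintro ⟨B, hB, h⟩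
      refine ⟨h.toFinset, ?_⟩
      rw [← hB, enc_inj]
      refine ASet.ext fun u => ?_
      rw [ASet.mem_ofFinset, Set.Finite.mem_toFinset]
      rfl

theorem enc_finset (F : Finset U) : enc A F = enc A (ASet.ofFinset A F) := rfl

theorem SigmaFun.ofFinset {f : T → Finset U} (hf : SigmaFun A f) :
    SigmaFun A (fun t => ASet.ofFinset A (f t)) :=
  comp (g := ASet.ofFinset A) (SigmaPred.of_rel₂ (S := fun a b => b = a)
    (IsDeltaRel.eq false true).isSigmaRel fun F B =>
      (enc_inj A (t := B) (t' := ASet.ofFinset A F)).symm) hf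

theorem SigmaSet.coe {f : T → Finset U} (hf : SigmaFun A f) :
    SigmaSet A (fun t => (f t : Set U)) := ⟨_, hf.ofFinset, fun _ _ => ASet.mem_ofFinset⟩

/-- A function into finite sets is recursive if it is recursive as a set-valued function. -/
theorem SigmaFun.finset_of_coe {f : T → Finset U} (hf : SigmaSet A (fun t => (f t : Set U))) :
    SigmaFun A f := by
  have h1 : SigmaFun A (fun t => ASet.ofFinset A (f t)) :=
    .of_mem_iff hf fun t u => ASet.mem_ofFinset
  have h2 : SigmaPred A (fun p : T × Finset U => ASet.ofFinset A p.2 = ASet.ofFinset A (f p.1)) :=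
    .graph (SigmaFun.ofFinset (by fun_prop)) (h1.comp (by fun_prop))
  refine h2.of_iff fun p => ⟨fun h => by rw [h], fun h => ?_⟩
  ext u
  rw [← ASet.mem_ofFinset (A := A), h, ASet.mem_ofFinset]

theorem SigmaSet.finset_subsets {X : T → Set U} (hX : SigmaSet A X) :
    SigmaSet A (fun t => {F : Finset U | (F : Set U) ⊆ X t}) := by
  obtain ⟨F, hF, h⟩ := hX
  have h1 : SigmaSet A (fun t => {B : ASet A U | (∀ u, u ∈ B → u ∈ F t) ∧ {u | u ∈ B}.Finite}) :=
    finite_subsets.comp hF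
  refine mk (fun t => ?_) ?_
  · obtain ⟨S, hS⟩ := h1.choose t
    refine ⟨⟨S.1, fun x hx => ?_⟩, fun G => ?_⟩
    · obtain ⟨B, rfl⟩ := S.2 x hx
      have h2 := ((hS B).1 hx).2
      refine ⟨h2.toFinset, ?_⟩
      rw [enc_finset, enc_inj]
      refine ASet.ext fun u => ?_
      rw [ASet.mem_ofFinset, Set.Finite.mem_toFinset]
      rfl
    · refine (hS (ASet.ofFinset A G)).trans ?_
      simp only [Set.mem_ofPred_eq, ASet.mem_ofFinset, h]
      exact and_iff_left (G.finite_toSet.subset fun u hu => hu)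
  · have : SigmaPred A (fun p : T × ASet A (Finset U) =>
        (∀ G, G ∈ {G | G ∈ p.2} → ∀ u, u ∈ (G : Set U) → u ∈ {u | u ∈ F p.1}) ∧
        ∀ B, B ∈ {B : ASet A U | (∀ u, u ∈ B → u ∈ F p.1) ∧ {u | u ∈ B}.Finite} →
          ∃ G : Finset U, ASet.ofFinset A G = B ∧ G ∈ p.2) := by
      refine .and (.ball (SigmaFun.sigmaSet (by fun_prop)) (.ball (.coe (by fun_prop))
        (SigmaFun.sigmaPred (.mem (SigmaFun.sigmaSet (by fun_prop)) (by fun_prop)))))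
        (.ball (h1.comp (by fun_prop)) (.ex (.and (.graph (.ofFinset (by fun_prop)) (by fun_prop))
          (SigmaFun.mem_aset (by fun_prop) (by fun_prop)).sigmaPred)))
    refine this.of_iff fun p => ?_
    simp only [Set.mem_ofPred_eq, Finset.mem_coe, Set.subset_def, ← h]
    constructor
    · intro h2
      refine ⟨fun G hG u hu => (h2 G).1 hG u hu, fun B hB => ⟨hB.2.toFinset, ASet.ext fun u => ?_,
        (h2 _).2 fun u hu => hB.1 u ?_⟩⟩
      · rw [ASet.mem_ofFinset, Set.Finite.mem_toFinset]
        rfl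
      · exact (Set.Finite.mem_toFinset hB.2).1 hu
    · rintro ⟨h2, h3⟩ G
      refine ⟨fun hG => h2 G hG, fun hG => ?_⟩
      obtain ⟨G', h4, h5⟩ := h3 (ASet.ofFinset A G)
        ⟨fun u hu => hG u (ASet.mem_ofFinset.1 hu),
          G.finite_toSet.subset fun u hu => ASet.mem_ofFinset.1 hu⟩
      have : G' = G := by
        ext u
        rw [← ASet.mem_ofFinset (A := A), h4, ASet.mem_ofFinset]
      exact this ▸ h5

theorem SigmaFun.finset_mem {f : T → U} {F : T → Finset U} (hf : SigmaFun A f)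
    (hF : SigmaFun A F) : SigmaFun A (fun t => f t ∈ F t) := .mem (.coe hF) hf

theorem SigmaFun.finset_image [DecidableEq W] {F : T → Finset U} {f : T → U → W}
    (hF : SigmaFun A F) (hf : SigmaFun A (fun p : T × U => f p.1 p.2)) :
    SigmaFun A (fun t => (F t).image (f t)) := by
  refine finset_of_coe ?_
  simp only [Finset.coe_image]
  exact .image (.coe hF) hf

theorem SigmaFun.finset_filter {F : T → Finset U} {P : T → U → Prop} [∀ t, DecidablePred (P t)]
    (hF : SigmaFun A F) (hP : SigmaFun A (fun p : T × U => P p.1 p.2)) :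
    SigmaFun A (fun t => (F t).filter (P t)) := by
  refine finset_of_coe ?_
  simp only [Finset.coe_filter]
  exact .sep (.coe hF) hP

theorem SigmaFun.finset_union [DecidableEq U] {F G : T → Finset U}
    (hF : SigmaFun A F) (hG : SigmaFun A G) : SigmaFun A (fun t => F t ∪ G t) := by
  refine finset_of_coe ?_
  simp only [Finset.coe_union]
  exact .union (.coe hF) (.coe hG)

theorem SigmaFun.finset_singleton {f : T → U} (hf : SigmaFun A f) :
    SigmaFun A (fun t => ({f t} : Finset U)) := by
  refine finset_of_coe ?_
  simp only [Finset.coe_singleton]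
  exact .singleton hf

/-- The number of elements of a finite set is recursive, because it is witnessed by the graph of an
enumeration. -/
@[fun_prop]
theorem SigmaFun.finset_card {F : T → Finset U} (hF : SigmaFun A F) :
    SigmaFun A (fun t => (F t).card) := by
  have h1 : SigmaPred A (fun p : Finset U × ℕ => ∃ h : Finset (U × ℕ),
      (∀ q, q ∈ (h : Set (U × ℕ)) → (q.1 ∈ p.1 ∧ q.2 < p.2) ∧
        ∀ q', q' ∈ (h : Set (U × ℕ)) → (q.1 = q'.1 ↔ q.2 = q'.2)) ∧
      (∀ u, u ∈ (p.1 : Set U) → ∃ q, q ∈ (h : Set (U × ℕ)) ∧ q.1 = u) ∧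
      (∀ m, m ∈ {m | m < p.2} → ∃ q, q ∈ (h : Set (U × ℕ)) ∧ q.2 = m)) := by
    refine .ex (.and (.ball (.coe (by fun_prop)) (SigmaFun.sigmaPred (.and (.and ?_ ?_)
      (.ball (.coe (by fun_prop)) (by fun_prop))))) (.and (.ball (.coe (by fun_prop))
        (SigmaFun.sigmaPred (.bex (.coe (by fun_prop)) (by fun_prop))))
          (.ball (.natIio (by fun_prop)) (SigmaFun.sigmaPred (.bex (.coe (by fun_prop))
            (by fun_prop))))))
    · exact .finset_mem (by fun_prop) (by fun_prop)
    · fun_prop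
  have h2 : SigmaFun A (fun F : Finset U => F.card) := h1.of_iff fun p => by
    obtain ⟨F, n⟩ := p
    simp only [Finset.mem_coe, Set.mem_ofPred_eq]
    constructor
    · rintro rfl
      let e := F.equivFin
      classical
      refine ⟨Finset.univ.image fun u : F => (u.1, (e u : ℕ)), ?_, ?_, ?_⟩
      · simp only [Finset.mem_image, Finset.mem_univ, true_and]
        rintro _ ⟨u, rfl⟩
        refine ⟨⟨u.2, (e u).2⟩, ?_⟩
        rintro _ ⟨v, rfl⟩
        simp only [← Subtype.ext_iff, ← Fin.ext_iff, e.injective.eq_iff]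
      · intro u hu
        exact ⟨(u, e ⟨u, hu⟩), Finset.mem_image.2 ⟨⟨u, hu⟩, Finset.mem_univ _, rfl⟩, rfl⟩
      · intro m hm
        exact ⟨((e.symm ⟨m, hm⟩).1, m),
          Finset.mem_image.2 ⟨e.symm ⟨m, hm⟩, Finset.mem_univ _, by simp⟩, rfl⟩
    · rintro ⟨h, h1, h2, h3⟩
      have e1 : h.card = F.card := Finset.card_bij (fun q _ => q.1) (fun q hq => (h1 q hq).1.1)
        (fun q hq q' hq' e => Prod.ext e (((h1 q hq).2 q' hq').1 e))
        (fun u hu => by obtain ⟨q, hq, e⟩ := h2 u hu; exact ⟨q, hq, e⟩)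
      have e2 : h.card = (Finset.range n).card := Finset.card_bij (fun q _ => q.2)
        (fun q hq => Finset.mem_range.2 (h1 q hq).1.2)
        (fun q hq q' hq' e => Prod.ext (((h1 q hq).2 q' hq').2 e) e)
        (fun u hu => by obtain ⟨q, hq, e⟩ := h3 u (Finset.mem_range.1 hu); exact ⟨q, hq, e⟩)
      rw [Finset.card_range] at e2
      exact e2.symm.trans e1
  exact h2.comp hF

end Admissible

/-! ### Positions in finite sets -/

section Rank

variable {X Y : Type*} [LinearOrder X] [LinearOrder Y]

/-- The number of elements of `c` below `x`. For `x ∈ c` this is the position of `x` in the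
increasing enumeration of `c`. -/
def Finset.posIn (c : Finset X) (x : X) : ℕ := (c.filter (· < x)).card

theorem Finset.posIn_lt_card {c : Finset X} {x : X} (h : x ∈ c) : c.posIn x < c.card :=
  Finset.card_lt_card (Finset.filter_ssubset.2 ⟨x, h, lt_irrefl x⟩)

theorem Finset.posIn_lt_posIn {c : Finset X} {x y : X} (h : x ∈ c) :
    c.posIn x < c.posIn y ↔ x < y := by
  constructor
  · intro hxy
    by_contra hyx
    rw [not_lt] at hyx
    exact absurd hxy (not_lt.2 (Finset.card_le_card
      (Finset.monotone_filter_right _ fun z _ hz => lt_of_lt_of_le hz hyx)))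
  · intro hxy
    refine Finset.card_lt_card (Finset.ssubset_iff_of_subset ?_ |>.2 ⟨x, ?_, ?_⟩)
    · exact Finset.monotone_filter_right _ fun z _ hz => lt_trans hz hxy
    · exact Finset.mem_filter.2 ⟨h, hxy⟩
    · simp

theorem Finset.posIn_image [DecidableEq Y] {c : Finset X} {x : X} (hx : x ∈ c) {f : X → Y}
    (hf : StrictMonoOn f (c : Set X)) : (c.image f).posIn (f x) = c.posIn x := by
  rw [Finset.posIn, Finset.posIn, Finset.filter_image, Finset.card_image_of_injOn]
  · refine congrArg Finset.card (Finset.filter_congr fun y hy => ?_)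
    exact hf.lt_iff_lt hy hx
  · exact hf.injOn.mono fun y hy => (Finset.mem_filter.1 hy).1

theorem Finset.posIn_image_univ [DecidableEq X] {n : ℕ} {f : Fin n → X}
    (hf : StrictMono f) (i : Fin n) : (Finset.univ.image f).posIn (f i) = i := by
  rw [Finset.posIn_image (Finset.mem_univ i) (hf.strictMonoOn _), Finset.posIn]
  have : Finset.univ.filter (· < i) = Finset.Iio i := by
    ext j
    simp
  rw [this, Fin.card_Iio]

end Rank

/-! ### Terms for the values of a dilator -/

namespace PreDilator

variable (D : PreDilator.{u}) {X Y : Type*} [LinearOrder X] [LinearOrder Y]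

/-- The graph of a morphism of natural numbers. -/
def graph {m n : ℕ} (f : Fin m ↪o Fin n) : Finset (ℕ × ℕ) :=
  Finset.univ.image (fun i : Fin m => ((i : ℕ), (f i : ℕ)))

theorem graph_injective {m n : ℕ} {f g : Fin m ↪o Fin n} (h : graph f = graph g) : f = g := by
  ext i
  have : ((i : ℕ), (f i : ℕ)) ∈ graph g := by
    rw [← h]
    exact Finset.mem_image_of_mem _ (Finset.mem_univ i)
  obtain ⟨j, -, hj⟩ := Finset.mem_image.1 this
  obtain ⟨h1, h2⟩ := Prod.mk.inj hj
  obtain rfl := Fin.ext h1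
  exact h2.symm

open Classical in
/-- The value of `D(f)` at `σ`, where `f : m → n` is the morphism with the given graph. If there is
no such morphism or if `σ` is not an element of `D(m)`, the value is zero. -/
noncomputable def act (m n : ℕ) (r : Finset (ℕ × ℕ)) (σ : Ordinal.{u}) : Ordinal.{u} :=
  if h : (∃ f : Fin m ↪o Fin n, graph f = r) ∧ σ < D.obj m then
    (D.map (Classical.choose h.1) ⟨σ, h.2⟩).1 else 0

variable {D}

theorem act_graph {m n : ℕ} (f : Fin m ↪o Fin n) {σ : Ordinal.{u}} (hσ : σ < D.obj m) :
    D.act m n (graph f) σ = (D.map f ⟨σ, hσ⟩).1 := by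
  have h : (∃ g : Fin m ↪o Fin n, graph g = graph f) ∧ σ < D.obj m := ⟨⟨f, rfl⟩, hσ⟩
  rw [act, dif_pos h, graph_injective (Classical.choose_spec h.1)]

/-- The graph of the map `|ι_c^e| : |c| → |e|` that is induced by an inclusion `c ⊆ e`. -/
def inclGraph (c e : Finset X) : Finset (ℕ × ℕ) := c.image (fun x => (c.posIn x, e.posIn x))

variable (D) in
/-- The value `D(|ι_c^e|)(σ)` for finite sets `c ⊆ e`, where `p` is the pair `(σ, c)`. -/
noncomputable def eval (e : Finset X) (p : Ordinal.{u} × Finset X) : Ordinal.{u} :=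
  D.act p.2.card e.card (inclGraph p.2 e) p.1

variable (D) in
/-- The pair `(σ, n)` belongs to the trace of `D`. -/
def IsTrace (n : ℕ) (σ : Ordinal.{u}) : Prop := ∃ h : σ < D.obj n, D.InTrace n ⟨σ, h⟩

variable (D) in
/-- The pair `(σ, c)` represents an expression: `(σ, |c|)` belongs to the trace of `D`. -/
def IsTerm (p : Ordinal.{u} × Finset X) : Prop := D.IsTrace p.2.card p.1

variable (D) in
/-- The order between expressions. -/
def TermLT (p q : Ordinal.{u} × Finset X) : Prop := D.eval (p.2 ∪ q.2) p < D.eval (p.2 ∪ q.2) q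

/-- The map `|ι_c^e| : |c| → |e|` that is induced by an inclusion `c ⊆ e`. -/
def incl (c e : Finset X) (h : c ⊆ e) : Fin c.card ↪o Fin e.card :=
  OrderEmbedding.ofStrictMono
    (fun i => ⟨e.posIn (c.orderEmbOfFin rfl i),
      Finset.posIn_lt_card (h (c.orderEmbOfFin_mem rfl i))⟩)
    (fun i _ hij => (Finset.posIn_lt_posIn (h (c.orderEmbOfFin_mem rfl i))).2
      ((c.orderEmbOfFin rfl).strictMono hij))

theorem image_orderEmbOfFin (c : Finset X) :
    Finset.univ.image (c.orderEmbOfFin rfl) = c := by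
  ext x
  rw [← Finset.mem_coe, ← Finset.mem_coe, Finset.coe_image, Finset.coe_univ, Set.image_univ,
    Finset.range_orderEmbOfFin]

theorem posIn_orderEmbOfFin (c : Finset X) (i : Fin c.card) :
    c.posIn (c.orderEmbOfFin rfl i) = i := by
  have := Finset.posIn_image_univ (c.orderEmbOfFin rfl).strictMono i
  rwa [image_orderEmbOfFin] at this

theorem graph_incl {c e : Finset X} (h : c ⊆ e) : graph (incl c e h) = inclGraph c e := by
  have := congrArg (Finset.image (fun x => (c.posIn x, e.posIn x))) (image_orderEmbOfFin c)
  rw [Finset.image_image] at this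
  rw [inclGraph, ← this, graph]
  refine Finset.image_congr fun i _ => ?_
  simp only [Function.comp_apply, posIn_orderEmbOfFin]
  rfl

theorem eval_eq {e : Finset X} {p : Ordinal.{u} × Finset X} (h : p.2 ⊆ e)
    (hσ : p.1 < D.obj p.2.card) :
    D.eval e p = (D.map (incl p.2 e h) ⟨p.1, hσ⟩).1 := by
  rw [eval, ← graph_incl h, act_graph]

theorem inclGraph_image {c e : Finset X} (h : c ⊆ e) {f : X → Y}
    (hf : StrictMonoOn f (e : Set X)) :
    inclGraph (c.image f) (e.image f) = inclGraph c e := by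
  rw [inclGraph, Finset.image_image, inclGraph]
  refine Finset.image_congr fun x hx => ?_
  simp only [Function.comp_apply]
  rw [Finset.posIn_image hx (hf.mono h), Finset.posIn_image (h hx) hf]

theorem eval_image {e : Finset X} {p : Ordinal.{u} × Finset X} (h : p.2 ⊆ e) {f : X → Y}
    (hf : StrictMonoOn f (e : Set X)) :
    D.eval (e.image f) (p.1, p.2.image f) = D.eval e p := by
  rw [eval, eval, inclGraph_image h hf, Finset.card_image_of_injOn hf.injOn,
    Finset.card_image_of_injOn (hf.injOn.mono h)]

theorem termLT_image {p q : Ordinal.{u} × Finset X} {f : X → Y}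
    (hf : StrictMonoOn f ((p.2 ∪ q.2 : Finset X) : Set X)) :
    D.TermLT (p.1, p.2.image f) (q.1, q.2.image f) ↔ D.TermLT p q := by
  rw [TermLT, TermLT, ← eval_image Finset.subset_union_left hf,
    ← eval_image Finset.subset_union_right hf, Finset.image_union]

theorem isTerm_image {p : Ordinal.{u} × Finset X} {f : X → Y}
    (hf : Set.InjOn f (p.2 : Set X)) : D.IsTerm (p.1, p.2.image f) ↔ D.IsTerm p := by
  rw [IsTerm, IsTerm]
  dsimp only
  rw [Finset.card_image_of_injOn hf]

/-- Membership in the trace in terms of the action on morphisms: `σ` has full support if and only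
if it does not come from a proper subset. -/
theorem isTerm_iff {p : Ordinal.{u} × Finset X} :
    D.IsTerm p ↔ p.1 < D.obj p.2.card ∧ ∀ c : Finset X, (c : Set X) ⊆ p.2 →
      (∃ σ, σ < D.obj c.card ∧ D.eval p.2 (σ, c) = p.1) → c = p.2 := by
  constructor
  · rintro ⟨hσ, h⟩
    refine ⟨hσ, fun c hc ⟨σ, hσ', he⟩ => ?_⟩
    by_contra hcp
    have hc' : c ⊆ p.2 := hc
    rw [eval_eq (p := (σ, c)) hc' hσ'] at he
    have h1 : D.map (incl c p.2 hc') ⟨σ, hσ'⟩ = ⟨p.1, hσ⟩ := Subtype.ext he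
    have h2 := D.supp_map (incl c p.2 hc') ⟨σ, hσ'⟩
    rw [h1, show D.supp _ _ = _ from h] at h2
    have h3 := (congrArg Finset.card h2).le.trans Finset.card_image_le
    rw [Finset.card_univ, Fintype.card_fin] at h3
    have h4 := h3.trans (Finset.card_le_univ _)
    rw [Fintype.card_fin] at h4
    exact absurd (Finset.card_lt_card (Finset.ssubset_iff_subset_ne.2 ⟨hc', hcp⟩)) (not_lt.2 h4)
  · rintro ⟨hσ, h⟩
    refine ⟨hσ, ?_⟩
    let s := D.supp _ ⟨p.1, hσ⟩
    let c : Finset X := s.image (p.2.orderEmbOfFin rfl)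
    have hc : c ⊆ p.2 := by
      intro x hx
      obtain ⟨i, -, rfl⟩ := Finset.mem_image.1 hx
      exact Finset.orderEmbOfFin_mem _ rfl i
    have hs : (s : Set (Fin p.2.card)) ⊆ Set.range (incl c p.2 hc) := by
      intro i hi
      have hx : p.2.orderEmbOfFin rfl i ∈ c := Finset.mem_image_of_mem _ hi
      rw [← image_orderEmbOfFin c] at hx
      obtain ⟨j, -, hj⟩ := Finset.mem_image.1 hx
      refine ⟨j, Fin.ext ?_⟩
      change p.2.posIn (c.orderEmbOfFin rfl j) = _
      rw [hj, posIn_orderEmbOfFin]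
    have hcp : c = p.2 := by
      obtain ⟨σ, hσ'⟩ := D.support_condition _ _ hs
      refine h c hc ⟨σ.1, σ.2, ?_⟩
      rw [eval_eq (p := (σ.1, c)) hc σ.2, Subtype.coe_eta, hσ']
    refine Finset.eq_univ_of_card s ?_
    rw [Fintype.card_fin]
    exact (Finset.card_image_of_injective s (p.2.orderEmbOfFin rfl).injective).symm.trans
      (congrArg Finset.card hcp)

/-- The constructor symbol and the set of arguments of an expression. -/
noncomputable def Expr.term {α : Ordinal.{u}} (s : D.Expr α) : Ordinal.{u} × Finset Ordinal.{u} :=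
  (s.symb, s.argSet.image Subtype.val)

theorem Expr.card_argSet {α : Ordinal.{u}} (s : D.Expr α) : s.argSet.card = s.arity := by
  rw [Expr.argSet, Finset.card_image_of_injective _ s.args.injective, Finset.card_univ,
    Fintype.card_fin]

theorem Expr.isTerm' {α : Ordinal.{u}} (s : D.Expr α) :
    D.IsTerm (s.symb.1, s.argSet) := by
  rw [IsTerm, s.card_argSet]
  exact ⟨s.symb.2, s.inTrace⟩

theorem Expr.isTerm {α : Ordinal.{u}} (s : D.Expr α) : D.IsTerm s.term :=
  (isTerm_image (Subtype.val_injective.injOn)).2 s.isTerm'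

theorem position_val {α : Ordinal.{u}} {n : ℕ} (a : Fin n ↪o Set.Iio α) (e : Finset (Set.Iio α))
    (h : ∀ i, a i ∈ e) (i : Fin n) : (position a e h i : ℕ) = e.posIn (a i) := by
  rw [← posIn_orderEmbOfFin e (position a e h i), position_apply]

theorem Expr.map_position {α : Ordinal.{u}} (s : D.Expr α) (e : Finset (Set.Iio α))
    (h : ∀ i, s.args i ∈ e) :
    (D.map (position s.args e h) s.symb).1 = D.eval e (s.symb.1, s.argSet) := by
  rw [eval, ← act_graph _ s.symb.2]
  simp only [s.card_argSet]
  congr 1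
  rw [inclGraph, graph, argSet, Finset.image_image]
  refine Finset.image_congr fun i _ => ?_
  simp only [Function.comp_apply, position_val]
  rw [Finset.posIn_image_univ s.args.strictMono]

theorem Expr.lt_iff_termLT {α : Ordinal.{u}} (s t : D.Expr α) :
    s.lt t ↔ D.TermLT s.term t.term := by
  refine Iff.trans ?_ (termLT_image (p := (s.symb.1, s.argSet)) (q := (t.symb.1, t.argSet))
    ((Subtype.strictMono_coe _).strictMonoOn _)).symm
  rw [TermLT, s.lt_iff t (s.argSet ∪ t.argSet) (fun i => Finset.mem_union_left _ (s.args_mem i))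
    (fun i => Finset.mem_union_right _ (t.args_mem i)), ← Subtype.coe_lt_coe, s.map_position,
    t.map_position]
  exact Iff.rfl

theorem Expr.term_injective {α : Ordinal.{u}} :
    Function.Injective (Expr.term (D := D) (α := α)) := by
  intro s t h
  refine (Expr.isStrictTotalOrder D α).trichotomous s t ?_ ?_ <;> rw [lt_iff_termLT, h] <;>
    exact lt_irrefl _

theorem Expr.mem_term_iff {α : Ordinal.{u}} (s : D.Expr α) (x : Ordinal.{u}) :
    x ∈ s.term.2 ↔ ∃ i, (s.args i : Ordinal.{u}) = x := by
  simp [term, argSet]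

theorem Expr.lt_of_mem_term {α : Ordinal.{u}} (s : D.Expr α) {x : Ordinal.{u}}
    (hx : x ∈ s.term.2) : x < α := by
  obtain ⟨i, rfl⟩ := (s.mem_term_iff x).1 hx
  exact (s.args i).2

theorem Expr.exists_term_eq {α : Ordinal.{u}} {p : Ordinal.{u} × Finset Ordinal.{u}}
    (hp : D.IsTerm p) (h : ∀ x ∈ p.2, x < α) : ∃ s : D.Expr α, s.term = p := by
  obtain ⟨hσ, hp⟩ := hp
  refine ⟨⟨p.2.card, ⟨p.1, hσ⟩, hp, OrderEmbedding.ofStrictMono (fun i =>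
    ⟨p.2.orderEmbOfFin rfl i, h _ (p.2.orderEmbOfFin_mem rfl i)⟩) fun i j hij =>
      Subtype.mk_lt_mk.2 ((p.2.orderEmbOfFin rfl).strictMono hij)⟩, Prod.ext rfl ?_⟩
  rw [Expr.term, Expr.argSet, Finset.image_image]
  exact image_orderEmbOfFin p.2

end PreDilator

namespace NormalDilator

variable (D : NormalDilator.{u})

open PreDilator

/-- The element `μ₁(0)` of `D(1)`. -/
def muZero : Ordinal.{u} := D.mu 1 0

theorem isTerm_singleton {X : Type*} [LinearOrder X] (x : X) : D.IsTerm (D.muZero, {x}) := by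
  rw [IsTerm, Finset.card_singleton]
  refine ⟨(D.mu 1 0).2, ?_⟩
  change D.supp 1 (D.mu 1 0) = Finset.univ
  by_contra h
  have h0 : (0 : Fin 1) ∉ D.supp 1 (D.mu 1 0) := fun h0 =>
    h (Finset.eq_univ_iff_forall.2 fun i => by rwa [Subsingleton.elim i 0])
  refine lt_irrefl (D.mu 1 0) ((D.normality 1 0 _).2 fun i hi => ?_)
  rw [Subsingleton.elim i 0] at hi
  exact (h0 hi).elim

/-- Normality: a term is below `(μ₁(0); x)` if and only if its arguments are below `x`. -/
theorem termLT_singleton {X : Type*} [LinearOrder X] {p : Ordinal.{u} × Finset X} (hp : D.IsTerm p)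
    (x : X) : D.TermLT p (D.muZero, {x}) ↔ ∀ y ∈ p.2, y < x := by
  have h1 : p.2 ⊆ p.2 ∪ {x} := Finset.subset_union_left
  have h2 : ({x} : Finset X) ⊆ p.2 ∪ {x} := Finset.subset_union_right
  have hx : x ∈ p.2 ∪ {x} := h2 (Finset.mem_singleton_self x)
  have hlt : D.muZero < D.obj (Finset.card {x}) := (D.isTerm_singleton x).1
  have e1 : D.map (incl {x} (p.2 ∪ {x}) h2) ⟨D.muZero, hlt⟩ =
      D.mu _ ⟨(p.2 ∪ {x}).posIn x, Finset.posIn_lt_card hx⟩ := by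
    have : (⟨D.muZero, hlt⟩ : Set.Iio (D.obj (Finset.card {x}))) =
      D.mu _ ⟨0, by simp⟩ := rfl
    rw [this, D.mu_map]
    congr 1
    apply Fin.ext
    change (p.2 ∪ {x}).posIn (Finset.orderEmbOfFin {x} rfl _) = _
    have h3 := Finset.orderEmbOfFin_mem {x} rfl (⟨0, by simp⟩ : Fin (Finset.card {x}))
    rw [Finset.mem_singleton] at h3
    rw [h3]
  rw [TermLT, eval_eq h1 hp.1, eval_eq h2 hlt, Subtype.coe_lt_coe]
  dsimp only
  rw [e1, D.normality, D.supp_map, show D.supp _ _ = _ from hp.2]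
  simp only [Finset.mem_image, Finset.mem_univ, true_and, forall_exists_index,
    forall_apply_eq_imp_iff]
  have h4 : ∀ i, incl p.2 (p.2 ∪ {x}) h1 i < ⟨(p.2 ∪ {x}).posIn x, Finset.posIn_lt_card hx⟩ ↔
      p.2.orderEmbOfFin rfl i < x := fun i =>
    Finset.posIn_lt_posIn (h1 (p.2.orderEmbOfFin_mem rfl i))
  simp only [h4]
  constructor
  · intro h y hy
    rw [← image_orderEmbOfFin p.2] at hy
    obtain ⟨i, -, rfl⟩ := Finset.mem_image.1 hy
    exact h i
  · exact fun h i => h _ (p.2.orderEmbOfFin_mem rfl i)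

/-- The expressions with arguments below `α` form an initial segment. -/
theorem lt_of_termLT {α β : Ordinal.{u}} {s t : D.Expr β} (hst : s.lt t)
    (ht : ∀ x ∈ t.term.2, x < α) : ∀ x ∈ s.term.2, x < α := by
  intro x hx
  by_contra hxα
  rw [not_lt] at hxα
  obtain ⟨r, hr⟩ := Expr.exists_term_eq (D := D.toPreDilator) (α := β) (D.isTerm_singleton x)
    (by simpa using s.lt_of_mem_term hx)
  have h1 : t.lt r := by
    rw [Expr.lt_iff_termLT, hr, D.termLT_singleton t.isTerm]
    exact fun y hy => (ht y hy).trans_le hxα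
  have h2 : s.lt r := (Expr.isStrictTotalOrder D.toPreDilator β).trans _ _ _ hst h1
  rw [Expr.lt_iff_termLT, hr, D.termLT_singleton s.isTerm] at h2
  exact lt_irrefl _ (h2 x hx)

theorem eta_lt_iff {α : Ordinal.{u}} (x y : Set.Iio (D.value α)) :
    (D.eta α x).lt (D.eta α y) ↔ x < y := (D.eta α).map_rel_iff

/-- The ordinals that are represented by expressions do not depend on the bound for the
arguments. -/
theorem term_eta_eq {α β : Ordinal.{u}} (h : α ≤ β) {γ : Ordinal.{u}} (hα : γ < D.value α) :
    ∃ hβ : γ < D.value β, (D.eta β ⟨γ, hβ⟩).term = (D.eta α ⟨γ, hα⟩).term := by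
  have key : ∀ s : D.Expr α, ∃ t : D.Expr β, t.term = s.term := fun s =>
    Expr.exists_term_eq s.isTerm fun x hx => (s.lt_of_mem_term hx).trans_le h
  choose l hl using key
  let F : Set.Iio (D.value α) → Set.Iio (D.value β) := fun x => (D.eta β).symm (l (D.eta α x))
  have hF : ∀ x, (D.eta β (F x)).term = (D.eta α x).term := fun x => by
    simp only [F, RelIso.apply_symm_apply, hl]
  have hlt : ∀ x y, F x < F y ↔ x < y := fun x y => by
    rw [← eta_lt_iff, ← eta_lt_iff, Expr.lt_iff_termLT, Expr.lt_iff_termLT, hF, hF]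
  let f : InitialSeg (fun x y : Set.Iio (D.value α) => x < y)
      (fun x y : Ordinal.{u} => x < y) :=
    { toFun := fun x => (F x).1
      inj' := fun x y hxy => by
        rcases lt_trichotomy x y with h | h | h
        · exact absurd hxy (((hlt x y).2 h).ne ∘ Subtype.ext)
        · exact h
        · exact absurd hxy (((hlt y x).2 h).ne' ∘ Subtype.ext)
      map_rel_iff' := fun {x y} => hlt x y
      mem_range_of_rel' := fun x b hb => by
        have hb' : b < D.value β := lt_trans hb (F x).2
        have h1 : (D.eta β ⟨b, hb'⟩).lt (D.eta β (F x)) := (D.eta_lt_iff _ _).2 hb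
        have h2 := D.lt_of_termLT (α := α) h1 (fun z hz => by
          rw [hF] at hz
          exact (D.eta α x).lt_of_mem_term hz)
        obtain ⟨s, hs⟩ := Expr.exists_term_eq (D.eta β ⟨b, hb'⟩).isTerm h2
        refine ⟨(D.eta α).symm s, ?_⟩
        have h3 : D.eta β (F ((D.eta α).symm s)) = D.eta β ⟨b, hb'⟩ := by
          apply Expr.term_injective
          rw [hF, RelIso.apply_symm_apply, hs]
        exact congrArg Subtype.val ((D.eta β).injective h3) }
  let g : InitialSeg (fun x y : Set.Iio (D.value α) => x < y)
      (fun x y : Ordinal.{u} => x < y) :=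
    { toFun := Subtype.val
      inj' := Subtype.val_injective
      map_rel_iff' := Iff.rfl
      mem_range_of_rel' := fun x b hb => ⟨⟨b, lt_trans hb x.2⟩, rfl⟩ }
  -- An embedding of an ordinal as an initial segment of the ordinals is unique.
  have hfg : (F ⟨γ, hα⟩).1 = γ := InitialSeg.eq f g ⟨γ, hα⟩
  have hβ : γ < D.value β := hfg ▸ (F ⟨γ, hα⟩).2
  refine ⟨hβ, ?_⟩
  rw [← hF, show F ⟨γ, hα⟩ = ⟨γ, hβ⟩ from Subtype.ext hfg]

theorem le_value (α : Ordinal.{u}) : α ≤ D.value α := by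
  have key : ∀ x : Set.Iio α, ∃ t : D.Expr α, t.term = (D.muZero, {x.1}) := fun x =>
    Expr.exists_term_eq (D.isTerm_singleton _) fun y hy => by
      rw [Finset.mem_singleton.1 hy]
      exact x.2
  choose l hl using key
  by_contra h
  rw [not_le] at h
  let F : Set.Iio α → Set.Iio α := fun x =>
    ⟨(D.eta α).symm (l x), lt_trans ((D.eta α).symm (l x)).2 h⟩
  have hF : StrictMono F := fun x y hxy => by
    change (D.eta α).symm (l x) < (D.eta α).symm (l y)
    rw [← eta_lt_iff, RelIso.apply_symm_apply, RelIso.apply_symm_apply, Expr.lt_iff_termLT, hl, hl,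
      D.termLT_singleton (D.isTerm_singleton _)]
    simpa using hxy
  have h1 := hF.le_apply (x := ⟨D.value α, h⟩)
  exact absurd (Subtype.prop ((D.eta α).symm (l ⟨D.value α, h⟩))) (not_lt.2 h1)

theorem lt_value_succ (γ : Ordinal.{u}) : γ < D.value (γ + 1) :=
  lt_of_lt_of_le (lt_add_one γ) (D.le_value _)

/-- The constructor symbol and the set of arguments of the expression that represents `γ`. -/
noncomputable def term (γ : Ordinal.{u}) : Ordinal.{u} × Finset Ordinal.{u} :=
  (D.eta (γ + 1) ⟨γ, D.lt_value_succ γ⟩).term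

theorem term_eta {α γ : Ordinal.{u}} (h : γ < D.value α) : (D.eta α ⟨γ, h⟩).term = D.term γ := by
  rcases le_total α (γ + 1) with h1 | h1
  · obtain ⟨_, h2⟩ := D.term_eta_eq h1 h
    exact h2.symm
  · obtain ⟨_, h2⟩ := D.term_eta_eq h1 (D.lt_value_succ γ)
    exact h2

theorem isTerm_term (γ : Ordinal.{u}) : D.IsTerm (D.term γ) := Expr.isTerm _

theorem exists_term_eq {p : Ordinal.{u} × Finset Ordinal.{u}} (hp : D.IsTerm p) {α : Ordinal.{u}}
    (h : ∀ x ∈ p.2, x < α) : ∃ γ < D.value α, D.term γ = p := by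
  obtain ⟨s, rfl⟩ := Expr.exists_term_eq hp h
  refine ⟨((D.eta α).symm s).1, ((D.eta α).symm s).2, ?_⟩
  rw [← D.term_eta ((D.eta α).symm s).2, Subtype.coe_eta, RelIso.apply_symm_apply]

theorem termLT_term {γ δ : Ordinal.{u}} : D.TermLT (D.term γ) (D.term δ) ↔ γ < δ := by
  have hγ : γ < D.value (max γ δ + 1) :=
    ((le_max_left _ _).trans_lt (lt_add_one _)).trans_le (D.le_value _)
  have hδ : δ < D.value (max γ δ + 1) :=
    ((le_max_right _ _).trans_lt (lt_add_one _)).trans_le (D.le_value _)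
  rw [← D.term_eta hγ, ← D.term_eta hδ, ← Expr.lt_iff_termLT, eta_lt_iff]
  exact Iff.rfl

theorem term_injective : Function.Injective D.term := fun γ δ h => by
  have h1 := D.termLT_term (γ := γ) (δ := δ)
  have h2 := D.termLT_term (γ := δ) (δ := γ)
  rw [h] at h1 h2
  have h3 : ¬ D.TermLT (D.term δ) (D.term δ) := lt_irrefl _
  exact le_antisymm (not_lt.1 fun h => h3 (h2.2 h)) (not_lt.1 fun h => h3 (h1.2 h))

theorem lt_value_iff {γ α : Ordinal.{u}} : γ < D.value α ↔ ∀ x ∈ (D.term γ).2, x < α := by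
  constructor
  · intro h x hx
    rw [← D.term_eta h] at hx
    exact Expr.lt_of_mem_term _ hx
  · intro h
    obtain ⟨δ, h1, h2⟩ := D.exists_term_eq (D.isTerm_term γ) h
    rwa [← D.term_injective h2]

theorem term_value (α : Ordinal.{u}) : D.term (D.value α) = (D.muZero, {α}) := by
  obtain ⟨δ, -, hδ⟩ := D.exists_term_eq (D.isTerm_singleton α) (α := α + 1) (by simp)
  have : δ = D.value α := by
    refine eq_of_forall_lt_iff fun γ => ?_
    rw [← D.termLT_term, hδ, D.termLT_singleton (D.isTerm_term γ), D.lt_value_iff]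
  rw [← this, hδ]

theorem represents_iff {n : ℕ} (σ : Set.Iio (D.obj n)) (g : Fin n → Ordinal.{u}) (γ : Ordinal.{u}) :
    D.Represents σ g γ ↔ D.InTrace n σ ∧ StrictMono g ∧ D.term γ = (σ.1, Finset.univ.image g) := by
  have aux : ∀ {α : Ordinal.{u}} (a : Fin n ↪o Set.Iio α) (hσ : D.InTrace n σ),
      (∀ i, (a i : Ordinal.{u}) = g i) →
      (⟨n, σ, hσ, a⟩ : D.Expr α).term = (σ.1, Finset.univ.image g) := by
    intro α a hσ ha
    refine Prod.ext rfl ?_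
    rw [Expr.term, Expr.argSet, Finset.image_image]
    exact Finset.image_congr fun i _ => ha i
  constructor
  · rintro ⟨α, hγ, hσ, a, ha, h⟩
    refine ⟨hσ, fun i j hij => ?_, ?_⟩
    · rw [← ha, ← ha]
      exact a.strictMono hij
    · rw [← D.term_eta hγ, h, aux a hσ ha]
  · rintro ⟨hσ, hg, h⟩
    have h1 : ∀ i, g i < γ + 1 := fun i => by
      have := D.lt_value_iff.1 (D.lt_value_succ γ)
      rw [h] at this
      exact this _ (Finset.mem_image_of_mem _ (Finset.mem_univ i))
    refine ⟨γ + 1, D.lt_value_succ γ, hσ, OrderEmbedding.ofStrictMono (fun i => ⟨g i, h1 i⟩) hg,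
      fun i => rfl, ?_⟩
    apply Expr.term_injective
    rw [D.term_eta, h, aux]
    exact fun i => rfl

end NormalDilator

/-! ### Basic properties of the relation `≤₁` -/

namespace NormalDilator

variable (D : NormalDilator.{u})

open PreDilator

theorem IsIsomorphism.trans {D : NormalDilator.{u}} {R : Ordinal.{u} → Ordinal.{u} → Prop}
    {X Y Z : Set Ordinal.{u}} {f g : Ordinal.{u} → Ordinal.{u}} (hf : D.IsIsomorphism R X Y f)
    (hg : D.IsIsomorphism R Y Z g) : D.IsIsomorphism R X Z (g ∘ f) where
  bijOn := hg.bijOn.comp hf.bijOn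
  le_iff γ hγ δ hδ := (hf.le_iff γ hγ δ hδ).trans
    (hg.le_iff _ (hf.bijOn.mapsTo hγ) _ (hf.bijOn.mapsTo hδ))
  rel_iff γ hγ δ hδ := (hf.rel_iff γ hγ δ hδ).trans
    (hg.rel_iff _ (hf.bijOn.mapsTo hγ) _ (hf.bijOn.mapsTo hδ))
  represents_iff n σ hσ γ hγ g hg' := (hf.represents_iff n σ hσ γ hγ g hg').trans
    (hg.represents_iff n σ hσ _ (hf.bijOn.mapsTo hγ) _ fun i => hf.bijOn.mapsTo (hg' i))

theorem IsIsomorphism.refl {D : NormalDilator.{u}} {R : Ordinal.{u} → Ordinal.{u} → Prop}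
    {X : Set Ordinal.{u}} : D.IsIsomorphism R X X id where
  bijOn := Set.bijOn_id X
  le_iff _ _ _ _ := Iff.rfl
  rel_iff _ _ _ _ := Iff.rfl
  represents_iff _ _ _ _ _ _ _ := Iff.rfl

variable {D}

theorem LeOne.le {α β : Ordinal.{u}} (h : D.LeOne α β) : α ≤ β := ((D.leOne_iff α β).1 h).1

theorem leOne_refl (α : Ordinal.{u}) : D.LeOne α α := by
  rw [leOne_iff]
  refine ⟨le_rfl, fun X Y _ hY _ hYα => ⟨Y, hY, ?_, id, .refl, fun _ _ => rfl⟩⟩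
  exact fun y hy => (hYα hy).1

theorem LeOne.of_le {α β γ : Ordinal.{u}} (h : D.LeOne α β) (h1 : α ≤ γ) (h2 : γ ≤ β) :
    D.LeOne α γ := by
  rw [leOne_iff] at h ⊢
  exact ⟨h1, fun X Y hX hY hXα hYγ => h.2 X Y hX hY hXα fun y hy =>
    ⟨lt_of_lt_of_le (hYγ hy).1 h2, (hYγ hy).2⟩⟩

theorem LeOne.trans {α β γ : Ordinal.{u}} (h : D.LeOne α β) (h' : D.LeOne β γ) : D.LeOne α γ := by
  have hαβ := h.le
  have hβγ := h'.le
  rw [leOne_iff] at h h' ⊢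
  refine ⟨hαβ.trans hβγ, fun X Y hX hY hXα hYγ => ?_⟩
  obtain ⟨Z, hZ, hZβ, f, hf, hf'⟩ := h'.2 (X ∪ Y ∩ Set.Iio β) (Y \ Set.Iio β)
    (hX.union (hY.inter_of_left _)) hY.sdiff
    (Set.union_subset (hXα.trans (Set.Iio_subset_Iio hαβ)) Set.inter_subset_right)
    (fun y hy => ⟨(hYγ hy.1).1, hy.2⟩)
  -- The copy `Z` of the part of `Y` above `β` lies below `β`, so that it can be moved below `α`.
  obtain ⟨Z', hZ', hZα, g, hg, hg'⟩ := h.2 (X ∪ Z ∩ Set.Iio α) (Y ∩ Set.Iio β ∪ Z \ Set.Iio α)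
    (hX.union (hZ.inter_of_left _)) ((hY.inter_of_left _).union hZ.sdiff)
    (Set.union_subset hXα Set.inter_subset_right)
    (Set.union_subset (fun y hy => ⟨hy.2, (hYγ hy.1).2⟩) fun y hy => ⟨hZβ hy.1, hy.2⟩)
  have e1 : X ∪ Y ∩ Set.Iio β ∪ Y \ Set.Iio β = X ∪ Y := by
    rw [Set.union_assoc, Set.inter_union_sdiff]
  have e2 : X ∪ Z ∩ Set.Iio α ∪ (Y ∩ Set.Iio β ∪ Z \ Set.Iio α) = X ∪ Y ∩ Set.Iio β ∪ Z := by
    nth_rewrite 3 [← Set.inter_union_sdiff Z (Set.Iio α)]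
    ext x
    simp only [Set.mem_union]
    tauto
  rw [e1] at hf
  rw [e2] at hg
  refine ⟨Z ∩ Set.Iio α ∪ Z', (hZ.inter_of_left _).union hZ',
    Set.union_subset Set.inter_subset_right hZα, g ∘ f, ?_, fun γ hγ => ?_⟩
  · rw [← Set.union_assoc]
    exact hf.trans hg
  · rw [Function.comp_apply, hf' γ (.inl hγ), hg' γ (.inl hγ)]

/-- A failure of `α ≤₁ β` is due to a finite subset of `β`. -/
theorem exists_finite_of_not_leOne {α β : Ordinal.{u}} (hαβ : α ≤ β) (h : ¬ D.LeOne α β) :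
    ∃ Y : Set Ordinal.{u}, Y.Finite ∧ Y ⊆ Set.Iio β ∧ ∀ γ, Y ⊆ Set.Iio γ → ¬ D.LeOne α γ := by
  by_contra! h'
  refine h ((D.leOne_iff α β).2 ⟨hαβ, fun X Y hX hY hXα hYβ => ?_⟩)
  obtain ⟨γ, hγ, hαγ⟩ := h' Y hY fun y hy => (hYβ hy).1
  exact ((D.leOne_iff α γ).1 hαγ).2 X Y hX hY hXα fun y hy => ⟨hγ hy, (hYβ hy).2⟩

theorem exists_represents (γ : Ordinal.{u}) : ∃ (n : ℕ) (σ : Set.Iio (D.obj n))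
    (g : Fin n → Ordinal.{u}), D.Represents σ g γ ∧ ∀ i, g i ∈ (D.term γ).2 := by
  obtain ⟨h1, h2⟩ := D.isTerm_term γ
  refine ⟨_, ⟨_, h1⟩, (D.term γ).2.orderEmbOfFin rfl, ?_, (D.term γ).2.orderEmbOfFin_mem rfl⟩
  rw [represents_iff]
  refine ⟨h2, ((D.term γ).2.orderEmbOfFin rfl).strictMono, ?_⟩
  rw [image_orderEmbOfFin]

/-- If `α ≤₁ β` holds for some `β > α`, then `α` is a fixed point of `D`: otherwise `α` has
arguments below `α`, and the copy of `α` below `α` would be represented by the same term. -/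
theorem LeOne.value_eq {α β : Ordinal.{u}} (h : D.LeOne α β) (hαβ : α < β) : D.value α = α := by
  by_contra hne
  have hlt : α < D.value α := lt_of_le_of_ne (D.le_value α) (Ne.symm hne)
  rw [lt_value_iff] at hlt
  obtain ⟨Y', -, hY', f, hf, hf'⟩ := ((D.leOne_iff α β).1 h).2 ((D.term α).2 : Set Ordinal.{u}) {α}
    (Finset.finite_toSet _) (Set.finite_singleton α) hlt (by simpa using hαβ)
  obtain ⟨n, σ, g, hg, hg'⟩ := D.exists_represents α
  have h1 := (hf.represents_iff n σ ((D.represents_iff σ g α).1 hg).1 α (.inr rfl) g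
    fun i => .inl (hg' i)).1 hg
  simp only [hf' _ (hg' _)] at h1
  rw [represents_iff] at hg h1
  have h2 : f α = α := D.term_injective (h1.2.2.trans hg.2.2.symm)
  have h3 : f α < α := by
    rcases hf.bijOn.mapsTo (Set.mem_union_right _ (Set.mem_singleton α)) with h | h
    · exact hlt _ h
    · exact hY' h
  exact h3.ne h2

/-! ### Substitution -/

variable (D) in
open Classical in
/-- The ordinal that is represented by a pair `(σ, c)`, or zero if there is none. -/
noncomputable def val (p : Ordinal.{u} × Finset Ordinal.{u}) : Ordinal.{u} :=
  if h : ∃ γ, D.term γ = p then Classical.choose h else 0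

theorem val_term (γ : Ordinal.{u}) : D.val (D.term γ) = γ := by
  have h : ∃ δ, D.term δ = D.term γ := ⟨γ, rfl⟩
  rw [val, dif_pos h]
  exact D.term_injective (Classical.choose_spec h)

theorem term_val {p : Ordinal.{u} × Finset Ordinal.{u}} (hp : D.IsTerm p) :
    D.term (D.val p) = p := by
  obtain ⟨γ, -, rfl⟩ := D.exists_term_eq hp (α := p.2.sup id + 1) fun x hx =>
    Order.lt_add_one_iff.2 (Finset.le_sup (f := id) hx)
  rw [val_term]

/-- The function that moves `a` to `b` and fixes all other ordinals. -/
noncomputable def move (a b x : Ordinal.{u}) : Ordinal.{u} := if x = a then b else x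

variable (D) in
/-- The ordinal `γ[a ↦ b]` that results if the argument `a` is replaced by `b` in the expression
that represents `γ`. -/
noncomputable def subst (a b γ : Ordinal.{u}) : Ordinal.{u} :=
  D.val ((D.term γ).1, (D.term γ).2.image (move a b))

variable (D) in
/-- Each argument of `γ` is equal to `a` or below both `a` and `b`. This ensures that replacing
`a` by `b` does not affect the order of the arguments. -/
def Args (a b γ : Ordinal.{u}) : Prop := ∀ x ∈ (D.term γ).2, x = a ∨ x < a ∧ x < b

theorem move_self (a b : Ordinal.{u}) : move a b a = b := if_pos rfl

theorem move_of_ne {a b x : Ordinal.{u}} (h : x ≠ a) : move a b x = x := if_neg h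

theorem move_strictMonoOn (a b : Ordinal.{u}) :
    StrictMonoOn (move a b) {x | x = a ∨ x < a ∧ x < b} := by
  rintro x (rfl | ⟨h1, h2⟩) y (rfl | ⟨h3, h4⟩) hxy
  · exact absurd hxy (lt_irrefl _)
  · exact absurd hxy (not_lt.2 h3.le)
  · rwa [move_self, move_of_ne h1.ne]
  · rwa [move_of_ne h1.ne, move_of_ne h3.ne]

theorem term_subst {a b γ : Ordinal.{u}} (h : D.Args a b γ) :
    D.term (D.subst a b γ) = ((D.term γ).1, (D.term γ).2.image (move a b)) :=
  term_val ((isTerm_image ((move_strictMonoOn a b).injOn.mono h)).2 (D.isTerm_term γ))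

theorem subst_lt_subst {a b γ δ : Ordinal.{u}} (hγ : D.Args a b γ) (hδ : D.Args a b δ) :
    D.subst a b γ < D.subst a b δ ↔ γ < δ := by
  rw [← termLT_term, term_subst hγ, term_subst hδ, termLT_image, termLT_term]
  refine (move_strictMonoOn a b).mono ?_
  rw [Finset.coe_union]
  exact Set.union_subset hγ hδ

theorem subst_inj {a b γ δ : Ordinal.{u}} (hγ : D.Args a b γ) (hδ : D.Args a b δ) :
    D.subst a b γ = D.subst a b δ ↔ γ = δ := by
  have h1 := subst_lt_subst hγ hδ
  have h2 := subst_lt_subst hδ hγ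
  constructor
  · intro h
    rw [h] at h1 h2
    exact le_antisymm (not_lt.1 fun h => lt_irrefl _ (h2.2 h))
      (not_lt.1 fun h => lt_irrefl _ (h1.2 h))
  · rintro rfl
    rfl

theorem subst_of_lt {a b γ : Ordinal.{u}} (h : γ < D.value a) : D.subst a b γ = γ := by
  rw [lt_value_iff] at h
  have : (D.term γ).2.image (move a b) = (D.term γ).2 := by
    refine (Finset.image_congr fun x hx => move_of_ne (h x hx).ne).trans Finset.image_id
  rw [subst, this, Prod.mk.eta, val_term]

theorem subst_subst {a b c γ : Ordinal.{u}} (h : D.Args a b γ) :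
    D.subst b c (D.subst a b γ) = D.subst a c γ := by
  rw [subst, term_subst h, subst]
  dsimp only
  rw [Finset.image_image]
  congr 2
  refine Finset.image_congr fun x hx => ?_
  rcases h x hx with rfl | ⟨h1, h2⟩
  · simp [move_self]
  · rw [Function.comp_apply, move_of_ne h1.ne, move_of_ne h1.ne, move_of_ne h2.ne]

theorem Args.subst {a b c γ : Ordinal.{u}} (h : D.Args a b γ)
    (h' : ∀ x ∈ (D.term γ).2, x < a → x < c) : D.Args b c (D.subst a b γ) := by
  rw [Args, term_subst h]
  intro x hx
  obtain ⟨y, hy, rfl⟩ := Finset.mem_image.1 hx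
  rcases h y hy with rfl | ⟨h1, h2⟩
  · rw [move_self]
    exact .inl rfl
  · rw [move_of_ne h1.ne]
    exact .inr ⟨h2, h' y hy h1⟩

theorem subst_lt_value {a b γ : Ordinal.{u}} (h : D.Args a b γ) :
    D.subst a b γ < D.value (b + 1) := by
  rw [lt_value_iff, term_subst h]
  intro x hx
  obtain ⟨y, hy, rfl⟩ := Finset.mem_image.1 hx
  rcases h y hy with rfl | ⟨h1, h2⟩
  · rw [move_self]
    exact lt_add_one b
  · rw [move_of_ne h1.ne]
    exact h2.trans (lt_add_one b)

theorem args_value (a b : Ordinal.{u}) : D.Args a b (D.value a) := by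
  rw [Args, term_value]
  exact fun x hx => .inl (Finset.mem_singleton.1 hx)

theorem subst_value (a b : Ordinal.{u}) : D.subst a b (D.value a) = D.value b := by
  apply D.term_injective
  rw [term_subst (args_value a b), term_value, term_value]
  simp [move_self]

theorem args_of_lt {a b γ : Ordinal.{u}} (h : γ < D.value b) (hab : b ≤ a) : D.Args a b γ :=
  fun x hx => .inr ⟨(D.lt_value_iff.1 h x hx).trans_le hab, D.lt_value_iff.1 h x hx⟩

theorem args_of_lt_value_succ {a b γ : Ordinal.{u}} (h : γ < D.value (a + 1))
    (h' : ∀ x ∈ (D.term γ).2, x < a → x < b) : D.Args a b γ := by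
  intro x hx
  rcases (Order.lt_add_one_iff.1 (D.lt_value_iff.1 h x hx)).eq_or_lt with h1 | h1
  · exact .inl h1
  · exact .inr ⟨h1, h' x hx h1⟩

theorem Args.lt_value_succ {a b γ : Ordinal.{u}} (h : D.Args a b γ) : γ < D.value (a + 1) := by
  rw [lt_value_iff]
  intro x hx
  rcases h x hx with rfl | ⟨h1, -⟩
  · exact lt_add_one x
  · exact h1.trans (lt_add_one a)

theorem value_strictMono : StrictMono D.value := by
  intro a b h
  rw [lt_value_iff, term_value]
  simpa using h

theorem exists_le_of_lt {γ δ : Ordinal.{u}} (h : γ < δ) {x : Ordinal.{u}}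
    (hx : x ∈ (D.term γ).2) : ∃ y ∈ (D.term δ).2, x ≤ y := by
  by_contra! h'
  exact lt_irrefl _ (D.lt_value_iff.1 (h.trans (D.lt_value_iff.2 h')) x hx)

theorem val_lt_val {p q : Ordinal.{u} × Finset Ordinal.{u}} (hp : D.IsTerm p)
    (hq : D.IsTerm q) : D.val p < D.val q ↔ D.TermLT p q := by
  rw [← D.termLT_term, term_val hp, term_val hq]

theorem val_of_not {p : Ordinal.{u} × Finset Ordinal.{u}}
    (hp : ¬ D.IsTerm p) : D.val p = 0 :=
  dif_neg fun ⟨γ, h⟩ => hp (h ▸ D.isTerm_term γ)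

theorem subst_self (a γ : Ordinal.{u}) : D.subst a a γ = γ := by
  have : (D.term γ).2.image (move a a) = (D.term γ).2 := by
    refine (Finset.image_congr fun x _ => ?_).trans Finset.image_id
    rw [move]
    split_ifs with h
    exacts [h.symm, rfl]
  rw [subst, this, Prod.mk.eta, val_term]

theorem subst_le_subst {a b γ δ : Ordinal.{u}} (hγ : D.Args a b γ) (hδ : D.Args a b δ) :
    D.subst a b γ ≤ D.subst a b δ ↔ γ ≤ δ := by
  rw [← not_lt, subst_lt_subst hδ hγ, not_lt]

/-- An ordinal above `a` is not a fixed point of `D` if its arguments are at most `a`. By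
`LeOne.value_eq`, such an ordinal is related to itself only. -/
theorem eq_of_leOne {a b γ δ : Ordinal.{u}} (h : D.Args a b γ) (ha : a < γ) (hγδ : D.LeOne γ δ) :
    γ = δ := by
  by_contra hne
  have h1 := hγδ.value_eq (lt_of_le_of_ne hγδ.le hne)
  have h2 := h.lt_value_succ
  have h3 : D.value (a + 1) ≤ D.value γ := value_strictMono.monotone (Order.add_one_le_iff.2 ha)
  rw [h1] at h3
  exact absurd h2 (not_lt.2 h3)

end NormalDilator

/-! ### The reflection argument -/

namespace NormalDilator

open PreDilator

variable {D : NormalDilator.{u}}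

theorem exists_lt_forall_le {κ : Ordinal.{u}} (hκ : 0 < κ) {B : Set Ordinal.{u}} (hB : B.Finite)
    (h : B ⊆ Set.Iio κ) : ∃ ρ < κ, ∀ b ∈ B, b ≤ ρ := by
  rcases B.eq_empty_or_nonempty with rfl | hne
  · exact ⟨0, hκ, by simp⟩
  · obtain ⟨b, hb, hb'⟩ := Set.exists_max_image B id hB hne
    exact ⟨b, h hb, hb'⟩

theorem exists_lt_forall_arg_le {κ : Ordinal.{u}} (hκ : 0 < κ) (γ : Ordinal.{u}) :
    ∃ ρ < κ, ∀ x ∈ (D.term γ).2, x < κ → x ≤ ρ := by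
  obtain ⟨ρ, hρ, h⟩ := exists_lt_forall_le hκ (B := ((D.term γ).2 : Set Ordinal.{u}) ∩ Set.Iio κ)
    ((Finset.finite_toSet _).inter_of_left _) Set.inter_subset_right
  exact ⟨ρ, hρ, fun x hx hxκ => h x ⟨hx, hxκ⟩⟩

/-- The map `γ ↦ γ[κ ↦ δ]` respects the relation symbols for the expressions. -/
theorem represents_subst {κ δ : Ordinal.{u}} (hδκ : δ < κ) (hκ : D.value κ = κ)
    (hδ : D.value δ = δ) {n : ℕ} (σ : Set.Iio (D.obj n)) {γ : Ordinal.{u}} (hγ : D.Args κ δ γ)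
    {g : Fin n → Ordinal.{u}} (hg : ∀ i, D.Args κ δ (g i)) :
    D.Represents σ g γ ↔ D.Represents σ (fun i => D.subst κ δ (g i)) (D.subst κ δ γ) := by
  have hκa : D.Args κ δ κ := by
    simpa only [hκ] using args_value (D := D) κ δ
  have hκs : D.subst κ δ κ = δ := by
    simpa only [hκ, hδ] using subst_value (D := D) κ δ
  have hmono : ∀ x y, D.Args κ δ x → D.Args κ δ y → (D.subst κ δ x < D.subst κ δ y ↔ x < y) :=
    fun x y => subst_lt_subst
  -- On ordinals up to `κ`, the substitution merely replaces `κ` by `δ`.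
  have hmove : ∀ x, D.Args κ δ x → x ≤ κ → D.subst κ δ x = move κ δ x ∧
      (x = κ ∨ x < κ ∧ x < δ) := by
    intro x hx hxκ
    rcases hxκ.eq_or_lt with rfl | h
    · exact ⟨by rw [hκs, move_self], .inl rfl⟩
    · have h1 : D.subst κ δ x = x := subst_of_lt (by rwa [hκ])
      refine ⟨by rw [h1, move_of_ne h.ne], .inr ⟨h, ?_⟩⟩
      have h2 := (hmono x κ hx hκa).2 h
      rwa [hκs, h1] at h2
  have hstrict : StrictMono (fun i => D.subst κ δ (g i)) ↔ StrictMono g :=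
    ⟨fun h i j hij => (hmono _ _ (hg i) (hg j)).1 (h hij),
      fun h i j hij => (hmono _ _ (hg i) (hg j)).2 (h hij)⟩
  rw [represents_iff, represents_iff, hstrict, term_subst hγ]
  refine and_congr_right fun _ => and_congr_right fun _ => ?_
  rw [Prod.ext_iff, Prod.ext_iff]
  refine and_congr_right fun _ => ?_
  dsimp only
  have key : (∀ i, g i ≤ κ) → (Finset.univ.image fun i => D.subst κ δ (g i)) =
      (Finset.univ.image g).image (move κ δ) := fun h => by
    rw [Finset.image_image]
    exact Finset.image_congr fun i _ => (hmove _ (hg i) (h i)).1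
  constructor
  · intro h
    have h1 : ∀ i, g i ≤ κ := fun i => by
      have : g i ∈ (D.term γ).2 := by
        rw [h]
        exact Finset.mem_image_of_mem _ (Finset.mem_univ i)
      rcases hγ _ this with h2 | h2
      exacts [h2.le, h2.1.le]
    rw [key h1, h]
  · intro h
    have h1 : ∀ i, g i ≤ κ := fun i => by
      have h2 : D.subst κ δ (g i) ∈ (D.term γ).2.image (move κ δ) := by
        rw [h]
        exact Finset.mem_image_of_mem _ (Finset.mem_univ i)
      obtain ⟨y, hy, h3⟩ := Finset.mem_image.1 h2
      have h4 : move κ δ y ≤ δ := by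
        rcases hγ y hy with rfl | ⟨h5, h6⟩
        · rw [move_self]
        · rw [move_of_ne h5.ne]
          exact h6.le
      by_contra h5
      rw [not_le, ← hmono _ _ hκa (hg i), hκs, ← h3] at h5
      exact absurd h5 (not_lt.2 h4)
    rw [key h1] at h
    refine Finset.coe_injective ?_
    have h2 := congrArg (fun s : Finset Ordinal.{u} => (s : Set Ordinal.{u})) h
    simp only [Finset.coe_image] at h2
    refine ((move_strictMonoOn κ δ).injOn.image_eq_image_iff hγ ?_).1 ?_
    · intro x hx
      rw [Finset.mem_coe, Finset.mem_image] at hx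
      obtain ⟨i, -, rfl⟩ := hx
      exact (hmove _ (hg i) (h1 i)).2
    · rw [h2, Finset.coe_image]

/-- If the relations `κ ≤₁ s` with `s < θ` are reflected by arbitrarily large `δ < κ`, then
`κ ≤₁ θ`. The required isomorphism replaces `κ` by such a `δ`, for the largest
element `s` of `Y`. -/
theorem leOne_of_reflection {κ : Ordinal.{u}} (hκ0 : 0 < κ) (hκ : D.value κ = κ)
    (θ : Ordinal.{u}) (hκθ : κ ≤ θ) (hθ : θ ≤ D.value (κ + 1))
    (H : ∀ s, κ ≤ s → s < θ → ∀ ρ < κ, ∃ δ, ρ < δ ∧ δ < κ ∧ D.value δ = δ ∧ D.Args κ δ s ∧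
      D.LeOne δ (D.subst κ δ s)) :
    D.LeOne κ θ := by
  induction θ using WellFoundedLT.induction with
  | _ θ ih =>
  rw [leOne_iff]
  refine ⟨hκθ, fun X Y hX hY hXκ hYθ => ?_⟩
  rcases Y.eq_empty_or_nonempty with rfl | hne
  · exact ⟨∅, Set.finite_empty, Set.empty_subset _, id, .refl, fun _ _ => rfl⟩
  obtain ⟨s, hs, hsmax⟩ := Set.exists_max_image Y id hY hne
  simp only [id] at hsmax
  have hκY : ∀ y ∈ Y, κ ≤ y := fun y hy => not_lt.1 (hYθ hy).2
  have hκs : D.LeOne κ s := ih s (hYθ hs).1 (hκY s hs) ((hYθ hs).1.le.trans hθ)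
    fun t h1 h2 => H t h1 (h2.trans (hYθ hs).1)
  -- If `α ≤₁ κ` fails for some `α ∈ X`, a finite set `F α` is responsible.
  have hF : ∀ α : Ordinal.{u}, ∃ F : Set Ordinal.{u}, F.Finite ∧ F ⊆ Set.Iio κ ∧
      (α < κ → ∀ γ, F ⊆ Set.Iio γ → D.LeOne α γ → D.LeOne α κ) := by
    intro α
    by_cases h : α < κ ∧ ¬ D.LeOne α κ
    · obtain ⟨F, h1, h2, h3⟩ := exists_finite_of_not_leOne h.1.le h.2
      exact ⟨F, h1, h2, fun _ γ h4 h5 => (h3 γ h4 h5).elim⟩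
    · push Not at h
      exact ⟨∅, Set.finite_empty, Set.empty_subset _, fun h1 γ _ _ => h h1⟩
  choose F hFfin hFκ hF using hF
  obtain ⟨ρ, hρκ, hρ⟩ := exists_lt_forall_le hκ0
    (B := X ∪ (⋃ α ∈ X, F α) ∪ ⋃ y ∈ Y, ((D.term y).2 : Set Ordinal.{u}) ∩ Set.Iio κ)
    ((hX.union (hX.biUnion fun α _ => hFfin α)).union
      (hY.biUnion fun y _ => (Finset.finite_toSet _).inter_of_left _))
    (by
      refine Set.union_subset (Set.union_subset hXκ ?_) ?_
      · exact Set.iUnion₂_subset fun α _ => hFκ α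
      · exact Set.iUnion₂_subset fun y _ => Set.inter_subset_right)
  obtain ⟨δ, hρδ, hδκ, hδ, -, hδs⟩ := H s (hκY s hs) (hYθ hs).1 ρ hρκ
  have hXδ : ∀ x ∈ X, x < δ := fun x hx => (hρ x (.inl (.inl hx))).trans_lt hρδ
  have hFδ : ∀ x ∈ X, F x ⊆ Set.Iio δ := fun x hx z hz =>
    (hρ z (.inl (.inr (Set.mem_iUnion₂.2 ⟨x, hx, hz⟩)))).trans_lt hρδ
  let f : Ordinal.{u} → Ordinal.{u} := D.subst κ δ
  have hfX : ∀ x ∈ X, f x = x := fun x hx => subst_of_lt (by rw [hκ]; exact hXκ hx)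
  have hargs : ∀ z ∈ X ∪ Y, D.Args κ δ z := by
    rintro z (hz | hz)
    · exact args_of_lt (by rw [hδ]; exact hXδ z hz) hδκ.le
    · refine args_of_lt_value_succ ((hYθ hz).1.trans_le hθ) fun x hx hxκ => ?_
      exact (hρ x (.inr (Set.mem_iUnion₂.2 ⟨z, hz, hx, hxκ⟩))).trans_lt hρδ
  have hlt : ∀ x ∈ X ∪ Y, ∀ y ∈ X ∪ Y, f x < f y ↔ x < y := fun x hx y hy =>
    subst_lt_subst (hargs x hx) (hargs y hy)
  have hle : ∀ x ∈ X ∪ Y, ∀ y ∈ X ∪ Y, f x ≤ f y ↔ x ≤ y := fun x hx y hy => by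
    rw [← not_lt, ← not_lt, hlt y hy x hx]
  have hfκ : f κ = δ := by
    have := subst_value (D := D) κ δ
    rwa [hκ, hδ] at this
  have hκa : D.Args κ δ κ := by
    simpa only [hκ] using args_value (D := D) κ δ
  have hfY : ∀ y ∈ Y, δ ≤ f y := fun y hy => by
    rw [← hfκ, ← not_lt]
    intro h
    exact absurd ((subst_lt_subst (hargs y (.inr hy)) hκa).1 h) (not_lt.2 (hκY y hy))
  have hfYκ : ∀ y ∈ Y, f y < κ := fun y hy => by
    refine (subst_lt_value (hargs y (.inr hy))).trans_le ?_
    conv_rhs => rw [← hκ]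
    exact value_strictMono.monotone (Order.add_one_le_iff.2 hδκ)
  refine ⟨f '' Y, hY.image f, ?_, f, ⟨?_, ?_, ?_, ?_⟩, hfX⟩
  · rintro _ ⟨y, hy, rfl⟩
    exact hfYκ y hy
  · have h1 : f '' (X ∪ Y) = X ∪ f '' Y := by
      rw [Set.image_union, Set.image_congr hfX, Set.image_id']
    rw [← h1]
    refine Set.InjOn.bijOn_image fun x hx y hy hxy => ?_
    exact (subst_inj (hargs x hx) (hargs y hy)).1 hxy
  · exact fun x hx y hy => (hle x hx y hy).symm
  · intro x hx y hy
    rcases hy with hy | hy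
    · rcases hx with hx | hx
      · rw [hfX x hx, hfX y hy]
      · have h1 : y < x := (hXκ hy).trans_le (hκY x hx)
        have h2 : f y < f x := (hlt y (.inl hy) x (.inr hx)).2 h1
        exact iff_of_false (fun h => absurd h.le (not_le.2 h1)) (fun h => absurd h.le (not_le.2 h2))
    rcases hx with hx | hx
    · rw [hfX x hx]
      -- If `x ≤₁ δ` then `x ≤₁ κ`, by the choice of `ρ`, and hence `x ≤₁ y` by transitivity.
      constructor
      · intro h
        exact h.of_le ((hXδ x hx).le.trans (hfY y hy)) ((hfYκ y hy).le.trans (hκY y hy))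
      · intro h
        have h1 : D.LeOne x κ :=
          hF x (hXκ hx) δ (hFδ x hx) (h.of_le (hXδ x hx).le (hfY y hy))
        exact h1.trans (hκs.of_le (hκY y hy) (hsmax y hy))
    · rcases (hκY x hx).eq_or_lt with rfl | hκx
      · rw [hfκ]
        exact iff_of_true (hκs.of_le (hκY y hy) (hsmax y hy))
          (hδs.of_le (hfY y hy) ((hle y (.inr hy) s (.inr hs)).2 (hsmax y hy)))
      -- Neither `x` nor its image is a fixed point.
      · constructor
        · intro h
          rw [eq_of_leOne (hargs x (.inr hx)) hκx h]
          exact leOne_refl _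
        · intro h
          have h1 : δ < f x := by
            rw [← hfκ]
            exact (subst_lt_subst hκa (hargs x (.inr hx))).2 hκx
          have h2 : D.Args δ κ (f x) :=
            (hargs x (.inr hx)).subst fun z _ hz => hz
          have h3 := eq_of_leOne h2 h1 h
          rw [(subst_inj (hargs x (.inr hx)) (hargs y (.inr hy))).1 h3]
          exact leOne_refl _
  · exact fun n σ _ γ hγ g hg => represents_subst hδκ hκ hδ σ (hargs γ hγ) fun i => hargs _ (hg i)

end NormalDilator

/-! ### A dilator as an element of an admissible set -/

namespace Admissible

open KripkePlatek PreDilator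

theorem mem_of_pair_mem {A : ZFSet.{u}} [Adm A] {x y : ZFSet.{u}} (h : ZFSet.pair x y ∈ A) :
    x ∈ A ∧ y ∈ A := by
  have h1 : ({x, y} : ZFSet.{u}) ∈ A := mem_of_mem h (by simp [ZFSet.pair])
  exact ⟨mem_of_mem h1 (by simp), mem_of_mem h1 (by simp)⟩

/-- An admissible set that contains a functor on the natural numbers contains `ω`. -/
theorem omega_mem_of_toSet_mem {A : ZFSet.{u}} [Adm A] {D : PreDilator.{u}} (h : D.toSet ∈ A) :
    (Ordinal.omega0.{u}).toZFSet ∈ A := by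
  have hG := (mem_of_pair_mem h).1
  obtain ⟨B, h1, h2⟩ := ASet.exists_collect (A := A) (U := El A) (W := El A)
    (R := fun x y => ∃ z, x = opair y z)
    (.of_rel₂ (S := fun x y => ∃ z, x = opair y z)
      (.ex (IsDeltaRel.eq_opair (some true) (some false) none).isSigmaRel)
      fun t u => Iff.rfl) (ASet.ofEl ⟨_, hG⟩) (by
      rintro x hx
      obtain ⟨n, hn⟩ := ZFSet.mem_range.1 (show x.1 ∈ _ from hx)
      have h3 := mem_of_pair_mem (hn.symm ▸ x.2)
      exact ⟨⟨_, h3.1⟩, ⟨_, h3.2⟩, Subtype.ext hn.symm⟩)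
  have : (Ordinal.omega0.{u}).toZFSet = B.1.1 := by
    ext x
    rw [Ordinal.mem_toZFSet_iff]
    constructor
    · rintro ⟨a, ha, rfl⟩
      obtain ⟨n, rfl⟩ := Ordinal.lt_omega0.1 ha
      have h3 : ZFSet.pair (natSet n) (D.obj n).toZFSet ∈
          ZFSet.range (fun n : ℕ => ZFSet.pair (natSet n) (D.obj n).toZFSet) :=
        ZFSet.mem_range.2 ⟨n, rfl⟩
      obtain ⟨w, hw, z, hz⟩ := h1 ⟨_, mem_of_mem hG h3⟩ h3
      have h4 := (ZFSet.pair_inj.1 (congrArg Subtype.val hz)).1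
      change natSet n ∈ _
      rw [h4]
      exact hw
    · intro hx
      obtain ⟨y, hy, z, hz⟩ := h2 ⟨x, mem_of_mem B.1.2 hx⟩ hx
      obtain ⟨n, hn⟩ := ZFSet.mem_range.1 (show y.1 ∈ _ from hy)
      rw [hz] at hn
      exact ⟨n, Ordinal.natCast_lt_omega0 n, (ZFSet.pair_inj.1 hn).1⟩
  rw [this]
  exact B.1.2

variable {A : ZFSet.{u}} [AdmOmega A] {D : PreDilator.{u}} [hD : Fact (D.toSet ∈ A)]
variable {T U W V : Type*} [Coded A T] [Coded A U] [Coded A W] [Coded A V]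

theorem obj_mem (A : ZFSet.{u}) [AdmOmega A] (D : PreDilator.{u}) [hD : Fact (D.toSet ∈ A)]
    (n : ℕ) : (D.obj n).toZFSet ∈ A := by
  have hG := (mem_of_pair_mem hD.out).1
  have h3 : ZFSet.pair (natSet n) (D.obj n).toZFSet ∈
      ZFSet.range (fun n : ℕ => ZFSet.pair (natSet n) (D.obj n).toZFSet) :=
    ZFSet.mem_range.2 ⟨n, rfl⟩
  exact (mem_of_pair_mem (mem_of_mem hG h3)).2

/-- The action of `D` on objects is recursive. -/
theorem SigmaFun.obj :
    SigmaFun A (fun n : ℕ => (⟨D.obj n, obj_mem A D n⟩ : On A)) := by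
  have hG := (mem_of_pair_mem hD.out).1
  let S : ASet A (ℕ × On A) := ⟨⟨_, hG⟩, fun x hx => by
    obtain ⟨n, hn⟩ := ZFSet.mem_range.1 (show x.1 ∈ _ from hx)
    exact ⟨(n, ⟨D.obj n, obj_mem A D n⟩), Subtype.ext hn⟩⟩
  have hS : ∀ p, p ∈ S ↔ p.2 = (⟨D.obj p.1, obj_mem A D p.1⟩ : On A) := by
    rintro ⟨n, β⟩
    constructor
    · intro h
      obtain ⟨m, hm⟩ := ZFSet.mem_range.1 (show (enc A (n, β)).1 ∈ _ from h)
      have : (m, (⟨D.obj m, obj_mem A D m⟩ : On A)) = (n, β) := (enc_inj A).1 (Subtype.ext hm)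
      obtain ⟨rfl, rfl⟩ := Prod.mk.inj this
      rfl
    · intro h
      obtain rfl : β = ⟨D.obj n, obj_mem A D n⟩ := h
      exact ZFSet.mem_range.2 ⟨n, rfl⟩
  exact (SigmaFun.mem_aset (f := fun p : ℕ × On A => p) (F := fun _ => S) (by fun_prop)
    (by fun_prop)).sigmaPred.of_iff fun p => (hS p).symm

theorem enc_graph {m n : ℕ} (f : Fin m ↪o Fin n) :
    (enc A ((m, n, graph f) : ℕ × ℕ × Finset (ℕ × ℕ))).1 = natMorphismSet f := by
  have : (enc A (graph f)).1 = ZFSet.range (fun i : Fin m =>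
      ZFSet.pair (natSet.{u} i) (natSet (f i))) := by
    ext x
    rw [ZFSet.mem_range]
    constructor
    · intro hx
      obtain ⟨p, hp⟩ := (ASet.ofFinset A (graph f)).2 ⟨x, mem_of_mem (enc A (graph f)).2 hx⟩ hx
      have h1 : p ∈ ASet.ofFinset A (graph f) := by
        rw [ASet.mem_def, hp]
        exact hx
      obtain ⟨i, -, rfl⟩ := Finset.mem_image.1 (ASet.mem_ofFinset.1 h1)
      exact ⟨i, congrArg Subtype.val hp⟩
    · rintro ⟨i, rfl⟩
      exact ASet.mem_ofFinset.2 (Finset.mem_image_of_mem _ (Finset.mem_univ i))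
  exact congrArg (fun z => ZFSet.pair (natSet m) (ZFSet.pair (natSet n) z)) this

theorem act_mem (A : ZFSet.{u}) [AdmOmega A] (D : PreDilator.{u}) [hD : Fact (D.toSet ∈ A)]
    (m n : ℕ) (r : Finset (ℕ × ℕ)) (σ : Ordinal.{u}) : (D.act m n r σ).toZFSet ∈ A := by
  rw [act]
  split_ifs with h
  · exact On.mem_of_lt (D.map _ _).2 (obj_mem A D n)
  · exact On.zero_mem A

/-- The action of `D` on morphisms is recursive. -/
theorem SigmaFun.act :
    SigmaFun A (fun p : (ℕ × ℕ × Finset (ℕ × ℕ)) × On A =>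
      (⟨D.act p.1.1 p.1.2.1 p.1.2.2 p.2.1, act_mem A D _ _ _ _⟩ : On A)) := by
  have hG := (mem_of_pair_mem hD.out).2
  -- A morphism and its image under `D`, as an object of a coded type.
  have hdata : ∀ {m n : ℕ} (f : Fin m ↪o Fin n), ∃ g : ASet A (On A × On A),
      (∀ σ τ, (σ, τ) ∈ g ↔ ∃ h : σ.1 < D.obj m, (D.map f ⟨σ.1, h⟩).1 = τ.1) ∧
      (enc A (((m, n, graph f), (⟨D.obj m, obj_mem A D m⟩ : On A),
        (⟨D.obj n, obj_mem A D n⟩ : On A), g) :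
          (ℕ × ℕ × Finset (ℕ × ℕ)) × On A × On A × ASet A (On A × On A))).1 =
      ZFSet.pair (natMorphismSet f) (ordMorphismSet (D.map f)) := by
    intro m n f
    have h1 := mem_of_mem hG (ZFSet.mem_range.2 ⟨(⟨m, n, f⟩ : Σ m n : ℕ, Fin m ↪o Fin n), rfl⟩)
    have h2 := (mem_of_pair_mem (mem_of_pair_mem (mem_of_pair_mem h1).2).2).2
    have key : ∀ x : Set.Iio (D.obj m), ∃ p : On A × On A, p.1.1 = x.1 ∧ p.2.1 = (D.map f x).1 :=
      fun x => ⟨(⟨x.1, On.mem_of_lt x.2 (obj_mem A D m)⟩,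
        ⟨_, On.mem_of_lt (D.map f x).2 (obj_mem A D n)⟩), rfl, rfl⟩
    refine ⟨⟨⟨_, h2⟩, fun x hx => ?_⟩, fun σ τ => ?_, ?_⟩
    · obtain ⟨y, hy⟩ := ZFSet.mem_range.1 (show x.1 ∈ _ from hx)
      obtain ⟨p, hp1, hp2⟩ := key y
      refine ⟨p, Subtype.ext ?_⟩
      rw [← hy, ← hp1, ← hp2]
      rfl
    · refine ZFSet.mem_range.trans ?_
      constructor
      · rintro ⟨y, hy⟩
        obtain ⟨p, hp1, hp2⟩ := key y
        rw [← hp1, ← hp2] at hy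
        obtain rfl : p = (σ, τ) := (enc_inj A).1 (Subtype.ext hy)
        refine ⟨hp1 ▸ y.2, ?_⟩
        dsimp only at hp1 hp2
        rw [hp2]
        congr 2
        exact Subtype.ext hp1
      · rintro ⟨h, h'⟩
        refine ⟨⟨σ.1, h⟩, ?_⟩
        dsimp only
        rw [h']
        rfl
    · rw [enc_prod]
      change ZFSet.pair (enc A ((m, n, graph f) : ℕ × ℕ × Finset (ℕ × ℕ))).1 _ = _
      rw [enc_graph]
      rfl
  let S : ASet A ((ℕ × ℕ × Finset (ℕ × ℕ)) × On A × On A × ASet A (On A × On A)) :=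
    ⟨⟨_, hG⟩, fun x hx => by
      obtain ⟨⟨m, n, f⟩, hf⟩ := ZFSet.mem_range.1 (show x.1 ∈ _ from hx)
      obtain ⟨g, -, hg⟩ := hdata f
      exact ⟨_, Subtype.ext (hg.trans hf)⟩⟩
  have hS : ∀ z, z ∈ S → ∃ (m n : ℕ) (f : Fin m ↪o Fin n), z.1 = (m, n, graph f) ∧
      z.2.1.1 = D.obj m ∧ ∀ σ τ, (σ, τ) ∈ z.2.2.2 ↔ ∃ h : σ.1 < D.obj m,
        (D.map f ⟨σ.1, h⟩).1 = τ.1 := by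
    intro z hz
    obtain ⟨⟨m, n, f⟩, hf⟩ := ZFSet.mem_range.1 (show (enc A z).1 ∈ _ from hz)
    obtain ⟨g, hg, hg'⟩ := hdata f
    obtain rfl := (enc_inj A).1 (Subtype.ext (hf.symm.trans hg'.symm))
    exact ⟨m, n, f, rfl, rfl, hg⟩
  have hS' : ∀ {m n : ℕ} (f : Fin m ↪o Fin n), ∃ z, z ∈ S ∧ z.1 = (m, n, graph f) := by
    intro m n f
    obtain ⟨g, hg, hg'⟩ := hdata f
    refine ⟨((m, n, graph f), ⟨D.obj m, obj_mem A D m⟩, ⟨D.obj n, obj_mem A D n⟩, g), ?_, rfl⟩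
    rw [ASet.mem_def, hg']
    exact ZFSet.mem_range.2 ⟨⟨m, n, f⟩, rfl⟩
  have h1 : SigmaFun A (fun p : ((ℕ × ℕ × Finset (ℕ × ℕ)) × On A) × On A =>
      (∃ z, z ∈ {z | z ∈ S} ∧ z.1 = p.1.1 ∧ (p.1.2, p.2) ∈ z.2.2.2) ∨
      (¬ ∃ z, z ∈ {z | z ∈ S} ∧ z.1 = p.1.1 ∧ p.1.2 < z.2.1) ∧ p.2 = ⟨0, On.zero_mem A⟩) := by
    refine .or (.bex (.const S) (.and (by fun_prop) (.mem_aset (by fun_prop) (by fun_prop))))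
      (.and (.not (.bex (.const S) (by fun_prop))) (by fun_prop))
  refine h1.sigmaPred.of_iff fun p => ?_
  obtain ⟨⟨⟨m, n, r⟩, σ⟩, τ⟩ := p
  dsimp only [Set.mem_ofPred_eq]
  rw [Subtype.ext_iff]
  by_cases h : (∃ f : Fin m ↪o Fin n, graph f = r) ∧ σ.1 < D.obj m
  · obtain ⟨⟨f, rfl⟩, hσ⟩ := h
    dsimp only
    rw [act_graph f hσ]
    obtain ⟨z, hz, hz1⟩ := hS' f
    constructor
    · intro h
      refine .inl ⟨z, hz, hz1, ?_⟩
      obtain ⟨m', n', f', h1, -, h2⟩ := hS z hz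
      rw [hz1] at h1
      simp only [Prod.mk.injEq] at h1
      obtain ⟨rfl, rfl, h1⟩ := h1
      obtain rfl := graph_injective h1
      exact (h2 _ _).2 ⟨hσ, h.symm⟩
    · rintro (⟨z, hz, hz1, h⟩ | ⟨h, -⟩)
      · obtain ⟨m', n', f', h1, -, h2⟩ := hS z hz
        rw [hz1] at h1
        simp only [Prod.mk.injEq] at h1
        obtain ⟨rfl, rfl, h1⟩ := h1
        obtain rfl := graph_injective h1
        obtain ⟨_, h3⟩ := (h2 _ _).1 h
        exact h3.symm
      · refine (h ⟨z, hz, hz1, ?_⟩).elim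
        obtain ⟨m', n', f', h1, h2, -⟩ := hS z hz
        rw [hz1] at h1
        simp only [Prod.mk.injEq] at h1
        obtain ⟨rfl, rfl, h1⟩ := h1
        rw [← Subtype.coe_lt_coe, h2]
        exact hσ
  · have h0 : D.act m n r σ.1 = 0 := dif_neg h
    dsimp only
    rw [h0]
    have h2 : ∀ z, z ∈ S → z.1 = (m, n, r) → ¬ σ.1 < z.2.1.1 := by
      intro z hz hz1 hlt
      obtain ⟨m', n', f', h1, h2, -⟩ := hS z hz
      rw [hz1] at h1
      simp only [Prod.mk.injEq] at h1
      obtain ⟨rfl, rfl, rfl⟩ := h1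
      exact h ⟨⟨f', rfl⟩, h2 ▸ hlt⟩
    constructor
    · intro h3
      exact .inr ⟨fun ⟨z, hz, hz1, h⟩ => h2 z hz hz1 h, Subtype.ext h3⟩
    · rintro (⟨z, hz, hz1, h3⟩ | ⟨-, h3⟩)
      · obtain ⟨m', n', f', h1, h4, h5⟩ := hS z hz
        obtain ⟨h6, -⟩ := (h5 _ _).1 h3
        exact (h2 z hz hz1 (h4 ▸ h6)).elim
      · exact congrArg Subtype.val h3

end Admissible

/-! ### Recursiveness of the values of a dilator -/

namespace Admissible

open KripkePlatek PreDilator NormalDilator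

variable {A : ZFSet.{u}} [AdmOmega A]
variable {T U W V : Type*} [Coded A T] [Coded A U] [Coded A W] [Coded A V]

section

variable {D : PreDilator.{u}} [hD : Fact (D.toSet ∈ A)]

theorem SigmaFun.posIn {f : T → Finset (On A)} {g : T → On A} (hf : SigmaFun A f)
    (hg : SigmaFun A g) : SigmaFun A (fun t => (f t).posIn (g t)) :=
  .finset_card (.finset_filter (P := fun t x => x < g t) hf (by fun_prop))

theorem SigmaFun.inclGraph {f g : T → Finset (On A)} (hf : SigmaFun A f)
    (hg : SigmaFun A g) : SigmaFun A (fun t => inclGraph (f t) (g t)) :=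
  .finset_image (f := fun t x => ((f t).posIn x, (g t).posIn x)) hf
    (.prodMk (.posIn (by fun_prop) (by fun_prop)) (.posIn (by fun_prop) (by fun_prop)))

variable (D) in
/-- The function `PreDilator.eval` on the ordinals of an admissible set. -/
noncomputable def evalOn (e : Finset (On A)) (p : On A × Finset (On A)) : On A :=
  ⟨D.eval e (p.1.1, p.2), act_mem A D _ _ _ _⟩

theorem SigmaFun.evalOn {e : T → Finset (On A)} {p : T → On A × Finset (On A)}
    (he : SigmaFun A e) (hp : SigmaFun A p) : SigmaFun A (fun t => evalOn D (e t) (p t)) :=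
  (SigmaFun.act (A := A) (D := D)).comp
    (f := fun t => (((p t).2.card, (e t).card, PreDilator.inclGraph (p t).2 (e t)), (p t).1))
    (.prodMk (.prodMk (by fun_prop) (.prodMk (by fun_prop) (.inclGraph (by fun_prop)
      (by fun_prop)))) (by fun_prop))

/-- A term with symbol and arguments in an admissible set, as a term. -/
noncomputable def onTerm (p : On A × Finset (On A)) : Ordinal.{u} × Finset Ordinal.{u} :=
  (p.1.1, p.2.image Subtype.val)

theorem onTerm_injective : Function.Injective (onTerm (A := A)) := by
  rintro ⟨σ, c⟩ ⟨τ, d⟩ h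
  obtain ⟨h1, h2⟩ := Prod.mk.inj h
  exact Prod.ext (Subtype.ext h1) (Finset.image_injective Subtype.val_injective h2)

theorem isTerm_onTerm {p : On A × Finset (On A)} :
    D.IsTerm (onTerm p) ↔ D.IsTerm (p.1.1, p.2) :=
  isTerm_image (p := (p.1.1, p.2)) Subtype.val_injective.injOn

theorem termLT_onTerm {p q : On A × Finset (On A)} :
    D.TermLT (onTerm p) (onTerm q) ↔ D.TermLT (p.1.1, p.2) (q.1.1, q.2) :=
  termLT_image (p := (p.1.1, p.2)) (q := (q.1.1, q.2)) ((Subtype.strictMono_coe _).strictMonoOn _)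

theorem exists_onTerm_eq {p : Ordinal.{u} × Finset Ordinal.{u}} (hp : D.IsTerm p)
    (h : ∀ x ∈ p.2, x.toZFSet ∈ A) : ∃ q : On A × Finset (On A), onTerm q = p := by
  classical
  refine ⟨(⟨p.1, On.mem_of_lt hp.1 (obj_mem A D _)⟩, p.2.subtype _), ?_⟩
  refine Prod.ext rfl ?_
  ext x
  simp only [onTerm, Finset.mem_image, Finset.mem_subtype, Subtype.exists, exists_and_left,
    exists_prop, exists_eq_right_right, and_iff_left_iff_imp]
  exact h x

theorem SigmaFun.isTerm {p : T → On A × Finset (On A)} (hp : SigmaFun A p) :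
    SigmaFun A (fun t => D.IsTerm (onTerm (p t))) := by
  have hobj : ∀ {S : Type _} [Coded A S] {c : S → Finset (On A)}, SigmaFun A c →
      SigmaFun A (fun s => (⟨D.obj (c s).card, obj_mem A D _⟩ : On A)) := fun hc =>
    SigmaFun.obj.comp (.finset_card hc)
  have h1 : SigmaFun A (fun p : On A × Finset (On A) => p.1 < ⟨D.obj p.2.card, obj_mem A D _⟩ ∧
      ∀ c, c ∈ {c : Finset (On A) | (c : Set (On A)) ⊆ p.2} →
      (∃ σ : On A, σ ∈ {σ : On A | σ < ⟨D.obj c.card, obj_mem A D _⟩} ∧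
        Admissible.evalOn D p.2 (σ, c) = p.1) → c = p.2) := by
    refine .and (.lt (by fun_prop) (hobj (by fun_prop))) (.ball (.finset_subsets (.coe
      (by fun_prop))) (.imp (.bex (.iio (hobj (by fun_prop))) (.eq
        (.evalOn (by fun_prop) (by fun_prop)) (by fun_prop))) (by fun_prop)))
  refine (h1.comp hp).congr fun t => propext ?_
  rw [isTerm_onTerm, isTerm_iff]
  refine and_congr Iff.rfl (forall₂_congr fun c hc => imp_congr_left ?_)
  constructor
  · rintro ⟨σ, h1, h2⟩
    exact ⟨⟨σ, On.mem_of_lt h1 (obj_mem A D _)⟩, h1, Subtype.ext h2⟩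
  · rintro ⟨σ, h1, h2⟩
    exact ⟨σ.1, h1, congrArg Subtype.val h2⟩

theorem SigmaFun.termLT {p q : T → On A × Finset (On A)} (hp : SigmaFun A p)
    (hq : SigmaFun A q) : SigmaFun A (fun t => D.TermLT (onTerm (p t)) (onTerm (q t))) := by
  have h1 : SigmaFun A (fun t => Admissible.evalOn D ((p t).2 ∪ (q t).2) (p t) <
      Admissible.evalOn D ((p t).2 ∪ (q t).2) (q t)) :=
    .lt (.evalOn (.finset_union (by fun_prop) (by fun_prop)) hp)
      (.evalOn (.finset_union (by fun_prop) (by fun_prop)) hq)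
  exact h1.congr fun t => propext termLT_onTerm

end

variable {D : NormalDilator.{u}} [hD : Fact (D.toPreDilator.toSet ∈ A)]

/-- The predecessors of a term form a set, since normality bounds their arguments. -/
theorem SigmaSet.termPreds : SigmaSet A (fun p : On A × Finset (On A) =>
    {q : On A × Finset (On A) |
      D.IsTerm (onTerm q) ∧ D.IsTerm (onTerm p) ∧ D.TermLT (onTerm q) (onTerm p)}) := by
  have h1 : SigmaSet A (fun p : On A × Finset (On A) =>
      {σ : On A | ∃ n, n ∈ (Set.univ : Set ℕ) ∧
        σ ∈ {σ : On A | σ < ⟨D.obj n, obj_mem A D.toPreDilator n⟩}}) :=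
    .biUnion .nat (.iio (SigmaFun.obj.comp (by fun_prop)))
  have h2 : SigmaSet A (fun p : On A × Finset (On A) => {x : On A |
      ∃ y, y ∈ (p.2 : Set (On A)) ∧ x ∈ {x : On A | x < y} ∪ {y}}) :=
    .biUnion (.coe (by fun_prop)) (.union (.iio (by fun_prop)) (.singleton (by fun_prop)))
  refine ((h1.prod h2.finset_subsets).sep (P := fun p (q : On A × Finset (On A)) =>
    D.IsTerm (onTerm q) ∧ D.IsTerm (onTerm p) ∧ D.TermLT (onTerm q) (onTerm p))
    (.and (.isTerm (by fun_prop)) (.and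
      (.isTerm (by fun_prop)) (.termLT (by fun_prop) (by fun_prop))))).of_eq fun p q => ?_
  simp only [Set.mem_ofPred_eq, Set.mem_prod, Set.mem_univ, true_and, iff_and_self]
  rintro ⟨hq, hp, hqp⟩
  refine ⟨⟨_, hq.1⟩, fun x hx => ?_⟩
  rw [← val_lt_val hq hp] at hqp
  have hx' : x.1 ∈ (D.term (D.val (onTerm q))).2 := by
    rw [term_val hq]
    exact Finset.mem_image_of_mem _ hx
  obtain ⟨y, hy, hxy⟩ := exists_le_of_lt hqp hx'
  rw [term_val hp] at hy
  obtain ⟨z, hz, rfl⟩ := Finset.mem_image.1 hy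
  refine ⟨z, hz, ?_⟩
  rcases hxy.lt_or_eq with h | h
  · exact .inl h
  · exact .inr (Subtype.ext h)

/-- The collapse of the order on terms to the ordinals is defined by a recursion that can be
carried out in an admissible set. -/
theorem val_recursion : (∀ p : On A × Finset (On A), ∃ u : On A, u.1 = D.val (onTerm p)) ∧
    SigmaPred A (fun p : (On A × Finset (On A)) × On A => p.2.1 = D.val (onTerm p.1)) := by
  -- The value of a term is the least strict upper bound for the values of its predecessors. An
  -- object that is not a term has no predecessors, in accordance with the default value zero.
  refine sigma_recursion (r := InvImage (· < ·) (fun p : On A × Finset (On A) => D.val (onTerm p)))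
    (InvImage.wf _ wellFounded_lt) (SigmaSet.termPreds (D := D)) ?_
    (G := fun p (u : On A) => u.1 = D.val (onTerm p)) ?_
    (Ψ := fun p u g => (∀ z, z ∈ {z | z ∈ g} → z.2 < u) ∧
      ∀ β, β ∈ {β | β < u} → ∃ z, z ∈ {z | z ∈ g} ∧ β ≤ z.2) ?_ ?_
  · rintro p q ⟨h1, h2, h3⟩
    exact (val_lt_val h1 h2).2 h3
  · exact fun p u u' h h' => Subtype.ext (h.trans h'.symm)
  · exact .and (.ball (SigmaFun.sigmaSet (by fun_prop)) (SigmaFun.sigmaPred (by fun_prop)))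
      (.ball (.iio (by fun_prop)) (SigmaFun.sigmaPred (.bex (SigmaFun.sigmaSet (by fun_prop))
        (by fun_prop))))
  · intro p g hg hb
    constructor
    · obtain ⟨S, hS⟩ := (SigmaSet.image (T := ℕ) (SigmaSet.const g) (f := fun _ z => z.2)
        (by fun_prop)).choose 0
      obtain ⟨β, hβ⟩ := S.exists_bound
      obtain ⟨u, hu, hu'⟩ := (wellFounded_lt (α := On A)).has_min
        {u | ∀ z, z ∈ g → z.2 < u} ⟨β, fun z hz => hβ _ ((hS _).2 ⟨z, hz, rfl⟩)⟩
      refine ⟨u, hu, fun β hβ => ?_⟩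
      by_contra! h
      exact hu' β (fun z hz => h z hz) hβ
    · rintro u ⟨h1, h2⟩
      refine eq_of_forall_lt_iff fun γ => ?_
      constructor
      · intro h
        obtain ⟨z, hz, hγ⟩ := h2 ⟨γ, On.mem_of_lt h u.2⟩ h
        obtain ⟨⟨h3, h4, h5⟩, h6⟩ := (hg z).1 hz
        refine lt_of_le_of_lt (Subtype.coe_le_coe.2 hγ) ?_
        rw [h6]
        exact (val_lt_val h3 h4).2 h5
      · intro h
        have hp : D.IsTerm (onTerm p) := by
          by_contra hp
          rw [val_of_not hp] at h
          exact not_lt_zero h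
        obtain ⟨q, hq⟩ := exists_onTerm_eq (A := A) (D.isTerm_term γ) fun x hx => by
          obtain ⟨y, hy, hxy⟩ := exists_le_of_lt h hx
          rw [term_val hp] at hy
          obtain ⟨z, hz, rfl⟩ := Finset.mem_image.1 hy
          rcases hxy.lt_or_eq with h | h
          · exact On.mem_of_lt h z.2
          · exact h ▸ z.2
        have hq' : D.val (onTerm q) = γ := by rw [hq, val_term]
        have hqt : D.IsTerm (onTerm q) := hq ▸ D.isTerm_term γ
        have hqb : D.IsTerm (onTerm q) ∧ D.IsTerm (onTerm p) ∧ D.TermLT (onTerm q) (onTerm p) := by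
          refine ⟨hqt, hp, ?_⟩
          rw [← val_lt_val hqt hp, hq']
          exact h
        obtain ⟨w, hw⟩ := hb q hqb
        have := h1 (q, w) ((hg _).2 ⟨hqb, hw⟩)
        rw [← Subtype.coe_lt_coe] at this
        rwa [← hq', ← hw]

variable (D) in
theorem val_mem (p : On A × Finset (On A)) : (D.val (onTerm p)).toZFSet ∈ A := by
  obtain ⟨u, hu⟩ := (val_recursion (D := D)).1 p
  exact hu ▸ u.2

variable (D) in
/-- The value of a term with symbol and arguments in an admissible set. -/
noncomputable def valOn (p : On A × Finset (On A)) : On A := ⟨_, val_mem D p⟩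

theorem SigmaFun.valOn {p : T → On A × Finset (On A)} (hp : SigmaFun A p) :
    SigmaFun A (fun t => valOn D (p t)) :=
  comp (g := Admissible.valOn D) ((val_recursion (D := D)).2.of_iff fun _ => Subtype.ext_iff) hp

variable (A D) in
theorem term_mem (γ : On A) : ∃ p : On A × Finset (On A), onTerm p = D.term γ.1 :=
  exists_onTerm_eq (D.isTerm_term γ.1) fun x hx =>
    On.mem_of_lt (D.lt_value_iff.1 (D.lt_value_succ γ.1) x hx) γ.succ_mem

variable (D) in
/-- The term that represents an ordinal of an admissible set. -/
noncomputable def termOn (γ : On A) : On A × Finset (On A) := Classical.choose (term_mem A D γ)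

theorem onTerm_termOn (γ : On A) : onTerm (termOn D γ) = D.term γ.1 :=
  Classical.choose_spec (term_mem A D γ)

theorem SigmaFun.termOn {f : T → On A} (hf : SigmaFun A f) :
    SigmaFun A (fun t => termOn D (f t)) := by
  have h : SigmaPred A (fun p : On A × (On A × Finset (On A)) => D.IsTerm (onTerm p.2) ∧
      Admissible.valOn D p.2 = p.1) :=
    .and (SigmaFun.sigmaPred (.isTerm (by fun_prop))) (.graph (.valOn (by fun_prop)) (by fun_prop))
  refine comp (g := Admissible.termOn D) (h.of_iff fun _ => ?_) hf
  constructor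
  · intro h
    rw [h, onTerm_termOn]
    refine ⟨D.isTerm_term _, Subtype.ext ?_⟩
    change D.val _ = _
    rw [onTerm_termOn, val_term]
  · rintro ⟨h1, h2⟩
    apply onTerm_injective
    rw [onTerm_termOn, ← h2]
    exact (term_val h1).symm

/-- The value of `D` at an ordinal of an admissible set belongs to the admissible set. -/
theorem value_mem (α : On A) : (D.value α.1).toZFSet ∈ A := by
  obtain ⟨p, hp⟩ := exists_onTerm_eq (A := A) (D.isTerm_singleton α.1) (by
    intro x hx
    rw [Finset.mem_singleton.1 hx]
    exact α.2)
  have := val_mem D p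
  rwa [hp, ← D.term_value, val_term] at this

theorem muZero_mem (A : ZFSet.{u}) [AdmOmega A] (D : NormalDilator.{u})
    [hD : Fact (D.toPreDilator.toSet ∈ A)] : (D.muZero).toZFSet ∈ A :=
  On.mem_of_lt (D.isTerm_singleton (0 : ℕ)).1 (obj_mem A D.toPreDilator _)

variable (D) in
/-- The function `D` on the ordinals of an admissible set. -/
noncomputable def valueOn (α : On A) : On A := ⟨D.value α.1, value_mem α⟩

theorem SigmaFun.valueOn {f : T → On A} (hf : SigmaFun A f) :
    SigmaFun A (fun t => valueOn D (f t)) := by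
  have : SigmaFun A (fun t => Admissible.valOn D (⟨D.muZero, muZero_mem A D⟩, {f t})) :=
    .valOn (.prodMk (by fun_prop) (.finset_singleton hf))
  refine this.congr fun t => Subtype.ext ?_
  change D.value _ = D.val (onTerm _)
  rw [onTerm, Finset.image_singleton, ← D.term_value, val_term]

variable (D) in
/-- Substitution on the ordinals of an admissible set. -/
noncomputable def substOn (a b γ : On A) : On A :=
  valOn D ((termOn D γ).1, (termOn D γ).2.image fun x => if x = a then b else x)

theorem substOn_val (a b γ : On A) : (substOn D a b γ).1 = D.subst a.1 b.1 γ.1 := by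
  rw [substOn, valOn, subst, ← onTerm_termOn]
  dsimp only [onTerm]
  rw [Finset.image_image, Finset.image_image]
  congr 2
  refine Finset.image_congr fun x _ => ?_
  simp only [Function.comp_apply, move, ← Subtype.ext_iff]
  split_ifs <;> rfl

theorem SigmaFun.substOn {a b f : T → On A} (ha : SigmaFun A a) (hb : SigmaFun A b)
    (hf : SigmaFun A f) : SigmaFun A (fun t => substOn D (a t) (b t) (f t)) :=
  .valOn (.prodMk (.fst (.termOn hf)) (.finset_image (f := fun t x => if x = a t then b t else x)
    (.snd (.termOn hf)) (.ite (by fun_prop) (by fun_prop) (by fun_prop))))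

end Admissible

/-! ### Recursiveness of the relation `≤₁` -/

namespace NormalDilator

variable {D : NormalDilator.{u}}

open PreDilator

/-- A function preserves and reflects the relations `γ ≃ (σ; γ₀, …, γₙ₋₁)` if and only if it is
compatible with the representation of ordinals by terms. -/
theorem represents_iff_iff {X : Set Ordinal.{u}} {f : Ordinal.{u} → Ordinal.{u}}
    (hf : StrictMonoOn f X) :
    (∀ (n : ℕ) (σ : Set.Iio (D.obj n)), D.InTrace n σ → ∀ γ ∈ X, ∀ g : Fin n → Ordinal.{u},
      (∀ i, g i ∈ X) → (D.Represents σ g γ ↔ D.Represents σ (fun i => f (g i)) (f γ))) ↔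
    ∀ γ ∈ X, ∀ p : Ordinal.{u} × Finset Ordinal.{u}, (p.2 : Set Ordinal.{u}) ⊆ X →
      (D.term γ = p ↔ D.term (f γ) = (p.1, p.2.image f)) := by
  constructor
  · intro h γ hγ p hp
    by_cases hpt : D.IsTerm p
    · have h1 := fun i => p.2.orderEmbOfFin_mem rfl i
      have h2 := h _ ⟨p.1, hpt.1⟩ hpt.2 γ hγ (p.2.orderEmbOfFin rfl) fun i => hp (h1 i)
      have h3 : StrictMono fun i => f (p.2.orderEmbOfFin rfl i) := fun i j hij =>
        hf (hp (h1 i)) (hp (h1 j)) ((p.2.orderEmbOfFin rfl).strictMono hij)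
      have h4 : Finset.univ.image (fun i => f (p.2.orderEmbOfFin rfl i)) = p.2.image f := by
        conv_rhs => rw [← image_orderEmbOfFin p.2, Finset.image_image]
        rfl
      rw [represents_iff, represents_iff, image_orderEmbOfFin, h4] at h2
      simpa only [show D.InTrace _ _ from hpt.2, (p.2.orderEmbOfFin rfl).strictMono, h3,
        true_and] using h2
    · refine iff_of_false (fun h => hpt (h ▸ D.isTerm_term γ)) (fun h => hpt ?_)
      rw [← isTerm_image (hf.injOn.mono hp), ← h]
      exact D.isTerm_term _
  · intro h n σ hσ γ hγ g hg
    rw [represents_iff, represents_iff]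
    have h1 : StrictMono (fun i => f (g i)) ↔ StrictMono g :=
      forall₂_congr fun i j => imp_congr_right fun _ => hf.lt_iff_lt (hg i) (hg j)
    rw [h1, h γ hγ (σ.1, Finset.univ.image g), Finset.image_image]
    · rfl
    · intro x hx
      obtain ⟨i, -, rfl⟩ := Finset.mem_image.1 hx
      exact hg i

end NormalDilator

namespace Admissible

open KripkePlatek PreDilator NormalDilator

variable {A : ZFSet.{u}} [AdmOmega A]
variable {T U W V : Type*} [Coded A T] [Coded A U] [Coded A W] [Coded A V]
variable {D : NormalDilator.{u}} [hD : Fact (D.toPreDilator.toSet ∈ A)]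

variable (D) in
/-- The finite set `P` is the graph of a function with values below `α` that fixes the ordinals
below `α` and is an isomorphism with respect to `≤`, the relation `R`, and the relations
`γ ≃ (σ; γ₀, …, γₙ₋₁)`. -/
def IsPartialIso (R : On A → On A → Prop) (α : On A) (P : Finset (On A × On A)) : Prop :=
  (∀ p, p ∈ (P : Set (On A × On A)) → p.2 < α ∧ (p.1 < α → p.2 = p.1)) ∧
  (∀ p, p ∈ (P : Set (On A × On A)) → ∀ q, q ∈ (P : Set (On A × On A)) →
    (p.1 ≤ q.1 ↔ p.2 ≤ q.2) ∧ (R p.1 q.1 ↔ R p.2 q.2)) ∧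
  ∀ p, p ∈ (P : Set (On A × On A)) →
    ∀ Q, Q ∈ {Q : Finset (On A × On A) | (Q : Set (On A × On A)) ⊆ (P : Set (On A × On A))} →
    ((termOn D p.1).2 = Q.image Prod.fst →
      termOn D p.2 = ((termOn D p.1).1, Q.image Prod.snd)) ∧
    ((termOn D p.2).2 = Q.image Prod.snd →
      termOn D p.1 = ((termOn D p.2).1, Q.image Prod.fst))

theorem SigmaFun.isPartialIso {R : T → On A → On A → Prop} {α : T → On A}
    {P : T → Finset (On A × On A)} (hR : SigmaFun A (fun p : T × On A × On A => R p.1 p.2.1 p.2.2))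
    (hα : SigmaFun A α) (hP : SigmaFun A P) :
    SigmaFun A (fun t => IsPartialIso D (R t) (α t) (P t)) := by
  have hi : ∀ {S : Type _} [Coded A S] {F : S → Finset (On A × On A)}, SigmaFun A F →
      SigmaFun A (fun s => (F s).image Prod.fst) ∧ SigmaFun A (fun s => (F s).image Prod.snd) :=
    fun hF => ⟨.finset_image (f := fun _ p => p.1) hF (by fun_prop),
      .finset_image (f := fun _ p => p.2) hF (by fun_prop)⟩
  refine .and (.ball (.coe hP) (.and (by fun_prop) (.imp (by fun_prop) (by fun_prop))))
    (.and (.ball (.coe hP) (.ball (.coe (by fun_prop)) (.and (by fun_prop) (.iff ?_ ?_))))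
      (.ball (.coe hP) (.ball (.finset_subsets (.coe (by fun_prop))) (.and (.imp ?_ ?_)
        (.imp ?_ ?_)))))
  · exact hR.comp (f := fun p : (T × On A × On A) × On A × On A => (p.1.1, p.1.2.1, p.2.1))
      (by fun_prop)
  · exact hR.comp (f := fun p : (T × On A × On A) × On A × On A => (p.1.1, p.1.2.2, p.2.2))
      (by fun_prop)
  · exact .eq (.snd (.termOn (by fun_prop))) (hi (by fun_prop)).1
  · exact .eq (.termOn (by fun_prop)) (.prodMk (.fst (.termOn (by fun_prop))) (hi (by fun_prop)).2)
  · exact .eq (.snd (.termOn (by fun_prop))) (hi (by fun_prop)).2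
  · exact .eq (.termOn (by fun_prop)) (.prodMk (.fst (.termOn (by fun_prop))) (hi (by fun_prop)).1)

theorem IsPartialIso.congr {R S : On A → On A → Prop} {α β : On A} {P : Finset (On A × On A)}
    (hαβ : α ≤ β) (hP : ∀ p ∈ P, p.1 < β) (hRS : ∀ x y, y < β → (R x y ↔ S x y))
    (h : IsPartialIso D R α P) : IsPartialIso D S α P :=
  ⟨h.1, fun p hp q hq => ⟨(h.2.1 p hp q hq).1, by
    rw [← hRS _ _ (hP q hq), ← hRS _ _ ((h.1 q hq).1.trans_le hαβ)]
    exact (h.2.1 p hp q hq).2⟩, h.2.2⟩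

variable (D) in
/-- The relation `≤₁` on the ordinals of an admissible set. -/
def LeOneOn (α β : On A) : Prop := D.LeOne α.1 β.1

/-- The relation `≤₁` in terms of finite graphs. -/
theorem leOneOn_iff (α β : On A) : LeOneOn D α β ↔ α ≤ β ∧ ∀ Z,
    Z ∈ {Z : Finset (On A) | (Z : Set (On A)) ⊆ {γ | γ < β}} → ∃ P,
      P ∈ {P : Finset (On A × On A) | (P : Set (On A × On A)) ⊆ (Z : Set (On A)) ×ˢ {γ | γ < α}} ∧
      (∀ z, z ∈ (Z : Set (On A)) → ∃ p, p ∈ (P : Set (On A × On A)) ∧ p.1 = z) ∧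
      IsPartialIso D (LeOneOn D) α P := by
  rw [LeOneOn, leOne_iff]
  refine and_congr Iff.rfl ?_
  constructor
  · intro h Z hZ
    let Z' : Set Ordinal.{u} := Subtype.val '' (Z : Set (On A))
    have hZ' : Z'.Finite := Z.finite_toSet.image _
    have hZβ : ∀ x ∈ Z', x < β.1 := by
      rintro _ ⟨z, hz, rfl⟩
      exact hZ hz
    obtain ⟨Y', -, hY', f, hf, hfX⟩ := h (Z' ∩ Set.Iio α.1) (Z' \ Set.Iio α.1)
      (hZ'.inter_of_left _) hZ'.sdiff Set.inter_subset_right fun x hx => ⟨hZβ x hx.1, hx.2⟩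
    rw [Set.inter_union_sdiff] at hf
    have hfα : ∀ x ∈ Z', f x < α.1 := fun x hx => by
      rcases hf.bijOn.mapsTo hx with h | h
      exacts [h.2, hY' h]
    have hmono : StrictMonoOn f Z' := fun x hx y hy hxy => by
      rw [← not_le, ← hf.le_iff y hy x hx, not_le]
      exact hxy
    have hterm := (represents_iff_iff hmono).1 hf.represents_iff
    have hval : ∀ z ∈ Z, z.1 ∈ Z' := fun z hz => ⟨z, hz, rfl⟩
    have hF : ∀ z : On A, ∃ w : On A, z ∈ Z → w.1 = f z.1 := fun z => by
      by_cases hz : z ∈ Z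
      · exact ⟨⟨f z.1, On.mem_of_lt (hfα _ (hval z hz)) α.2⟩, fun _ => rfl⟩
      · exact ⟨z, fun h => (hz h).elim⟩
    choose F hF using hF
    have hFimage : ∀ C : Finset (On A), (C : Set (On A)) ⊆ Z →
        (C.image F).image Subtype.val = (C.image Subtype.val).image f := fun C hC => by
      rw [Finset.image_image, Finset.image_image]
      exact Finset.image_congr fun z hz => hF z (hC hz)
    -- The compatibility with terms, for elements of the admissible set.
    have hterm' : ∀ z ∈ Z, ∀ σ : On A, ∀ C : Finset (On A), (C : Set (On A)) ⊆ Z →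
        (termOn D z = (σ, C) ↔ termOn D (F z) = (σ, C.image F)) := fun z hz σ C hC => by
      rw [← onTerm_injective.eq_iff, ← onTerm_injective.eq_iff (a := termOn D (F z)),
        onTerm_termOn, onTerm_termOn, hF z hz]
      rw [hterm z.1 (hval z hz) (onTerm (σ, C)) (by
        intro x hx
        obtain ⟨w, hw, rfl⟩ := Finset.mem_image.1 hx
        exact hval w (hC hw))]
      rw [onTerm, onTerm]
      dsimp only
      rw [hFimage C hC]
    have hP : ∀ p, p ∈ Z.image (fun z => (z, F z)) ↔ p.1 ∈ Z ∧ p.2 = F p.1 := by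
      rintro ⟨z, w⟩
      simp only [Finset.mem_image, Prod.mk.injEq]
      constructor
      · rintro ⟨z, hz, rfl, rfl⟩
        exact ⟨hz, rfl⟩
      · rintro ⟨hz, rfl⟩
        exact ⟨z, hz, rfl, rfl⟩
    have hle : ∀ z ∈ Z, F z < α := fun z hz => by
      rw [← Subtype.coe_lt_coe, hF z hz]
      exact hfα _ (hval z hz)
    refine ⟨Z.image fun z => (z, F z), ?_, ?_, ?_, ?_, ?_⟩
    · rintro p hp
      obtain ⟨h1, h2⟩ := (hP p).1 hp
      exact ⟨h1, h2 ▸ hle _ h1⟩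
    · exact fun z hz => ⟨(z, F z), (hP _).2 ⟨hz, rfl⟩, rfl⟩
    · rintro ⟨z, w⟩ hp
      obtain ⟨h1, rfl⟩ : z ∈ Z ∧ w = F z := (hP (z, w)).1 hp
      refine ⟨hle _ h1, fun h2 => Subtype.ext ?_⟩
      dsimp only
      rw [hF z h1]
      exact hfX _ ⟨hval z h1, h2⟩
    · rintro ⟨z, w⟩ hp ⟨z', w'⟩ hp'
      obtain ⟨h1, rfl⟩ : z ∈ Z ∧ w = F z := (hP (z, w)).1 hp
      obtain ⟨h1', rfl⟩ : z' ∈ Z ∧ w' = F z' := (hP (z', w')).1 hp'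
      dsimp only [LeOneOn]
      rw [← Subtype.coe_le_coe, ← Subtype.coe_le_coe, hF z h1, hF z' h1']
      exact ⟨hf.le_iff _ (hval z h1) _ (hval z' h1'), hf.rel_iff _ (hval z h1) _ (hval z' h1')⟩
    · rintro ⟨z, w⟩ hp Q hQ
      obtain ⟨h1, rfl⟩ : z ∈ Z ∧ w = F z := (hP (z, w)).1 hp
      have h2 : Q.image Prod.snd = (Q.image Prod.fst).image F := by
        rw [Finset.image_image]
        exact Finset.image_congr fun q hq => ((hP q).1 (hQ hq)).2
      have h3 : ((Q.image Prod.fst : Finset (On A)) : Set (On A)) ⊆ Z := by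
        intro x hx
        obtain ⟨q, hq, rfl⟩ := Finset.mem_image.1 hx
        exact ((hP q).1 (hQ hq)).1
      rw [h2]
      constructor
      · intro h4
        exact (hterm' z h1 _ _ h3).1 (Prod.ext rfl h4)
      · intro h4
        exact (hterm' z h1 _ _ h3).2 (Prod.ext rfl h4)
  · intro h X Y hX hY hXα hYβ
    have hαβ : α.1 ≤ β.1 ∨ Y = ∅ := by
      rcases Y.eq_empty_or_nonempty with h | ⟨y, hy⟩
      · exact .inr h
      · exact .inl ((not_lt.1 (hYβ hy).2).trans (hYβ hy).1.le)
    rcases hαβ with hαβ | rfl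
    swap
    · exact ⟨∅, Set.finite_empty, Set.empty_subset _, id, .refl, fun _ _ => rfl⟩
    have hXYβ : ∀ x ∈ X ∪ Y, x < β.1 := by
      rintro x (hx | hx)
      exacts [lt_of_lt_of_le (hXα hx) hαβ, (hYβ hx).1]
    classical
    obtain ⟨P, hPZ, hP1, hP2, hP3, hP4⟩ := h ((hX.union hY).toFinset.subtype _) (by
      intro z hz
      have h1 : z.1 ∈ (hX.union hY).toFinset := Finset.mem_subtype.1 hz
      exact hXYβ _ ((Set.Finite.mem_toFinset _).1 h1))
    have hZ : ∀ z : On A, z ∈ (hX.union hY).toFinset.subtype (fun x : Ordinal.{u} => x.toZFSet ∈ A)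
        ↔ z.1 ∈ X ∪ Y := fun z => by
      rw [Finset.mem_subtype, Set.Finite.mem_toFinset]
    have hf : ∀ x : Ordinal.{u}, ∃ y : Ordinal.{u}, x ∈ X ∪ Y → ∃ p ∈ P, p.1.1 = x ∧ p.2.1 = y :=
      fun x => by
        by_cases hx : x ∈ X ∪ Y
        · obtain ⟨p, hp, h1⟩ := hP1 ⟨x, On.mem_of_lt (hXYβ x hx) β.2⟩ ((hZ _).2 hx)
          exact ⟨p.2.1, fun _ => ⟨p, hp, congrArg Subtype.val h1, rfl⟩⟩
        · exact ⟨x, fun h => (hx h).elim⟩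
    choose f hf using hf
    have hPf : ∀ p ∈ P, p.2.1 = f p.1.1 ∧ p.1.1 ∈ X ∪ Y := fun p hp => by
      have h1 : p.1.1 ∈ X ∪ Y := (hZ _).1 (hPZ hp).1
      obtain ⟨q, hq, h2, h3⟩ := hf _ h1
      refine ⟨?_, h1⟩
      rw [← h3]
      have h4 := Subtype.ext h2
      exact congrArg Subtype.val (le_antisymm ((hP3 p hp q hq).1.1 h4.ge)
        ((hP3 q hq p hp).1.1 h4.le))
    have hfX : ∀ x ∈ X, f x = x := fun x hx => by
      obtain ⟨p, hp, rfl, h2⟩ := hf x (.inl hx)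
      rw [← h2]
      exact congrArg Subtype.val ((hP2 p hp).2 (hXα hx))
    have hle : ∀ x ∈ X ∪ Y, ∀ y ∈ X ∪ Y, x ≤ y ↔ f x ≤ f y := fun x hx y hy => by
      obtain ⟨p, hp, rfl, h2⟩ := hf x hx
      obtain ⟨q, hq, rfl, h3⟩ := hf y hy
      rw [← h2, ← h3]
      exact (hP3 p hp q hq).1
    have hmono : StrictMonoOn f (X ∪ Y) := fun x hx y hy hxy => by
      rw [← not_le, ← hle y hy x hx, not_le]
      exact hxy
    have himg : f '' (X ∪ Y) = X ∪ f '' Y := by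
      rw [Set.image_union, Set.image_congr hfX, Set.image_id']
    refine ⟨f '' Y, hY.image f, ?_, f, ⟨?_, hle, ?_, ?_⟩, hfX⟩
    · rintro _ ⟨y, hy, rfl⟩
      obtain ⟨p, hp, -, h2⟩ := hf y (.inr hy)
      rw [← h2]
      exact (hP2 p hp).1
    · rw [← himg]
      exact hmono.injOn.bijOn_image
    · intro x hx y hy
      obtain ⟨p, hp, rfl, h2⟩ := hf x hx
      obtain ⟨q, hq, rfl, h3⟩ := hf y hy
      rw [← h2, ← h3]
      exact (hP3 p hp q hq).2
    · refine (represents_iff_iff hmono).2 fun x hx p hp => ?_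
      obtain ⟨r, hr, rfl, h2⟩ := hf x hx
      -- The arguments of the term, together with their images.
      let Q : Finset (On A × On A) := P.filter fun q => q.1.1 ∈ p.2
      have hQ : (Q.image Prod.fst).image Subtype.val = p.2 := by
        ext y
        simp only [Q, Finset.image_image, Finset.mem_image, Finset.mem_filter, Function.comp_apply]
        constructor
        · rintro ⟨q, ⟨-, h⟩, rfl⟩
          exact h
        · intro hy
          obtain ⟨q, hq, rfl, -⟩ := hf y (hp hy)
          exact ⟨q, ⟨hq, hy⟩, rfl⟩
      have hQ' : (Q.image Prod.snd).image Subtype.val = p.2.image f := by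
        rw [← hQ, Finset.image_image, Finset.image_image, Finset.image_image]
        exact Finset.image_congr fun q hq => (hPf q (Finset.mem_filter.1 hq).1).1
      obtain ⟨h3, h4⟩ := hP4 r hr Q (Finset.filter_subset _ _)
      rw [← h2, ← onTerm_termOn, ← onTerm_termOn]
      constructor
      · intro h5
        have h6 : (termOn D r.1).2 = Q.image Prod.fst :=
          Finset.image_injective Subtype.val_injective ((congrArg Prod.snd h5).trans hQ.symm)
        rw [h3 h6]
        exact Prod.ext (show (termOn D r.1).1.1 = p.1 from congrArg Prod.fst h5) hQ'
      · intro h5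
        have h6 : (termOn D r.2).2 = Q.image Prod.snd :=
          Finset.image_injective Subtype.val_injective ((congrArg Prod.snd h5).trans hQ'.symm)
        rw [h4 h6]
        exact Prod.ext (show (termOn D r.2).1.1 = p.1 from congrArg Prod.fst h5) hQ

/-- The recursion that defines `≤₁` can be carried out in an admissible set: for each `β`, it yields
the set of all `α` with `α ≤₁ β`. -/
theorem leOne_recursion : (∀ β : On A, ∃ S : ASet A (On A), ∀ α, α ∈ S ↔ LeOneOn D α β) ∧
    SigmaPred A (fun p : On A × ASet A (On A) => ∀ α, α ∈ p.2 ↔ LeOneOn D α p.1) := by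
  -- The relation `≤₁` that is coded by a function on the ordinals.
  let R : ASet A (On A × ASet A (On A)) → On A → On A → Prop := fun g x y =>
    ∃ z, z ∈ {z | z ∈ g} ∧ z.1 = y ∧ x ∈ z.2
  have hR : SigmaFun A (fun p : ASet A (On A × ASet A (On A)) × On A × On A =>
      R p.1 p.2.1 p.2.2) :=
    .bex (SigmaFun.sigmaSet (by fun_prop)) (.and (by fun_prop)
      (.mem_aset (by fun_prop) (by fun_prop)))
  have h1 : SigmaSet A (fun p : On A × ASet A (On A × ASet A (On A)) =>
      {α : On A | α ∈ {α | α < p.1} ∪ {p.1} ∧ ∀ Z,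
        Z ∈ {Z : Finset (On A) | (Z : Set (On A)) ⊆ {γ | γ < p.1}} → ∃ P,
        P ∈ {P : Finset (On A × On A) |
          (P : Set (On A × On A)) ⊆ (Z : Set (On A)) ×ˢ {γ | γ < α}} ∧
        (∀ z, z ∈ (Z : Set (On A)) → ∃ p, p ∈ (P : Set (On A × On A)) ∧ p.1 = z) ∧
        IsPartialIso D (R p.2) α P}) := by
    refine .sep (.union (.iio (by fun_prop)) (.singleton (by fun_prop)))
      (.ball (.finset_subsets (.iio (by fun_prop))) (.bex (.finset_subsets (.prod
        (.coe (by fun_prop)) (.iio (by fun_prop)))) (.and (.ball (.coe (by fun_prop))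
        (.bex (.coe (by fun_prop)) (by fun_prop))) (.isPartialIso ?_ (by fun_prop)
          (by fun_prop)))))
    exact hR.comp (f := fun p : ((((On A × ASet A (On A × ASet A (On A))) × On A) × Finset (On A)) ×
      Finset (On A × On A)) × On A × On A => (p.1.1.1.1.2, p.2.1, p.2.2)) (by fun_prop)
  obtain ⟨F, hF, hF'⟩ := h1
  refine sigma_recursion (r := fun a b : On A => a < b) wellFounded_lt
    (SigmaSet.iio (f := fun β : On A => β) (by fun_prop)) (fun _ _ h => h)
    (G := fun β (S : ASet A (On A)) => ∀ α, α ∈ S ↔ LeOneOn D α β) ?_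
    (Ψ := fun β S g => S = F (β, g)) (SigmaFun.sigmaPred (by fun_prop)) ?_
  · exact fun β S S' h h' => ASet.ext fun α => (h α).trans (h' α).symm
  · intro β g hg hb
    refine ⟨⟨_, rfl⟩, ?_⟩
    rintro _ rfl α
    have hRL : ∀ x y, y < β → (R g x y ↔ LeOneOn D x y) := fun x y hy => by
      constructor
      · rintro ⟨⟨y, S⟩, hz, rfl, hx⟩
        exact (((hg _).1 hz).2 x).1 hx
      · intro h
        obtain ⟨S, hS⟩ := hb y hy
        exact ⟨(y, S), (hg _).2 ⟨hy, hS⟩, rfl, (hS x).2 h⟩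
    rw [hF', leOneOn_iff]
    have hle : α ∈ {α | α < β} ∪ {β} ↔ α ≤ β := by
      rw [le_iff_lt_or_eq]
      rfl
    refine (and_congr_left fun _ => hle).trans (and_congr_right fun hαβ => ?_)
    refine forall₂_congr fun Z hZ => exists_congr fun P => and_congr_right fun hP =>
      and_congr_right fun _ => ?_
    exact ⟨.congr hαβ (fun p hp => hZ (hP hp).1) hRL,
      .congr hαβ (fun p hp => hZ (hP hp).1) fun x y hy => (hRL x y hy).symm⟩

theorem SigmaFun.leOne {f g : T → On A} (hf : SigmaFun A f) (hg : SigmaFun A g) :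
    SigmaFun A (fun t => LeOneOn D (f t) (g t)) := by
  obtain ⟨h1, h2⟩ := leOne_recursion (A := A) (D := D)
  have h3 : SigmaFun A (fun p : On A × On A => LeOneOn D p.1 p.2) := by
    have h4 : ∀ {Q : (On A × On A) × ASet A (On A) → Prop}, SigmaFun A Q →
        SigmaPred A (fun p : On A × On A => ∃ S : ASet A (On A),
          (∀ α, α ∈ S ↔ LeOneOn D α p.2) ∧ Q (p, S)) := fun hQ =>
      .ex (.and (h2.comp (f := fun q : (On A × On A) × ASet A (On A) => (q.1.2, q.2))
        (by fun_prop)) hQ.sigmaPred)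
    refine .of_sigmaPred ((h4 (Q := fun q => q.1.1 ∈ q.2) (.mem_aset (by fun_prop)
      (by fun_prop))).of_iff fun p => ?_) ((h4 (Q := fun q => ¬ q.1.1 ∈ q.2)
      (.not (.mem_aset (by fun_prop) (by fun_prop)))).of_iff fun p => ?_)
    · constructor
      · intro h
        obtain ⟨S, hS⟩ := h1 p.2
        exact ⟨S, hS, (hS _).2 h⟩
      · rintro ⟨S, hS, h⟩
        exact (hS _).1 h
    · constructor
      · intro h
        obtain ⟨S, hS⟩ := h1 p.2
        exact ⟨S, hS, fun h' => h ((hS _).1 h')⟩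
      · rintro ⟨S, hS, h⟩ h'
        exact h ((hS _).2 h')
  exact h3.comp (f := fun t => (f t, g t)) (by fun_prop)

end Admissible

/-! ### Reflection below the height of an admissible set -/

namespace Admissible

open KripkePlatek PreDilator NormalDilator

variable {A : ZFSet.{u}} [AdmOmega A]
variable {T U W V : Type*} [Coded A T] [Coded A U] [Coded A W] [Coded A V]

/-- The iteration of a recursive unbounded property along `ω` stays below the height of an
admissible set. -/
theorem exists_iterate {ρ : On A} {P : On A → On A → Prop}
    (hP : SigmaFun A (fun p : On A × On A => P p.1 p.2)) (h : ∀ κ, ρ < κ → ∃ β, P κ β)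
    (hlt : ∀ κ β, P κ β → κ < β) :
    ∃ (d : ℕ → On A) (δ : On A), ρ < d 0 ∧ (∀ n, P (d n) (d (n + 1))) ∧ (∀ n, d n < δ) ∧
      ∀ γ < δ, ∃ n, γ < d n := by
  have hex : ∀ κ, ∃ β, IsLeast {β | ρ < κ → P κ β} β := fun κ => by
    have hne : {β | ρ < κ → P κ β}.Nonempty := by
      by_cases hκ : ρ < κ
      · obtain ⟨β, hβ⟩ := h κ hκ
        exact ⟨β, fun _ => hβ⟩
      · exact ⟨κ, fun h => (hκ h).elim⟩
    exact ⟨_, WellFounded.min_mem wellFounded_lt _ hne,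
      fun β hβ => WellFounded.min_le wellFounded_lt hβ⟩
  choose step hstep using hex
  have hstep' : SigmaFun A step :=
    .least (P := fun κ β => ρ < κ → P κ β) (.imp (by fun_prop) hP) hstep
  let ρ' : On A := ⟨_, ρ.succ_mem⟩
  let d : ℕ → On A := fun n => Nat.rec (motive := fun _ => On A) ρ' (fun _ => step) n
  have hd : SigmaFun A d := (SigmaFun.natRec (T := ℕ) (f := fun _ => ρ')
    (h := fun _ _ => step) (by fun_prop) (by fun_prop)).comp (f := fun n : ℕ => (n, n))
      (by fun_prop)
  have hρd : ∀ n, ρ < d n ∧ P (d n) (d (n + 1)) := fun n => by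
    have key : ∀ n, ρ < d n → P (d n) (d (n + 1)) := fun n hn => (hstep (d n)).1 hn
    have hn : ρ < d n := by
      induction n with
      | zero => exact lt_add_one ρ.1
      | succ n ih => exact ih.trans (hlt _ _ (key n ih))
    exact ⟨hn, key n hn⟩
  obtain ⟨S, hS⟩ := (SigmaSet.image (T := ℕ) SigmaSet.nat (f := fun _ n => d n)
    (by fun_prop)).choose 0
  obtain ⟨β, hβ⟩ := S.exists_bound
  obtain ⟨δ, hδ, hδ'⟩ := (wellFounded_lt (α := On A)).has_min {δ | ∀ n, d n < δ}
    ⟨β, fun n => hβ _ ((hS _).2 ⟨n, trivial, rfl⟩)⟩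
  refine ⟨d, δ, (hρd 0).1, fun n => (hρd n).2, hδ, fun γ hγ => ?_⟩
  by_contra! h'
  exact hδ' γ (fun n => (hlt _ _ (hρd n).2).trans_le (h' (n + 1))) hγ

variable {D : NormalDilator.{u}} [hD : Fact (D.toPreDilator.toSet ∈ A)]
variable {Ω : Ordinal.{u}}

/-- The height of an admissible set that contains `D` is a fixed point of `D`. -/
theorem value_height (hΩ : ∀ α : Ordinal.{u}, α < Ω ↔ α.toZFSet ∈ A) : D.value Ω = Ω := by
  have h0 : 0 < Ω := (hΩ 0).2 (On.zero_mem A)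
  refine le_antisymm (le_of_forall_lt fun γ hγ => ?_) (D.le_value Ω)
  obtain ⟨ρ, hρ, h⟩ := D.exists_lt_forall_arg_le h0 γ
  have h1 : γ < D.value (ρ + 1) := D.lt_value_iff.2 fun x hx =>
    Order.lt_add_one_iff.2 (h x hx (D.lt_value_iff.1 hγ x hx))
  exact h1.trans ((hΩ _).2 (value_mem (A := A) ⟨_, On.succ_mem ⟨ρ, (hΩ ρ).1 hρ⟩⟩))

/-- Replacing the argument `Ω` by smaller ordinals is recursive, even though `Ω` does not belong to
the admissible set: only the symbol and the other arguments are needed. -/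
theorem exists_sigmaFun_subst (hΩ : ∀ α : Ordinal.{u}, α < Ω ↔ α.toZFSet ∈ A) {t : Ordinal.{u}}
    (ht : Ω ≤ t) (ht' : t < D.value (Ω + 1)) :
    ∃ F : On A → On A, SigmaFun A F ∧ ∀ κ, (F κ).1 = D.subst Ω κ.1 t := by
  have hmem : Ω ∈ (D.term t).2 := by
    by_contra hmem
    have h1 : t < D.value Ω := D.lt_value_iff.2 fun x hx =>
      lt_of_le_of_ne (Order.lt_add_one_iff.1 (D.lt_value_iff.1 ht' x hx)) fun h => hmem (h ▸ hx)
    rw [value_height hΩ] at h1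
    exact absurd h1 (not_lt.2 ht)
  classical
  let σ : On A := ⟨(D.term t).1, On.mem_of_lt (D.isTerm_term t).1 (obj_mem A D.toPreDilator _)⟩
  let c : Finset (On A) := (D.term t).2.subtype _
  have hc : c.image Subtype.val = (D.term t).2.erase Ω := by
    ext x
    simp only [c, Finset.mem_image, Finset.mem_subtype, Subtype.exists, exists_and_left,
      exists_prop, exists_eq_right_right, Finset.mem_erase]
    constructor
    · rintro ⟨h1, h2⟩
      exact ⟨((hΩ x).2 h2).ne, h1⟩
    · rintro ⟨h1, h2⟩
      exact ⟨h2, (hΩ x).1 (lt_of_le_of_ne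
        (Order.lt_add_one_iff.1 (D.lt_value_iff.1 ht' x h2)) h1)⟩
  refine ⟨fun κ => valOn D (σ, c ∪ {κ}), .valOn (.prodMk (by fun_prop)
    (.finset_union (by fun_prop) (.finset_singleton (by fun_prop)))), fun κ => ?_⟩
  change D.val (onTerm _) = _
  rw [onTerm, Finset.image_union, hc, Finset.image_singleton, subst, ← Finset.insert_erase hmem,
    Finset.image_insert, move_self, Finset.erase_insert (Finset.notMem_erase _ _)]
  have : ((D.term t).2.erase Ω).image (move Ω κ.1) = (D.term t).2.erase Ω :=
    (Finset.image_congr fun x hx => move_of_ne (Finset.mem_erase.1 hx).1).trans Finset.image_id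
  rw [this, Finset.insert_eq, Finset.union_comm {κ.1}]

/-- Each ordinal `t` with largest argument `Ω` is reflected by fixed points `δ < Ω` of `D` such that
`δ ≤₁ t[Ω ↦ δ]`. By induction, smaller ordinals are reflected. Closing off under this reflection
leads to a `δ` to which `leOne_of_reflection` applies. -/
theorem exists_reflection (hΩ : ∀ α : Ordinal.{u}, α < Ω ↔ α.toZFSet ∈ A) (t : Ordinal.{u})
    (ht : Ω ≤ t) (ht' : t < D.value (Ω + 1)) (ρ : Ordinal.{u}) (hρ : ρ < Ω) :
    ∃ δ, ρ < δ ∧ δ < Ω ∧ D.value δ = δ ∧ D.Args Ω δ t ∧ D.LeOne δ (D.subst Ω δ t) := by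
  induction t using WellFoundedLT.induction generalizing ρ with
  | _ t ih =>
  have hΩ0 : 0 < Ω := (hΩ 0).2 (On.zero_mem A)
  have hΩv := value_height (D := D) hΩ
  obtain ⟨ρ₁, hρ₁, hargs⟩ := D.exists_lt_forall_arg_le hΩ0 t
  have hρ₂ := max_lt hρ hρ₁
  obtain ⟨F, hF, hFt⟩ := exists_sigmaFun_subst hΩ ht ht'
  have hA : ∀ {δ : Ordinal.{u}}, max ρ ρ₁ < δ → D.Args Ω δ t := fun hδ =>
    args_of_lt_value_succ ht' fun x hx hxΩ =>
      (hargs x hx hxΩ).trans_lt (lt_of_le_of_lt (le_max_right _ _) hδ)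
  -- The ordinal `β` bounds fixed points that reflect the terms below `t[Ω ↦ κ]`.
  let R : On A → On A → On A → Prop := fun κ ξ δ =>
    valueOn D κ ≤ ξ → κ < δ ∧ valueOn D δ = δ ∧ LeOneOn D δ (substOn D κ δ ξ)
  let P : On A → On A → Prop := fun κ β => κ < β ∧ valueOn D κ ≤ β ∧
    ∀ ξ, ξ ∈ {ξ | ξ < F κ} → ∃ δ, δ ∈ {δ | δ < β} ∧ R κ ξ δ
  have hR : SigmaFun A (fun p : On A × On A × On A => R p.1 p.2.1 p.2.2) :=
    .imp (.le (.valueOn (by fun_prop)) (by fun_prop)) (.and (by fun_prop) (.and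
      (.eq (.valueOn (by fun_prop)) (by fun_prop)) (.leOne (by fun_prop)
        (.substOn (by fun_prop) (by fun_prop) (by fun_prop)))))
  have hP : SigmaFun A (fun p : On A × On A => P p.1 p.2) := by
    refine .and (by fun_prop) (.and (.le (.valueOn (by fun_prop)) (by fun_prop))
      (.ball (.iio (by fun_prop)) (.bex (.iio (by fun_prop)) ?_)))
    exact hR.comp (f := fun p : ((On A × On A) × On A) × On A => (p.1.1.1, p.1.2, p.2))
      (by fun_prop)
  have hex : ∀ κ : On A, (⟨max ρ ρ₁, (hΩ _).1 hρ₂⟩ : On A) < κ → ∃ β, P κ β := by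
    intro κ hκ
    have hκt : D.Args Ω κ.1 t := hA hκ
    have hκΩ : κ.1 < Ω := (hΩ _).2 κ.2
    have hκt' : D.Args κ.1 Ω (D.subst Ω κ.1 t) := hκt.subst fun x _ hx => hx
    have h1 : ∀ ξ, ξ ∈ (On.iio (F κ)) → ∃ δ, R κ ξ δ := by
      intro ξ hξ
      rw [On.mem_iio, ← Subtype.coe_lt_coe, hFt] at hξ
      by_cases hκξ : valueOn D κ ≤ ξ
      swap
      · exact ⟨κ, fun h => (hκξ h).elim⟩
      have hξa : D.Args κ.1 Ω ξ.1 := args_of_lt_value_succ (hξ.trans (subst_lt_value hκt))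
        fun x _ hx => hx.trans hκΩ
      have h2 : D.subst κ.1 Ω ξ.1 < t := by
        have := (subst_lt_subst hξa hκt').2 hξ
        rwa [subst_subst hκt, subst_self] at this
      have h3 : Ω ≤ D.subst κ.1 Ω ξ.1 := by
        have := (subst_le_subst (args_value κ.1 Ω) hξa).2 hκξ
        rwa [subst_value, hΩv] at this
      obtain ⟨δ, h4, h5, h6, -, h7⟩ := ih _ h2 h3 (h2.trans ht') κ.1 hκΩ
      refine ⟨⟨δ, (hΩ δ).1 h5⟩, fun _ => ⟨h4, Subtype.ext h6, ?_⟩⟩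
      rw [LeOneOn, substOn_val]
      rwa [subst_subst hξa] at h7
    -- By collection, there is a bound on the fixed points that the induction hypothesis provides.
    obtain ⟨B, hB, -⟩ := ASet.exists_collect (R := R κ)
      (hR.comp (f := fun p : On A × On A => (κ, p.1, p.2)) (by fun_prop)).sigmaPred _ h1
    obtain ⟨β, hβ⟩ := B.exists_bound
    refine ⟨max β (max ⟨_, κ.succ_mem⟩ (valueOn D κ)), ?_, ?_, fun ξ hξ => ?_⟩
    · have h2 : κ < ⟨_, κ.succ_mem⟩ := lt_add_one κ.1
      exact h2.trans_le ((le_max_left _ _).trans (le_max_right _ _))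
    · exact (le_max_right _ _).trans (le_max_right _ _)
    · obtain ⟨δ, hδ, h2⟩ := hB ξ (On.mem_iio.2 hξ)
      exact ⟨δ, (hβ δ hδ).trans_le (le_max_left _ _), h2⟩
  obtain ⟨d, δ, hd0, hd, hdδ, hδ⟩ := exists_iterate hP hex fun κ β h => h.1
  have hmono : StrictMono d := strictMono_nat_of_lt_succ fun n => (hd n).1
  have hρd : ∀ n, max ρ ρ₁ < (d n).1 := fun n =>
    lt_of_lt_of_le (show _ < (d 0).1 from hd0) (hmono.monotone (Nat.zero_le n))
  have hρδ : max ρ ρ₁ < δ.1 := (hρd 0).trans (hdδ 0)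
  have hδ0 : 0 < δ.1 := pos_of_gt hρδ
  have hδΩ : δ.1 < Ω := (hΩ _).2 δ.2
  have hlim : ∀ γ < δ.1, ∃ n, γ < (d n).1 := fun γ hγ => hδ ⟨γ, On.mem_of_lt hγ δ.2⟩ hγ
  have hδv : D.value δ.1 = δ.1 := by
    refine le_antisymm (le_of_forall_lt fun γ hγ => ?_) (D.le_value _)
    obtain ⟨ρ', hρ', h1⟩ := D.exists_lt_forall_arg_le hδ0 γ
    obtain ⟨n, hn⟩ := hlim ρ' hρ'
    have h2 : γ < D.value (d n).1 := D.lt_value_iff.2 fun x hx =>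
      (h1 x hx (D.lt_value_iff.1 hγ x hx)).trans_lt hn
    exact (h2.trans_le (hd n).2.1).trans (hdδ (n + 1))
  have hδt := hA hρδ
  refine ⟨δ.1, (le_max_left _ _).trans_lt hρδ, hδΩ, hδv, hδt,
    leOne_of_reflection hδ0 hδv _ ?_ (subst_lt_value hδt).le ?_⟩
  · have := (subst_le_subst (args_value Ω δ.1) hδt).2 (hΩv.symm ▸ ht)
    rwa [subst_value, hδv] at this
  · intro s hs hst ρ' hρ'
    obtain ⟨ρ₃, hρ₃, h1⟩ := D.exists_lt_forall_arg_le hδ0 s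
    obtain ⟨n, hn⟩ := hlim _ (max_lt hρ' hρ₃)
    have hs' : s < D.value (δ.1 + 1) := hst.trans (subst_lt_value hδt)
    have hsargs : ∀ {ε : Ordinal.{u}}, (d n).1 ≤ ε → D.Args δ.1 ε s := fun hε =>
      args_of_lt_value_succ hs' fun x hx hxδ =>
        ((h1 x hx hxδ).trans_lt (lt_of_le_of_lt (le_max_right _ _) hn)).trans_le hε
    have hsn := hsargs le_rfl
    have h2 : D.value (d n).1 ≤ D.subst δ.1 (d n).1 s := by
      have := (subst_le_subst (args_value δ.1 (d n).1) hsn).2 (hδv.symm ▸ hs)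
      rwa [subst_value] at this
    have h3 : D.subst δ.1 (d n).1 s < D.subst Ω (d n).1 t := by
      have := (subst_lt_subst hsn (hδt.subst fun x hx hxΩ => (hargs x hx hxΩ).trans_lt
        (lt_of_le_of_lt (le_max_right _ _) (hρd n)))).2 hst
      rwa [subst_subst hδt] at this
    rw [← hFt] at h3
    -- The closure property of `d (n + 1)` applies to the copy `s[δ ↦ d n]` of `s`.
    obtain ⟨ε, hε, h4⟩ := (hd n).2.2 ⟨_, On.mem_of_lt h3 (F (d n)).2⟩ h3
    obtain ⟨h5, h6, h7⟩ := h4 h2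
    refine ⟨ε.1, ((le_max_left _ _).trans_lt hn).trans h5,
      (show ε.1 < (d (n + 1)).1 from hε).trans (hdδ (n + 1)), congrArg Subtype.val h6,
      hsargs (show (d n).1 < ε.1 from h5).le, ?_⟩
    rw [LeOneOn, substOn_val] at h7
    dsimp only at h7
    rwa [subst_subst hsn] at h7

end Admissible

open Admissible in
theorem mainTheorem3 (D : NormalDilator.{u}) (A : ZFSet.{u}) (hA : IsAdmissibleSet A)
    (hD : D.toPreDilator.toSet ∈ A) (Ω : Ordinal.{u})
    (hΩ : Ω.toZFSet = A.sep ZFSet.IsOrdinal) :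
    D.LeOne Ω (D.value (Ω + 1)) := by
  have : Adm A := ⟨hA⟩
  have : AdmOmega A := ⟨omega_mem_of_toSet_mem hD⟩
  have : Fact (D.toPreDilator.toSet ∈ A) := ⟨hD⟩
  have hΩ' : ∀ α : Ordinal.{u}, α < Ω ↔ α.toZFSet ∈ A := fun α => by
    rw [← Ordinal.toZFSet_mem_toZFSet_iff, hΩ, ZFSet.mem_sep]
    exact and_iff_left (ZFSet.isOrdinal_toZFSet α)
  have h0 : 0 < Ω := (hΩ' 0).2 (On.zero_mem A)
  exact NormalDilator.leOne_of_reflection h0 (value_height hΩ') _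
    ((lt_add_one Ω).le.trans (D.le_value _)) le_rfl
    fun s hs hs' ρ hρ => exists_reflection hΩ' s hs hs' ρ hρ
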